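/- Let $d\ge 2$ and let $T$ be a tiling of $\mathbb{R}^d$: a cover of $\mathbb{R}^d$ by compact, possibly labelled, $d$-dimensional polyhedral sets (finite unions of convex polytopes with non-empty interior; tilings that are not face to face are allowed) which meet only on their boundaries and of which, up to translation, there are only finitely many. Suppose that $T$ is periodic, i.e. that its translational symmetries span $\mathbb{R}^d$, and that $T$ has point group $G$: $G\le \mathrm{SO}(d)$ is a finite subgroup such that for every finite patch $P\subset T$ and $g\in G$ a translate of $g(P)$ is a patch of $T$, and for some $r>0$ every $g\in\mathrm{SO}(d)$ that takes the set of the tiles meeting some closed ball of radius $r$ to a patch of $T$, up to translation, lies in $G$. Notation. Let $\Lambda$ be the group of translational symmetries of $T$, and $\Gamma_+$ the positive space group, the group of all orientation preserving isometries of $\mathbb{R}^d$ that preserve $T$. Let $\mathrm{Sp}(d)$ be the universal covering group of $\mathrm{SO}(d)$, $\widetilde G\le\mathrm{Sp}(d)$ the preimage of $G$, and $q\colon\widetilde G\to G$ the quotient map. A tiling is locally indistinguishable from $T$ if each of its finite patches is, up to translation, a patch of $T$. The translational hull $\Omega_t$ is the space of tilings locally indistinguishable from $T$, and the rotational hull $\Omega_r$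 is the space of tilings some rotate of which (about the origin) is locally indistinguishable from $T$; two tilings are close if, after a small rigid motion of one of them, they agree on a large ball about the origin. $T$ is the base point of both. Then: 1. $\Lambda\cong\mathbb{Z}^d$, and the inclusion of $\Lambda$ and the map that takes a symmetry to its rotational part form an extension $\Lambda\to\Gamma_+\to G$ (the standard extension). 2. There is a continuous map $\theta\colon\Omega_r\to\mathrm{Sp}(d)/\widetilde G$ with $\theta(s\cdot T')=[s]$ for $T'\in\Omega_t$ and $s\in\mathrm{Sp}(d)$ (acting through $\mathrm{SO}(d)$). There are isomorphisms $\Lambda\cong\pi_1(\Omega_t,T)$, taking $v$ to the class of the loop $t\mapsto T+tv$, and $\pi_1(\mathrm{Sp}(d)/\widetilde G)\cong\widetilde G$, taking the image of a path in $\mathrm{Sp}(d)$ from $1$ to $g\in\widetilde G$ to $g$. With these, the inclusion $\Omega_t\to\Omega_r$ and $\theta$ induce an extension $\Lambda\to\pi_1(\Omega_r,T)\to\widetilde G$. 3. This extension is isomorphic, as an extension of $\widetilde G$ by $\Lambda$, to the pullback of the standard extension along $q$, i.e. to $\Lambda\to\Gamma_+\times_G\widetilde G\to\widetilde G$. 4.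 Consequently, the resulting map $\pi_1(\Omega_r,T)\cong\Gamma_+\times_G\widetilde G\to\Gamma_+$ is surjective, with kernel isomorphic to $\mathbb{Z}$ if $d=2$ and to $\mathbb{Z}/2$ if $d\ge3$: $\pi_1(\Omega_r,T)$ is a group extension of $\Gamma_+$ by $\mathbb{Z}$, respectively by $\mathbb{Z}/2$. -/

import Mathlib

open scoped Pointwise unitInterval Topology

noncomputable section

namespace TilingSpace

/-! ### The universal covering group of a topological group -/

section UniversalCover

variable (H : Type*) [TopologicalSpace H] [Group H] [IsTopologicalGroup H]

/-- The topological group (compact-open topology, pointwise product) of all paths in `H`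
that start at the identity. -/
def BasedPaths : Subgroup C(I, H) where
  carrier := {γ | γ 0 = 1}
  one_mem' := by simp
  mul_mem' := by
    intro a b ha hb
    simp only [Set.mem_ofPred_eq] at ha hb ⊢
    simp [ha, hb]
  inv_mem' := by
    intro a ha
    simp only [Set.mem_ofPred_eq] at ha ⊢
    simp [ha]

variable {H}

theorem homotopicRel_mul {f₀ f₁ g₀ g₁ : C(I, H)} {S : Set I}
    (hf : f₀.HomotopicRel f₁ S) (hg : g₀.HomotopicRel g₁ S) :
    (f₀ * g₀).HomotopicRel (f₁ * g₁) S := by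
  obtain ⟨F⟩ := hf
  obtain ⟨K⟩ := hg
  have h : (f₀.prodMk g₀).HomotopicRel (f₁.prodMk g₁) S := ⟨ContinuousMap.HomotopyRel.prod F K⟩
  exact h.comp_continuousMap (⟨fun p : H × H => p.1 * p.2, continuous_mul⟩ : C(H × H, H))

theorem homotopicRel_inv {f₀ f₁ : C(I, H)} {S : Set I}
    (hf : f₀.HomotopicRel f₁ S) : (f₀⁻¹).HomotopicRel (f₁⁻¹) S :=
  hf.comp_continuousMap (⟨fun p : H => p⁻¹, continuous_inv⟩ : C(H, H))

variable (H)

/-- The normal subgroup of the loops at the identity that are null-homotopic relative to their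
end points. -/
def NullLoops : Subgroup (BasedPaths H) where
  carrier := {γ | (γ : C(I, H)).HomotopicRel 1 {0, 1}}
  one_mem' := ContinuousMap.HomotopicRel.refl _
  mul_mem' := by
    intro a b ha hb
    have h := homotopicRel_mul ha hb
    rw [one_mul] at h
    exact h
  inv_mem' := by
    intro a ha
    have h := homotopicRel_inv ha
    rw [inv_one] at h
    exact h

instance : (NullLoops H).Normal where
  conj_mem := by
    intro n hn g
    have h := homotopicRel_mul
      (homotopicRel_mul (ContinuousMap.HomotopicRel.refl (g : C(I, H))) hn)
      (homotopicRel_inv (ContinuousMap.HomotopicRel.refl (g : C(I, H))))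
    have e : (g : C(I, H)) * 1 * (g : C(I, H))⁻¹ = 1 := by group
    rw [e] at h
    exact h

/-- The universal covering group of `H` (for `H` connected and locally contractible, such as a
connected Lie group): homotopy classes, relative to the end points, of paths in `H` that start at
the identity, with pointwise multiplication and the quotient of the compact-open topology. -/
abbrev UniversalCover : Type _ := BasedPaths H ⧸ NullLoops H

variable {H}

/-- Two based paths have the same class exactly if they are homotopic relative to
their end points. -/
theorem UniversalCover.mk_eq_mk_iff (γ δ : BasedPaths H) :
    (QuotientGroup.mk γ : UniversalCover H) = QuotientGroup.mk δ ↔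
      (γ : C(I, H)).HomotopicRel (δ : C(I, H)) {0, 1} := by
  rw [QuotientGroup.eq]
  constructor
  · intro h
    have h' := homotopicRel_mul (ContinuousMap.HomotopicRel.refl (γ : C(I, H)))
      (ContinuousMap.HomotopicRel.symm h)
    have e : (γ : C(I, H)) * ((γ⁻¹ * δ : BasedPaths H) : C(I, H)) = δ := by
      push_cast
      group
    rw [e, mul_one] at h'
    exact h'
  · intro h
    have h' := homotopicRel_mul
      (homotopicRel_inv (ContinuousMap.HomotopicRel.refl (γ : C(I, H)))) h.symm
    rw [inv_mul_cancel] at h'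
    exact h'

/-- The covering homomorphism, which sends a class of paths to the common end point. -/
def UniversalCover.proj : UniversalCover H →* H :=
  QuotientGroup.lift (NullLoops H)
    { toFun := fun γ => (γ : C(I, H)) 1
      map_one' := rfl
      map_mul' := fun _ _ => rfl }
    (fun _ hγ => ContinuousMap.HomotopicRel.fst_eq_snd hγ (by simp))

end UniversalCover

/-! ### Euclidean space, rotations and rigid motions -/

/-- Euclidean space of dimension `d`. -/
abbrev Euc (d : ℕ) : Type := EuclideanSpace ℝ (Fin d)

/-- The special orthogonal group. -/
abbrev SO (d : ℕ) : Type := Matrix.specialOrthogonalGroup (Fin d) ℝ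

instance (d : ℕ) : IsTopologicalGroup (SO d) where
  continuous_mul := by
    refine Continuous.subtype_mk ?_ _
    fun_prop
  continuous_inv := by
    refine Continuous.subtype_mk ?_ _
    exact Continuous.star continuous_subtype_val

/-- `Sp(d)`, the universal covering group of `SO(d)`. -/
abbrev Sp (d : ℕ) : Type := UniversalCover (SO d)

/-- The lift of a subgroup `G` of `SO(d)` to `Sp(d)`. -/
def liftGroup {d : ℕ} (G : Subgroup (SO d)) : Subgroup (Sp d) := G.comap UniversalCover.proj

/-- The quotient homomorphism from the lift of `G` to `G`. -/
def liftProj {d : ℕ} (G : Subgroup (SO d)) : liftGroup G →* G where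
  toFun g := ⟨UniversalCover.proj (g : Sp d), g.2⟩
  map_one' := Subtype.ext (map_one _)
  map_mul' a b := Subtype.ext (map_mul UniversalCover.proj (a : Sp d) (b : Sp d))

/-- The group of rigid motions: all orientation preserving isometries of Euclidean space. -/
def RigidMotion (d : ℕ) : Subgroup (Euc d ≃ᵃⁱ[ℝ] Euc d) where
  carrier := {Φ | LinearMap.det (Φ.linearIsometryEquiv.toLinearEquiv : Euc d →ₗ[ℝ] Euc d) = 1}
  one_mem' := LinearMap.det_id
  mul_mem' := by
    intro a b ha hb
    have h := LinearMap.det_comp (a.linearIsometryEquiv.toLinearEquiv : Euc d →ₗ[ℝ] Euc d)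
      (b.linearIsometryEquiv.toLinearEquiv : Euc d →ₗ[ℝ] Euc d)
    rw [ha, hb, one_mul] at h
    exact h
  inv_mem' := by
    intro a ha
    have h := LinearEquiv.det_mul_det_symm a.linearIsometryEquiv.toLinearEquiv
    rw [ha, one_mul] at h
    exact h

/-- The linear isometry of Euclidean space given by a rotation matrix. -/
def rotationLinear {d : ℕ} (A : SO d) : Euc d ≃ₗᵢ[ℝ] Euc d :=
  Unitary.linearIsometryEquiv
    ⟨Matrix.toEuclideanCLM (n := Fin d) (𝕜 := ℝ) A, Unitary.map_mem _ A.2.1⟩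

/-- The rotation about the origin given by a rotation matrix, as a rigid motion. -/
def rotationMotion {d : ℕ} : SO d →* RigidMotion d where
  toFun A := ⟨(rotationLinear A).toAffineIsometryEquiv,
    (LinearMap.det_toLpLin 2 (A : Matrix (Fin d) (Fin d) ℝ)).trans A.2.2⟩
  map_one' := by
    refine Subtype.ext (AffineIsometryEquiv.ext fun x => ?_)
    change Matrix.toEuclideanCLM (n := Fin d) (𝕜 := ℝ) 1 x = x
    rw [map_one]
    rfl
  map_mul' A B := by
    refine Subtype.ext (AffineIsometryEquiv.ext fun x => ?_)
    change Matrix.toEuclideanCLM (n := Fin d) (𝕜 := ℝ)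
      ((A : Matrix (Fin d) (Fin d) ℝ) * (B : Matrix (Fin d) (Fin d) ℝ)) x = _
    rw [map_mul]
    rfl

/-- The rotation matrix of the linear part of a rigid motion. -/
def rotationPart {d : ℕ} : RigidMotion d →* SO d where
  toFun Φ := ⟨(Matrix.toEuclideanCLM (n := Fin d) (𝕜 := ℝ)).symm
      (Unitary.linearIsometryEquiv.symm (Φ : Euc d ≃ᵃⁱ[ℝ] Euc d).linearIsometryEquiv : Euc d →L[ℝ] Euc d),
    by
      have hu := (Unitary.linearIsometryEquiv.symm
        (Φ : Euc d ≃ᵃⁱ[ℝ] Euc d).linearIsometryEquiv).2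
      refine ⟨Unitary.map_mem (S := Matrix (Fin d) (Fin d) ℝ)
        (Matrix.toEuclideanCLM (n := Fin d) (𝕜 := ℝ)).symm hu, ?_⟩
      change Matrix.det _ = 1
      rw [← LinearMap.det_toLpLin 2, ← Matrix.coe_toEuclideanCLM_eq_toEuclideanLin,
        StarAlgEquiv.apply_symm_apply]
      exact Φ.2⟩
  map_one' := by
    refine Subtype.ext ?_
    exact map_one (Matrix.toEuclideanCLM (n := Fin d) (𝕜 := ℝ)).symm
  map_mul' Φ Ψ := by
    refine Subtype.ext ?_
    exact map_mul (Matrix.toEuclideanCLM (n := Fin d) (𝕜 := ℝ)).symm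
      ((Φ : Euc d ≃ᵃⁱ[ℝ] Euc d).linearIsometryEquiv : Euc d →L[ℝ] Euc d)
      ((Ψ : Euc d ≃ᵃⁱ[ℝ] Euc d).linearIsometryEquiv : Euc d →L[ℝ] Euc d)

/-- The translation by a vector, as a rigid motion. -/
def translationMotion {d : ℕ} : Multiplicative (Euc d) →* RigidMotion d where
  toFun v := ⟨AffineIsometryEquiv.constVAdd ℝ (Euc d) v.toAdd, LinearMap.det_id⟩
  map_one' := Subtype.ext (AffineIsometryEquiv.constVAdd_zero)
  map_mul' v w := by
    refine Subtype.ext (AffineIsometryEquiv.ext fun x => ?_)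
    exact add_vadd v.toAdd w.toAdd x

/-! ### Tilings -/

/-- A labelled tile: a subset of Euclidean space with a label. -/
@[ext]
structure Tile (d : ℕ) (L : Type*) where
  /-- The region covered by the tile. -/
  support : Set (Euc d)
  /-- The label (or colour) of the tile. -/
  label : L

variable {d : ℕ} {L : Type*}

/-- Rigid motions act on tiles and preserve labels. Via the pointwise action, they also act on
sets of tiles, such as patches and tilings. -/
instance : MulAction (RigidMotion d) (Tile d L) where
  smul Φ t := ⟨(Φ : Euc d ≃ᵃⁱ[ℝ] Euc d) '' t.support, t.label⟩
  one_smul t := Tile.ext (Set.image_id t.support) rfl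
  mul_smul Φ Ψ t :=
    Tile.ext (Set.image_comp (Φ : Euc d ≃ᵃⁱ[ℝ] Euc d) (Ψ : Euc d ≃ᵃⁱ[ℝ] Euc d) t.support) rfl

/-- A compact `d`-dimensional polyhedral set: a finite non-empty union of convex polytopes with
non-empty interior. -/
def IsPolyhedral (K : Set (Euc d)) : Prop :=
  ∃ V : Set (Set (Euc d)), V.Finite ∧ V.Nonempty ∧
    (∀ s ∈ V, s.Finite ∧ (interior (convexHull ℝ s)).Nonempty) ∧
    K = ⋃ s ∈ V, convexHull ℝ s

/-- A tiling: a cover of Euclidean space by compact labelled `d`-dimensional polyhedral sets which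
meet only on their boundaries, such that, up to translation, there are finitely many tiles.
Tilings that are not face to face are allowed. -/
structure IsTiling (T : Set (Tile d L)) : Prop where
  polyhedral : ∀ t ∈ T, IsPolyhedral t.support
  cover : ⋃ t ∈ T, t.support = Set.univ
  boundary : ∀ s ∈ T, ∀ t ∈ T, s ≠ t →
    s.support ∩ t.support ⊆ frontier s.support ∩ frontier t.support
  prototiles : ∃ F : Set (Tile d L), F.Finite ∧
    ∀ t ∈ T, ∃ p ∈ F, ∃ v : Euc d, t = translationMotion (.ofAdd v) • p

/-- The tiles of `T` that meet the closed ball of radius `r` about `x`. -/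
def patch (T : Set (Tile d L)) (x : Euc d) (r : ℝ) : Set (Tile d L) :=
  {t ∈ T | (t.support ∩ Metric.closedBall x r).Nonempty}

/-- The patch (set of tiles) `P` belongs to `T` up to translation. -/
def OccursIn (P T : Set (Tile d L)) : Prop :=
  ∃ v : Euc d, translationMotion (.ofAdd v) • P ⊆ T

/-- `T'` is locally indistinguishable from `T`: every patch, that is, every finite set of tiles,
of `T'` belongs to `T` up to translation. -/
def LocallyIndistinguishable (T' T : Set (Tile d L)) : Prop :=
  ∀ P ⊆ T', P.Finite → OccursIn P T

/-- A finite subgroup of `SO(d)` acts on `T` by rotations if rotates of patches of `T` are,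
up to translation, patches of `T`. -/
def ActsByRotations (G : Subgroup (SO d)) (T : Set (Tile d L)) : Prop :=
  (G : Set (SO d)).Finite ∧
    ∀ P ⊆ T, P.Finite → ∀ g ∈ G, OccursIn (rotationMotion g • P) T

/-- `T` has point group `G`: the finite group `G` acts on `T` by rotations, and for some radius
`r > 0` every rotation that takes some `r`-patch of `T` to a patch of `T`, up to translation,
lies in `G`. -/
def HasPointGroup (T : Set (Tile d L)) (G : Subgroup (SO d)) : Prop :=
  ActsByRotations G T ∧
    ∃ r : ℝ, 0 < r ∧ ∀ (x : Euc d) (g : SO d), OccursIn (rotationMotion g • patch T x r) T → g ∈ G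

/-- The positive space group of `T`: all orientation preserving symmetries. -/
def positiveSpaceGroup (T : Set (Tile d L)) : Subgroup (RigidMotion d) :=
  MulAction.stabilizer (RigidMotion d) T

/-- The group of the translational symmetries of `T`, written multiplicatively. -/
def translationGroup (T : Set (Tile d L)) : Subgroup (Multiplicative (Euc d)) :=
  (positiveSpaceGroup T).comap translationMotion

/-- `T` is periodic: its translational symmetries span Euclidean space. -/
def IsPeriodic (T : Set (Tile d L)) : Prop :=
  Submodule.span ℝ {v : Euc d | translationMotion (.ofAdd v) • T = T} = ⊤

/-- The inclusion of the translational symmetries in the positive space group. -/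
def translationInclusion (T : Set (Tile d L)) : translationGroup T →* positiveSpaceGroup T where
  toFun v := ⟨translationMotion (v : Multiplicative (Euc d)), v.2⟩
  map_one' := Subtype.ext (map_one _)
  map_mul' v w := Subtype.ext (map_mul translationMotion (v : Multiplicative (Euc d)) w)

/-! ### Tiling spaces -/

/-- `T₂` is `ε`-close to `T₁`: a rigid motion that moves the points of the unit ball by less than
`ε` takes `T₁` to a set of tiles that agrees with `T₂` on the ball of radius `1 / ε` about the
origin. -/
def Close (ε : ℝ) (T₁ T₂ : Set (Tile d L)) : Prop :=
  ∃ Φ : RigidMotion d,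
    (∀ x ∈ Metric.closedBall (0 : Euc d) 1, dist ((Φ : Euc d ≃ᵃⁱ[ℝ] Euc d) x) x < ε) ∧
    patch (Φ • T₁) 0 (1 / ε) = patch T₂ 0 (1 / ε)

theorem patch_eq_of_le {T₁ T₂ : Set (Tile d L)} {x : Euc d} {r s : ℝ} (hrs : r ≤ s)
    (h : patch T₁ x s = patch T₂ x s) : patch T₁ x r = patch T₂ x r := by
  have key : ∀ T : Set (Tile d L),
      patch T x r = {t ∈ patch T x s | (t.support ∩ Metric.closedBall x r).Nonempty} := by
    intro T
    ext t
    constructor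
    · rintro ⟨h1, h2⟩
      exact ⟨⟨h1, h2.mono (Set.inter_subset_inter_right _
        (Metric.closedBall_subset_closedBall hrs))⟩, h2⟩
    · rintro ⟨⟨h1, _⟩, h2⟩
      exact ⟨h1, h2⟩
  rw [key T₁, key T₂, h]

theorem Close.mono {ε δ : ℝ} (hε : 0 < ε) (h : ε ≤ δ) {T₁ T₂ : Set (Tile d L)}
    (hc : Close ε T₁ T₂) : Close δ T₁ T₂ := by
  obtain ⟨Φ, h1, h2⟩ := hc
  exact ⟨Φ, fun x hx => (h1 x hx).trans_le h,
    patch_eq_of_le (one_div_le_one_div_of_le hε h) h2⟩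

/-- The tiling topology: the sets of the tilings that are `ε`-close to a given one are
a neighbourhood basis. -/
instance tilingTopology : TopologicalSpace (Set (Tile d L)) where
  IsOpen U := ∀ T₁ ∈ U, ∃ ε > 0, ∀ T₂, Close ε T₁ T₂ → T₂ ∈ U
  isOpen_univ := fun _ _ => ⟨1, one_pos, fun _ _ => trivial⟩
  isOpen_inter := by
    intro U V hU hV T hT
    obtain ⟨ε, hε, h1⟩ := hU T hT.1
    obtain ⟨δ, hδ, h2⟩ := hV T hT.2
    refine ⟨min ε δ, lt_min hε hδ, fun T₂ h => ⟨h1 T₂ ?_, h2 T₂ ?_⟩⟩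
    · exact h.mono (lt_min hε hδ) (min_le_left _ _)
    · exact h.mono (lt_min hε hδ) (min_le_right _ _)
  isOpen_sUnion := by
    intro 𝒰 h T ⟨U, hU, hT⟩
    obtain ⟨ε, hε, h1⟩ := h U hU T hT
    exact ⟨ε, hε, fun T₂ h2 => ⟨U, hU, h1 T₂ h2⟩⟩

/-- The translational hull of `T`: the tilings that are locally indistinguishable from `T`,
with the subspace topology. -/
def translationalHull (T : Set (Tile d L)) : Set (Set (Tile d L)) :=
  {T' | IsTiling T' ∧ LocallyIndistinguishable T' T}

/-- The rotational hull of `T`: the tilings that are, up to a rotation, locally indistinguishable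
from `T`, with the subspace topology. -/
def rotationalHull (T : Set (Tile d L)) : Set (Set (Tile d L)) :=
  {T' | ∃ A : SO d, rotationMotion A • T' ∈ translationalHull T}

theorem mem_translationalHull {T : Set (Tile d L)} (hT : IsTiling T) :
    T ∈ translationalHull T := by
  refine ⟨hT, fun P hP _ => ⟨0, ?_⟩⟩
  rw [show (Multiplicative.ofAdd (0 : Euc d)) = 1 from rfl, map_one, one_smul]
  exact hP

theorem translationalHull_subset (T : Set (Tile d L)) :
    translationalHull T ⊆ rotationalHull T := by
  intro T' h
  refine ⟨1, ?_⟩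
  rw [map_one, one_smul]
  exact h

/-- `T` as the base point of its translational hull. -/
def basePointT {T : Set (Tile d L)} (hT : IsTiling T) : translationalHull T :=
  ⟨T, mem_translationalHull hT⟩

/-- The inclusion of the translational hull in the rotational hull. -/
def hullInclusion (T : Set (Tile d L)) : C(translationalHull T, rotationalHull T) :=
  ContinuousMap.inclusion (translationalHull_subset T)

/-- `T` as the base point of its rotational hull. -/
def basePointR {T : Set (Tile d L)} (hT : IsTiling T) : rotationalHull T :=
  hullInclusion T (basePointT hT)

/-- The homotopy class of a loop, as an element of the fundamental group. -/
def loopClass {X : Type*} [TopologicalSpace X] {x : X} (ℓ : Path x x) : FundamentalGroup X x :=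
  FundamentalGroup.fromPath (Path.Homotopic.Quotient.mk ℓ)

/-! ### Pullbacks of group extensions -/

section Extension

variable {N A B B' : Type*} [Group N] [Group A] [Group B] [Group B']

/-- The fibre product of two group homomorphisms with the same target. -/
def FibreProduct (f : A →* B) (q : B' →* B) : Subgroup (A × B') :=
  (f.comp (MonoidHom.fst A B')).eqLocus (q.comp (MonoidHom.snd A B'))

/-- The pullback of a group extension `N → A → B` along a homomorphism `q : B' → B`: the
extension of `B'` by `N` with the fibre product of `A` and `B'` over `B` in the middle. -/
def pullbackExtension (S : GroupExtension N A B) (q : B' →* B) :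
    GroupExtension N (FibreProduct S.rightHom q) B' where
  inl := ((S.inl).prod (1 : N →* B')).codRestrict _ fun n => by
    change S.rightHom (S.inl n) = q 1
    rw [S.rightHom_inl, map_one]
  rightHom := (MonoidHom.snd A B').comp (FibreProduct S.rightHom q).subtype
  inl_injective := fun a b h =>
    S.inl_injective (congrArg (fun x : FibreProduct S.rightHom q => (x : A × B').1) h)
  range_inl_eq_ker_rightHom := by
    ext ⟨⟨a, b⟩, h⟩
    change S.rightHom a = q b at h
    constructor
    · rintro ⟨n, hn⟩
      exact (congrArg (fun x : FibreProduct S.rightHom q => (x : A × B').2) hn).symm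
    · intro hb
      change b = 1 at hb
      subst hb
      rw [map_one, ← MonoidHom.mem_ker, ← S.range_inl_eq_ker_rightHom] at h
      obtain ⟨n, hn⟩ := h
      exact ⟨n, Subtype.ext (Prod.ext hn rfl)⟩
  rightHom_surjective := by
    intro b
    obtain ⟨a, ha⟩ := S.rightHom_surjective (q b)
    exact ⟨⟨(a, b), ha⟩, rfl⟩

/-- The projection of the pullback extension to the original one. -/
def pullbackFst (S : GroupExtension N A B) (q : B' →* B) : FibreProduct S.rightHom q →* A :=
  (MonoidHom.fst A B').comp (FibreProduct S.rightHom q).subtype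

end Extension

end TilingSpace

end

open TilingSpace

/-! Periodicity makes both hulls homogeneous. A cover whose patches all occur in `T` is a translate
of `T`: the vectors that carry a given tile into `T` form a closed set, the lattice moves the
solution for each finite patch into one ball, and compactness gives a common solution
(`IsPeriodic.exists_translate`). Hence `Ω_t` is the orbit of `T` under translations, with stabilizer
`Λ`, and `Ω_r` is its orbit under rigid motions, with stabilizer `Γ₊`.

These descriptions also hold topologically. By `HasPointGroup.exists_rigidity`, two moved copies of
`T` that agree on a large ball are equal: the point group radius controls the rotation, the covering
radius of the lattice the translation. So the orbit maps are open (`isOpenMap_hullMap`) and the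
hulls are coset spaces.

The group of rigid motions is covered by `MotionCover d`, the semidirect product of Euclidean space
with `Sp(d)`, which is simply connected. The preimage of `Γ₊` in it is discrete and is the fibre
product of `Γ₊` and `G̃` over `G`. For a discrete subgroup `D` of a simply connected group `E`, end
points of lifted paths identify the fundamental group of `E / D` with `D`; this applies to `Ω_t`,
`Ω_r` and `Sp(d) / G̃`. Lifting is natural (`IsLifting.map_eq`), so the maps between the three
fundamental groups become the inclusion of `Λ` and the projection to `G̃`. No exact sequence of a
fibration is needed.

The kernel of the projection from the fibre product to `Γ₊` is the kernel of `Sp(d) → SO(d)`, that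
is, the fundamental group of `SO(d)`. It is `ℤ` for `d = 2`, by the line covering the circle, and
`ℤ/2` for `d = 3`, by the unit quaternions. For larger `d`, general position on the sphere shows
that `SO(n) → SO(n + 1)` induces an isomorphism of fundamental groups once `n ≥ 3`. `Sp(d)` is a
group of path classes; that it is a simply connected covering group follows from the Cayley
contraction of a neighbourhood of `1` in `SO(d)`. -/

namespace TilingSpace

/-! ### Fundamental groups of coset spaces of discrete subgroups -/

section DiscreteQuotient

/-- A subgroup is isomorphic to the opposite of its opposite. -/
def subgroupOpOpEquiv {E : Type*} [Group E] (D : Subgroup E) : (D.op)ᵐᵒᵖ ≃* D where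
  toFun x := ⟨MulOpposite.unop (MulOpposite.unop x).1, (MulOpposite.unop x).2⟩
  invFun x := MulOpposite.op ⟨MulOpposite.op (x : E), x.2⟩
  left_inv _ := rfl
  right_inv _ := rfl
  map_mul' _ _ := rfl

variable {E X : Type*} [Group E] [TopologicalSpace E] [IsTopologicalGroup E]
  [TopologicalSpace X] {p : E → X}

/-- Loops in the base of a quotient by a discrete subgroup lift to paths that start at `1`. -/
theorem exists_lift_of_discrete (hp : Topology.IsQuotientMap p) (D : Subgroup E)
    (hD : IsDiscrete (D : Set E)) (hpD : ∀ {a b}, p a = p b ↔ a⁻¹ * b ∈ D) {x₀ : X}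
    (h1 : p 1 = x₀) (ℓ : C(I, X)) (hℓ : ℓ 0 = x₀) :
    ∃ s : C(I, E), s 0 = 1 ∧ ∀ t, p (s t) = ℓ t := by
  have hc := (hp.isQuotientCoveringMap_of_subgroupOp D hD hpD).isCoveringMap
  exact ⟨hc.liftPath ℓ 1 (hℓ.trans h1.symm), hc.liftPath_zero .., congrFun (hc.liftPath_lifts ..)⟩

/-- The fundamental group of the quotient of a simply connected group by a discrete subgroup. -/
theorem exists_fundamentalGroup_equiv [SimplyConnectedSpace E] (hp : Topology.IsQuotientMap p)
    (D : Subgroup E) (hD : IsDiscrete (D : Set E)) (hpD : ∀ {a b}, p a = p b ↔ a⁻¹ * b ∈ D)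
    {x₀ : X} (h1 : p 1 = x₀) :
    ∃ η : FundamentalGroup X x₀ ≃* D, ∀ (ℓ : Path x₀ x₀) (s : C(I, E)), s 0 = 1 →
      (∀ t, p (s t) = ℓ t) → (η (loopClass ℓ) : E) = s 1 := by
  have hq := hp.isQuotientCoveringMap_of_subgroupOp D hD hpD
  have hc := hq.isCoveringMap
  let e : p ⁻¹' {x₀} := ⟨1, h1⟩
  -- `D` acts by right multiplication, hence through `D.op`, and composition of loops reverses the
  -- order once more; the two opposites cancel.
  refine ⟨(hq.fundamentalGroupEquiv e).trans (subgroupOpOpEquiv D), fun ℓ s h0 hs => ?_⟩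
  have h := hq.unop_fundamentalGroupToMulOpposite_smul (e := e) (γ := loopClass ℓ)
  have hl : s = hc.liftPath ℓ 1 (ℓ.source.trans h1.symm) :=
    (hc.eq_liftPath_iff' _).2 ⟨funext hs, h0⟩
  have h' : (hc.monodromy (loopClass ℓ) e : E) = s 1 := by
    rw [hl]; rfl
  rw [← h', ← h]
  exact (one_mul _).symm

end DiscreteQuotient

/-! ### The path group as a simply connected covering group -/

section UniversalCover

/-- A subgroup that meets a neighbourhood of `1` trivially is discrete. -/
theorem isDiscrete_of_nhds_one {E : Type*} [Group E] [TopologicalSpace E] [IsTopologicalGroup E]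
    (K : Subgroup E) {U : Set E} (hU : U ∈ 𝓝 (1 : E)) (h : ∀ x ∈ K, x ∈ U → x = 1) :
    IsDiscrete (K : Set E) := by
  refine ⟨discreteTopology_of_isOpen_singleton_one (G := K) ?_⟩
  rw [isOpen_singleton_iff_nhds_eq_pure]
  refine le_antisymm ?_ (pure_le_nhds _)
  rw [Filter.le_pure_iff, nhds_subtype_eq_comap]
  exact ⟨U, hU, fun x hx => Subtype.ext (h x x.2 hx)⟩

/-- A path-connected space all of whose loops at one point are null-homotopic is
simply connected. -/
theorem simplyConnectedSpace_of_loops {Y : Type*} [TopologicalSpace Y] [PathConnectedSpace Y]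
    (y : Y) (h : ∀ γ : Path y y, γ.Homotopic (Path.refl y)) : SimplyConnectedSpace Y := by
  rw [simply_connected_iff_loops_nullhomotopic]
  refine ⟨inferInstance, fun x γ => ?_⟩
  have hs : Subsingleton (FundamentalGroup Y y) := by
    refine subsingleton_of_forall_eq 1 fun a => ?_
    induction a using Quotient.inductionOn with
    | h a => exact Path.Homotopic.Quotient.eq.2 (h a)
  have := (FundamentalGroup.fundamentalGroupMulEquivOfPathConnected x y).toEquiv.subsingleton
  exact Path.Homotopic.Quotient.eq.1 (Subsingleton.elim (loopClass γ) (loopClass (Path.refl x)))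

variable (H : Type*) [TopologicalSpace H] [Group H] [IsTopologicalGroup H]

/-- Some open neighbourhood of `1` contracts to `1`, within the group. -/
def HasContraction : Prop :=
  ∃ (V : Set H) (c : C(V × I, H)), IsOpen V ∧ 1 ∈ V ∧
    (∀ v, c (v, 0) = 1) ∧ (∀ v, c (v, 1) = v) ∧ ∀ (v : V) (t : I), (v : H) = 1 → c (v, t) = 1

variable {H}

instance : IsTopologicalGroup (BasedPaths H) where
  continuous_mul := by
    refine Continuous.subtype_mk (ContinuousMap.continuous_of_continuous_uncurry _ ?_) _
    change Continuous fun p : (BasedPaths H × BasedPaths H) × I =>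
      (p.1.1 : C(I, H)) p.2 * (p.1.2 : C(I, H)) p.2
    fun_prop
  continuous_inv := by
    refine Continuous.subtype_mk (ContinuousMap.continuous_of_continuous_uncurry _ ?_) _
    change Continuous fun p : BasedPaths H × I => ((p.1 : C(I, H)) p.2)⁻¹
    fun_prop

namespace UniversalCover

theorem continuous_proj : Continuous (proj : UniversalCover H → H) := by
  refine continuous_quot_lift _ ?_
  exact (continuous_eval_const (1 : I)).comp continuous_subtype_val

theorem proj_surjective [PathConnectedSpace H] :
    Function.Surjective (proj : UniversalCover H → H) := by
  intro h
  let γ := PathConnectedSpace.somePath (1 : H) h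
  exact ⟨QuotientGroup.mk ⟨γ.toContinuousMap, γ.source⟩, γ.target⟩

/-- The path `γ`, run through up to time `s`. -/
def initialPath (γ : BasedPaths H) (s : I) : BasedPaths H :=
  ⟨(γ : C(I, H)).comp ⟨fun t => s * t, by fun_prop⟩, by
    change (γ : C(I, H)) (s * 0) = 1
    rw [mul_zero]; exact γ.2⟩

theorem continuous_initialPath (γ : BasedPaths H) : Continuous (initialPath γ) := by
  refine Continuous.subtype_mk ?_ _
  refine ContinuousMap.continuous_of_continuous_uncurry _ ?_
  change Continuous fun p : I × I => (γ : C(I, H)) (p.1 * p.2)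
  fun_prop

theorem initialPath_zero (γ : BasedPaths H) : initialPath γ 0 = 1 := by
  refine Subtype.ext (ContinuousMap.ext fun t => ?_)
  change (γ : C(I, H)) (0 * t) = 1
  rw [zero_mul]; exact γ.2

theorem initialPath_one (γ : BasedPaths H) : initialPath γ 1 = γ := by
  refine Subtype.ext (ContinuousMap.ext fun t => ?_)
  change (γ : C(I, H)) (1 * t) = (γ : C(I, H)) t
  rw [one_mul]

/-- The canonical path in the universal cover that lifts the path `γ`. -/
def canonicalLift (γ : BasedPaths H) :
    Path (1 : UniversalCover H) (QuotientGroup.mk γ : UniversalCover H) where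
  toFun s := QuotientGroup.mk (initialPath γ s)
  continuous_toFun := continuous_quotient_mk'.comp (continuous_initialPath γ)
  source' := by rw [initialPath_zero]; rfl
  target' := by rw [initialPath_one]

theorem proj_canonicalLift (γ : BasedPaths H) (t : I) :
    proj (canonicalLift γ t) = (γ : C(I, H)) t := by
  change (γ : C(I, H)) (t * 1) = _
  rw [mul_one]

instance : PathConnectedSpace (UniversalCover H) where
  nonempty := ⟨1⟩
  joined := by
    have h : ∀ x : UniversalCover H, Joined 1 x := by
      intro x
      induction x using QuotientGroup.induction_on with
      | H γ => exact ⟨canonicalLift γ⟩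
    exact fun x y => (h x).symm.trans (h y)

/-- The contraction assigns to each `v` in `V` a path from `1` to `v` that depends continuously on
`v`; its class is the value of the section. -/
theorem exists_local_section (hH : HasContraction H) :
    ∃ (V : Set H) (sec : V → UniversalCover H), IsOpen V ∧ 1 ∈ V ∧ Continuous sec ∧
      (∀ v, proj (sec v) = v) ∧ ∀ v : V, (v : H) = 1 → sec v = 1 := by
  obtain ⟨V, c, hV, h1, hc0, hc1, hct⟩ := hH
  refine ⟨V, fun v => QuotientGroup.mk (⟨c.curry v, hc0 v⟩ : BasedPaths H), hV, h1, ?_, hc1,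
    fun v hv => ?_⟩
  · exact continuous_quotient_mk'.comp (c.curry.continuous.subtype_mk _)
  · have : (⟨c.curry v, hc0 v⟩ : BasedPaths H) = 1 :=
      Subtype.ext (ContinuousMap.ext fun t => hct v t hv)
    exact congrArg QuotientGroup.mk this

/-- A homomorphism has to be tested for openness only at `1`, where the image of a neighbourhood
contains its preimage under the local section. -/
theorem isOpenMap_proj (hH : HasContraction H) :
    IsOpenMap (proj : UniversalCover H → H) := by
  obtain ⟨V, sec, hV, h1, hsec, hsecp, hsec1⟩ := exists_local_section hH
  refine IsTopologicalGroup.isOpenMap_iff_nhds_one.2 fun U hU => ?_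
  rw [Filter.mem_map] at hU
  have h2 : sec ⁻¹' ((proj : UniversalCover H → H) ⁻¹' U) ∈ 𝓝 (⟨1, h1⟩ : V) :=
    hsec.continuousAt (by rwa [hsec1 ⟨1, h1⟩ rfl])
  have h3 := hV.isOpenEmbedding_subtypeVal.isOpenMap.image_mem_nhds h2
  refine Filter.mem_of_superset h3 ?_
  rintro _ ⟨v, hv, rfl⟩
  rw [← hsecp v]
  exact hv

theorem isQuotientMap_proj [PathConnectedSpace H] (hH : HasContraction H) :
    Topology.IsQuotientMap (proj : UniversalCover H → H) :=
  (isOpenMap_proj hH).isQuotientMap continuous_proj proj_surjective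

/-- A loop that stays inside `V` is null-homotopic by the contraction, relative to its ends because
the contraction fixes `1`. The paths inside `V` form an open set since `I` is compact. -/
theorem exists_nhds_ker_proj (hH : HasContraction H) :
    ∃ U ∈ 𝓝 (1 : UniversalCover H), ∀ x ∈ U, proj x = 1 → x = 1 := by
  obtain ⟨V, c, hV, h1, hc0, hc1, hct⟩ := hH
  let W : Set (BasedPaths H) := {γ | Set.MapsTo (γ : C(I, H)) Set.univ V}
  have hW : IsOpen W :=
    (ContinuousMap.isOpen_setOfPred_mapsTo isCompact_univ hV).preimage continuous_subtype_val
  refine ⟨QuotientGroup.mk '' W, (QuotientGroup.isOpenMap_coe _ hW).mem_nhds ⟨1, fun _ _ => h1, rfl⟩,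
    ?_⟩
  rintro _ ⟨γ, hγ, rfl⟩ hγ1
  change (γ : C(I, H)) 1 = 1 at hγ1
  have h0 : (γ : C(I, H)) 0 = 1 := γ.2
  refine (UniversalCover.mk_eq_mk_iff γ 1).2 (ContinuousMap.HomotopicRel.symm
    ⟨⟨⟨⟨fun p => c (⟨(γ : C(I, H)) p.2, hγ trivial⟩, p.1), by fun_prop⟩,
      fun t => hc0 _, fun t => hc1 _⟩, ?_⟩⟩)
  rintro t x (rfl | rfl)
  · exact hct _ _ h0
  · exact hct _ _ hγ1

theorem isDiscrete_ker_proj (hH : HasContraction H) :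
    IsDiscrete ((proj : UniversalCover H →* H).ker : Set (UniversalCover H)) := by
  obtain ⟨U, hU, h⟩ := exists_nhds_ker_proj hH
  exact isDiscrete_of_nhds_one _ hU fun x hx hxU => h x hxU hx

theorem isCoveringMap_proj [PathConnectedSpace H] (hH : HasContraction H) :
    IsCoveringMap (proj : UniversalCover H → H) :=
  ((isQuotientMap_proj hH).isQuotientCoveringMap_of_isDiscrete_ker_monoidHom
    (isDiscrete_ker_proj hH)).isCoveringMap

/-- A loop `α` in the cover projects to a loop `β` in `H`, and by uniqueness of lifts `α` is the
canonical lift of `β`, which ends at the class of `β`. As `α` closes up at `1`, this class is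
trivial, so `β` is null-homotopic, and the homotopy lifts. -/
theorem simplyConnectedSpace [PathConnectedSpace H] (hH : HasContraction H) :
    SimplyConnectedSpace (UniversalCover H) := by
  have hc := isCoveringMap_proj hH
  refine simplyConnectedSpace_of_loops 1 fun α => ?_
  let β : BasedPaths H := ⟨⟨fun t => proj (α t), by have := hc.continuous; fun_prop⟩, by
    change proj (α 0) = 1
    rw [α.source, map_one]⟩
  have hαβ : (α : I → UniversalCover H) = canonicalLift β := by
    refine hc.eq_of_comp_eq α.continuous (canonicalLift β).continuous ?_ 0
      (α.source.trans (canonicalLift β).source.symm)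
    exact funext fun t => (proj_canonicalLift β t).symm
  have hβ : (QuotientGroup.mk β : UniversalCover H) = QuotientGroup.mk 1 := by
    have := congrFun hαβ 1
    rw [α.target, (canonicalLift β).target] at this
    exact this.symm
  have h := (UniversalCover.mk_eq_mk_iff _ _).1 hβ
  refine (hc.homotopicRel_iff_comp (f₀ := α.toContinuousMap)
    (f₁ := (Path.refl (1 : UniversalCover H)).toContinuousMap) ⟨0, by simp, ?_⟩).2 ?_
  · simp
  · convert! h using 1

/-- The fundamental group of a locally contractible group is the kernel of the projection of its
universal covering group. -/
theorem nonempty_fundamentalGroup_equiv_ker [PathConnectedSpace H] (hH : HasContraction H) :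
    Nonempty (FundamentalGroup H 1 ≃* (proj : UniversalCover H →* H).ker) := by
  have := simplyConnectedSpace hH
  obtain ⟨η, -⟩ := exists_fundamentalGroup_equiv (isQuotientMap_proj hH) _ (isDiscrete_ker_proj hH)
    (fun {a b} => by rw [MonoidHom.mem_ker, map_mul, map_inv, inv_mul_eq_one]) (map_one proj)
  exact ⟨η⟩

end UniversalCover

end UniversalCover

/-! ### Special orthogonal groups: local contraction, rotations between unit vectors -/

section SpecialOrthogonal

open Matrix

variable {n : ℕ}

theorem mem_SO_iff {A : Matrix (Fin n) (Fin n) ℝ} :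
    A ∈ specialOrthogonalGroup (Fin n) ℝ ↔ A * Aᵀ = 1 ∧ A.det = 1 := by
  rw [mem_specialOrthogonalGroup_iff, mem_orthogonalGroup_iff]

theorem SO_mul_transpose (A : SO n) : (A : Matrix (Fin n) (Fin n) ℝ) * (A : Matrix _ _ ℝ)ᵀ = 1 :=
  (mem_SO_iff.1 A.2).1

theorem SO_transpose_mul (A : SO n) : (A : Matrix (Fin n) (Fin n) ℝ)ᵀ * (A : Matrix _ _ ℝ) = 1 :=
  mul_eq_one_comm.1 (SO_mul_transpose A)

theorem SO_coe_mul (A B : SO n) :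
    ((A * B : SO n) : Matrix (Fin n) (Fin n) ℝ) = (A : Matrix _ _ ℝ) * (B : Matrix _ _ ℝ) := rfl

theorem SO_coe_one : ((1 : SO n) : Matrix (Fin n) (Fin n) ℝ) = 1 := rfl

theorem SO_dotProduct (A : SO n) (v : Fin n → ℝ) :
    ((A : Matrix (Fin n) (Fin n) ℝ) *ᵥ v) ⬝ᵥ ((A : Matrix (Fin n) (Fin n) ℝ) *ᵥ v) = v ⬝ᵥ v := by
  rw [dotProduct_mulVec, ← mulVec_transpose, mulVec_mulVec, SO_transpose_mul, one_mulVec]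

/-! #### The Cayley contraction -/

/-- The numerator of the Cayley contraction. -/
noncomputable def cayleyNum (A : Matrix (Fin n) (Fin n) ℝ) (t : ℝ) : Matrix (Fin n) (Fin n) ℝ :=
  (1 + t) • A + (1 - t) • 1

/-- Write `N t` for `cayleyNum A t`. If `K = (A - 1)(A + 1)⁻¹` is the Cayley transform, then `N t *
(N (-t))⁻¹ = (1 + tK)(1 - tK)⁻¹`, which shrinks `A` to `1` as `t` goes to `0`. The identity here is
the source of its orthogonality. -/
theorem mul_transpose_cayleyNum (A : SO n) (t : ℝ) :
    (A : Matrix (Fin n) (Fin n) ℝ) * (cayleyNum (A : Matrix (Fin n) (Fin n) ℝ) t)ᵀ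
      = cayleyNum (A : Matrix (Fin n) (Fin n) ℝ) (-t) := by
  simp only [cayleyNum, transpose_add, transpose_smul, transpose_one, mul_add, mul_smul_comm, mul_one,
    SO_mul_transpose]
  rw [add_comm, sub_neg_eq_add, ← sub_eq_add_neg]

theorem det_cayleyNum_neg (A : SO n) (t : ℝ) :
    (cayleyNum (A : Matrix (Fin n) (Fin n) ℝ) (-t)).det
      = (cayleyNum (A : Matrix (Fin n) (Fin n) ℝ) t).det := by
  rw [← mul_transpose_cayleyNum, det_mul, det_transpose, (mem_SO_iff.1 A.2).2, one_mul]

theorem cayleyNum_mul_comm (A : Matrix (Fin n) (Fin n) ℝ) (s t : ℝ) :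
    Commute (cayleyNum A s) (cayleyNum A t) := by
  unfold cayleyNum
  have h : Commute A ((1 + t) • A + (1 - t) • 1) :=
    ((Commute.refl A).smul_right _).add_right ((Commute.one_right A).smul_right _)
  exact (h.smul_left _).add_left ((Commute.one_left _).smul_left _)

/-- A kernel vector `v` satisfies `(1 + t) A v = -(1 - t) v`. Since `A` preserves lengths, `(1 + t)²
= (1 - t)²`, so `t = 0`, and that case is the hypothesis on `A + 1`. -/
theorem det_cayleyNum_ne_zero (A : SO n) (hA : ((A : Matrix (Fin n) (Fin n) ℝ) + 1).det ≠ 0)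
    {t : ℝ} (ht : 0 ≤ t) : (cayleyNum (A : Matrix (Fin n) (Fin n) ℝ) t).det ≠ 0 := by
  intro h0
  obtain ⟨v, hv, hv0⟩ := exists_mulVec_eq_zero_iff.2 h0
  rcases ht.eq_or_lt with rfl | ht
  · apply hA
    simpa [cayleyNum] using h0
  · have h1 : (1 + t) • ((A : Matrix (Fin n) (Fin n) ℝ) *ᵥ v) = -((1 - t) • v) := by
      rw [cayleyNum, add_mulVec, smul_mulVec, smul_mulVec, one_mulVec] at hv0
      exact eq_neg_of_add_eq_zero_left hv0
    have h2 := congrArg (fun w => w ⬝ᵥ w) h1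
    simp only [smul_dotProduct, dotProduct_smul, neg_dotProduct, dotProduct_neg, SO_dotProduct,
      smul_eq_mul] at h2
    have h3 : v ⬝ᵥ v ≠ 0 := fun h => hv (dotProduct_self_eq_zero.1 h)
    have h4 : 4 * t * (v ⬝ᵥ v) = 0 := by linear_combination h2
    rcases mul_eq_zero.1 h4 with h | h
    · linarith
    · exact h3 h

/-- The Cayley contraction as a matrix. -/
noncomputable def cayleyMatrix (A : Matrix (Fin n) (Fin n) ℝ) (t : ℝ) : Matrix (Fin n) (Fin n) ℝ :=
  (cayleyNum A (-t)).det⁻¹ • (cayleyNum A t * (cayleyNum A (-t)).adjugate)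

/-- The definition by determinant and adjugate makes continuity visible; the algebra uses the matrix
inverse. -/
theorem cayleyMatrix_eq (A : Matrix (Fin n) (Fin n) ℝ) (t : ℝ) :
    cayleyMatrix A t = cayleyNum A t * (cayleyNum A (-t))⁻¹ := by
  rw [cayleyMatrix, inv_def, Ring.inverse_eq_inv', mul_smul_comm]

/-- With `N = N t` and `M = N (-t)`, the relations `M = A Nᵀ`, `N = A Mᵀ` and `N M = M N` give `N Nᵀ
= M Mᵀ`, so `N M⁻¹` is orthogonal. Its determinant is `1` because `N` and `M` have the same
determinant. -/
theorem cayleyMatrix_mem (A : SO n) (hA : ((A : Matrix (Fin n) (Fin n) ℝ) + 1).det ≠ 0)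
    {t : ℝ} (ht : 0 ≤ t) :
    cayleyMatrix (A : Matrix (Fin n) (Fin n) ℝ) t ∈ specialOrthogonalGroup (Fin n) ℝ := by
  have hd := det_cayleyNum_ne_zero A hA ht
  have hu : IsUnit (cayleyNum (A : Matrix (Fin n) (Fin n) ℝ) (-t)).det := by
    rw [det_cayleyNum_neg]; exact hd.isUnit
  rw [mem_SO_iff, cayleyMatrix_eq]
  constructor
  · set N := cayleyNum (A : Matrix (Fin n) (Fin n) ℝ) t with hN
    set M := cayleyNum (A : Matrix (Fin n) (Fin n) ℝ) (-t) with hM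
    have h1 : (A : Matrix (Fin n) (Fin n) ℝ) * Nᵀ = M := mul_transpose_cayleyNum A t
    have h2 : (A : Matrix (Fin n) (Fin n) ℝ) * Mᵀ = N := by
      rw [hM, mul_transpose_cayleyNum, neg_neg]
    have hc : N * M = M * N := cayleyNum_mul_comm _ _ _
    have h3 : N * Nᵀ = M * Mᵀ := by
      rw [← h1, ← h2, mul_assoc, h2, mul_assoc, h1, ← transpose_mul, ← transpose_mul, hc]
    have h4 : N * M⁻¹ = M⁻¹ * N := by
      rw [← nonsing_inv_mul_cancel_left M (N * M⁻¹) hu, ← mul_assoc M, ← hc, mul_assoc N,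
        mul_nonsing_inv _ hu, mul_one]
    have hut : IsUnit Mᵀ.det := by rwa [det_transpose]
    calc N * M⁻¹ * (N * M⁻¹)ᵀ = M⁻¹ * (N * Nᵀ) * Mᵀ⁻¹ := by
          rw [h4, transpose_mul, transpose_nonsing_inv]; simp only [mul_assoc]
      _ = 1 := by
          rw [h3, ← mul_assoc, nonsing_inv_mul _ hu, one_mul, mul_nonsing_inv _ hut]
  · rw [det_mul, det_nonsing_inv, Ring.inverse_eq_inv', det_cayleyNum_neg,
      mul_inv_cancel₀ hd]

/-- The neighbourhood consists of the rotations without eigenvalue `-1`. At `t = 0` numerator and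
denominator agree; at `t = 1` they are `2A` and `2`. -/
theorem hasContraction_SO (n : ℕ) : HasContraction (SO n) := by
  let V : Set (SO n) := {A | ((A : Matrix (Fin n) (Fin n) ℝ) + 1).det ≠ 0}
  have hV : IsOpen V := by
    refine isOpen_ne_fun (f := fun A : SO n => ((A : Matrix (Fin n) (Fin n) ℝ) + 1).det) ?_
      continuous_const
    fun_prop
  have hcont : Continuous fun p : V × I =>
      cayleyMatrix ((p.1 : SO n) : Matrix (Fin n) (Fin n) ℝ) (p.2 : ℝ) := by
    unfold cayleyMatrix
    have h1 : Continuous fun p : V × I =>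
        (cayleyNum ((p.1 : SO n) : Matrix (Fin n) (Fin n) ℝ) (-(p.2 : ℝ))).det := by
      unfold cayleyNum; fun_prop
    refine (h1.inv₀ fun p => ?_).smul ?_
    · rw [det_cayleyNum_neg]
      exact det_cayleyNum_ne_zero _ p.1.2 p.2.2.1
    · unfold cayleyNum; fun_prop
  have hid : ∀ t : ℝ, cayleyNum (1 : Matrix (Fin n) (Fin n) ℝ) t = (2 : ℝ) • 1 := fun t => by
    rw [cayleyNum, ← add_smul]; norm_num
  have h2 : ((2 : ℝ) • (1 : Matrix (Fin n) (Fin n) ℝ)).det ≠ 0 := by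
    rw [det_smul, det_one, mul_one]; positivity
  refine ⟨V, ⟨fun p => ⟨_, cayleyMatrix_mem p.1.1 p.1.2 p.2.2.1⟩, hcont.subtype_mk _⟩, hV, ?_,
    fun A => Subtype.ext ?_, fun A => Subtype.ext ?_, fun A t hA => Subtype.ext ?_⟩
  · change det ((1 : Matrix (Fin n) (Fin n) ℝ) + 1) ≠ 0
    rwa [← two_smul ℝ]
  · change cayleyMatrix ((A : SO n) : Matrix (Fin n) (Fin n) ℝ) ((0 : I) : ℝ) = 1
    rw [cayleyMatrix_eq, Set.Icc.coe_zero, neg_zero]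
    exact mul_nonsing_inv _ (det_cayleyNum_ne_zero _ A.2 le_rfl).isUnit
  · change cayleyMatrix ((A : SO n) : Matrix (Fin n) (Fin n) ℝ) ((1 : I) : ℝ) = A
    have e1 : cayleyNum ((A : SO n) : Matrix (Fin n) (Fin n) ℝ) 1
        = ((A : SO n) : Matrix (Fin n) (Fin n) ℝ) * ((2 : ℝ) • 1) := by
      rw [cayleyNum, sub_self, zero_smul, add_zero, mul_smul_comm, mul_one]; norm_num
    have e2 : cayleyNum ((A : SO n) : Matrix (Fin n) (Fin n) ℝ) (-1) = (2 : ℝ) • 1 := by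
      rw [cayleyNum, add_neg_cancel, zero_smul, zero_add]; norm_num
    rw [cayleyMatrix_eq, Set.Icc.coe_one, e1, e2, mul_nonsing_inv_cancel_right _ _ h2.isUnit]
  · change cayleyMatrix ((A : SO n) : Matrix (Fin n) (Fin n) ℝ) (t : ℝ) = 1
    rw [cayleyMatrix_eq, hA, SO_coe_one, hid, hid, mul_nonsing_inv _ h2.isUnit]

/-! #### Householder reflections and rotations that take one unit vector to another -/

/-- The reflection in the hyperplane orthogonal to `u`. -/
noncomputable def householder (u : Fin n → ℝ) : Matrix (Fin n) (Fin n) ℝ :=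
  1 - (2 / (u ⬝ᵥ u)) • vecMulVec u u

theorem householder_transpose (u : Fin n → ℝ) : (householder u)ᵀ = householder u := by
  simp [householder, transpose_vecMulVec]

theorem householder_mulVec (u x : Fin n → ℝ) :
    householder u *ᵥ x = x - (2 * (u ⬝ᵥ x) / (u ⬝ᵥ u)) • u := by
  rw [householder, sub_mulVec, one_mulVec, smul_mulVec, vecMulVec_mulVec, op_smul_eq_smul,
    smul_smul, div_mul_eq_mul_div]

theorem householder_mul_self {u : Fin n → ℝ} (hu : u ≠ 0) : householder u * householder u = 1 := by
  have h : u ⬝ᵥ u ≠ 0 := fun h => hu (dotProduct_self_eq_zero.1 h)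
  refine ext_of_mulVec_single fun i => ?_
  rw [← mulVec_mulVec, householder_mulVec, householder_mulVec, one_mulVec, dotProduct_sub,
    dotProduct_smul, smul_eq_mul]
  have e : 2 * (u ⬝ᵥ Pi.single i 1 - 2 * u ⬝ᵥ Pi.single i 1 / u ⬝ᵥ u * u ⬝ᵥ u) / u ⬝ᵥ u
      = - (2 * u ⬝ᵥ Pi.single i 1 / u ⬝ᵥ u) := by field_simp; ring
  rw [e, neg_smul, sub_neg_eq_add, sub_add_cancel]

theorem det_householder {u : Fin n → ℝ} (hu : u ≠ 0) : (householder u).det = -1 := by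
  have h : u ⬝ᵥ u ≠ 0 := fun h => hu (dotProduct_self_eq_zero.1 h)
  have e : householder u = 1 + replicateCol Unit (-(2 / (u ⬝ᵥ u)) • u) * replicateRow Unit u := by
    rw [householder, ← vecMulVec_eq, smul_vecMulVec, neg_smul, sub_eq_add_neg]
  rw [e, det_one_add_replicateCol_mul_replicateRow, dotProduct_smul, smul_eq_mul, neg_mul,
    div_mul_cancel₀ _ h]
  norm_num

theorem householder_mul_mem {u v : Fin n → ℝ} (hu : u ≠ 0) (hv : v ≠ 0) :
    householder u * householder v ∈ specialOrthogonalGroup (Fin n) ℝ := by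
  rw [mem_SO_iff, transpose_mul, householder_transpose, householder_transpose, det_mul,
    det_householder hu, det_householder hv]
  refine ⟨?_, by norm_num⟩
  rw [mul_assoc, ← mul_assoc (householder v), householder_mul_self hv, one_mul,
    householder_mul_self hu]

theorem dotProduct_ofLp_self (a : Euc n) : a.ofLp ⬝ᵥ a.ofLp = ‖a‖ ^ 2 := by
  rw [EuclideanSpace.real_norm_sq_eq, dotProduct]
  simp [sq]

open Classical in
/-- The rotation in the plane of the unit vectors `a` and `b` that takes `a` to `b`. -/
noncomputable def rotTo (a b : Euc n) : SO n :=
  if h : b.ofLp ≠ 0 ∧ (a + b).ofLp ≠ 0 then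
    ⟨householder b.ofLp * householder (a + b).ofLp, householder_mul_mem h.1 h.2⟩
  else 1

theorem coe_rotTo {a b : Euc n} (hb : ‖b‖ = 1) (hab : a + b ≠ 0) :
    (rotTo a b : Matrix (Fin n) (Fin n) ℝ) = householder b.ofLp * householder (a + b).ofLp := by
  have h : b.ofLp ≠ 0 ∧ (a + b).ofLp ≠ 0 := by
    constructor
    · intro h
      rw [WithLp.ofLp_eq_zero] at h
      rw [h, norm_zero] at hb
      exact zero_ne_one hb
    · rwa [Ne, WithLp.ofLp_eq_zero]
  rw [rotTo, dif_pos h]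

/-- For unit vectors, the reflection along `a + b` takes `a` to `-b`, and the reflection along `b`
takes `-b` to `b`. -/
theorem rotTo_mulVec {a b : Euc n} (ha : ‖a‖ = 1) (hb : ‖b‖ = 1) (hab : a + b ≠ 0) :
    (rotTo a b : Matrix (Fin n) (Fin n) ℝ) *ᵥ a.ofLp = b.ofLp := by
  have h1 : a.ofLp ⬝ᵥ a.ofLp = 1 := by rw [dotProduct_ofLp_self, ha, one_pow]
  have h2 : b.ofLp ⬝ᵥ b.ofLp = 1 := by rw [dotProduct_ofLp_self, hb, one_pow]
  have h3 : (a + b).ofLp ⬝ᵥ (a + b).ofLp ≠ 0 := fun h =>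
    hab ((WithLp.ofLp_eq_zero _).1 (dotProduct_self_eq_zero.1 h))
  have h4 : 2 * ((a + b).ofLp ⬝ᵥ a.ofLp) = (a + b).ofLp ⬝ᵥ (a + b).ofLp := by
    simp only [WithLp.ofLp_add, add_dotProduct, dotProduct_add, h1, h2, dotProduct_comm b.ofLp]
    ring
  rw [coe_rotTo hb hab, ← mulVec_mulVec, householder_mulVec (a + b).ofLp, h4, div_self h3, one_smul,
    householder_mulVec, WithLp.ofLp_add, sub_add_cancel_left, dotProduct_neg, h2]
  norm_num
  rw [two_smul]; abel

theorem rotTo_self {a : Euc n} (ha : ‖a‖ = 1) : rotTo a a = 1 := by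
  have h0 : a ≠ 0 := by rintro rfl; simp at ha
  have h0' : a.ofLp ≠ 0 := by rwa [Ne, WithLp.ofLp_eq_zero]
  have h : a + a ≠ 0 := by rw [← two_smul ℝ]; exact smul_ne_zero two_ne_zero h0
  refine Subtype.ext ?_
  rw [coe_rotTo ha h, SO_coe_one]
  have e : householder (a + a).ofLp = householder a.ofLp := by
    have h1 : a.ofLp ⬝ᵥ a.ofLp = 1 := by rw [dotProduct_ofLp_self, ha, one_pow]
    have e : (a + a).ofLp = (2 : ℝ) • a.ofLp := by rw [WithLp.ofLp_add, two_smul]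
    rw [householder, householder, e, smul_vecMulVec, vecMulVec_smul, smul_dotProduct,
      dotProduct_smul, h1]
    simp only [smul_smul, smul_eq_mul]
    norm_num
  rw [e, householder_mul_self h0']

theorem continuous_rotTo {X : Type*} [TopologicalSpace X] {a b : X → Euc n} (ha : Continuous a)
    (hb : Continuous b) (hb1 : ∀ x, ‖b x‖ = 1) (hab : ∀ x, a x + b x ≠ 0) :
    Continuous fun x => rotTo (a x) (b x) := by
  refine continuous_induced_rng.2 ?_
  have e : (Subtype.val ∘ fun x => rotTo (a x) (b x)) =
      fun x => householder (b x).ofLp * householder (a x + b x).ofLp :=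
    funext fun x => coe_rotTo (hb1 x) (hab x)
  rw [e]
  have key : ∀ u : X → Euc n, Continuous u → (∀ x, u x ≠ 0) →
      Continuous fun x => householder (u x).ofLp := by
    intro u hu hu0
    unfold householder
    refine continuous_const.sub (Continuous.smul (f := fun x => 2 / ((u x).ofLp ⬝ᵥ (u x).ofLp))
      (Continuous.div continuous_const ?_ fun x h => ?_) ?_)
    · fun_prop
    · exact hu0 x ((WithLp.ofLp_eq_zero _).1 (dotProduct_self_eq_zero.1 h))
    · fun_prop
  refine (key b hb fun x h => ?_).mul (key _ (ha.add hb) hab)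
  have := hb1 x
  rw [h, norm_zero] at this
  exact zero_ne_one this

end SpecialOrthogonal

/-! ### Special orthogonal groups: stabilizers and path-connectedness -/

section SpecialOrthogonal

open Matrix

variable {n : ℕ}

/-! #### Segments on the sphere -/

section Segment

variable {V : Type*} [NormedAddCommGroup V] [InnerProductSpace ℝ V]

/-- The radial projection to the unit sphere of the segment from `a` to `b`. -/
noncomputable def sphereSegment (a b : V) (s : ℝ) : V :=
  ‖(1 - s) • a + s • b‖⁻¹ • ((1 - s) • a + s • b)

theorem segment_ne_zero {a b : V} (ha : ‖a‖ = 1) (hb : ‖b‖ = 1) (hab : a + b ≠ 0) {s : ℝ}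
    (hs0 : 0 ≤ s) (hs1 : s ≤ 1) : (1 - s) • a + s • b ≠ 0 := by
  intro h
  have h1 : (1 - s) • a = -(s • b) := eq_neg_of_add_eq_zero_left h
  have h2 := congrArg norm h1
  rw [norm_neg, norm_smul, norm_smul, ha, hb, mul_one, mul_one, Real.norm_of_nonneg hs0,
    Real.norm_of_nonneg (by linarith)] at h2
  have h3 : s = 1 / 2 := by linarith
  apply hab
  rw [h3] at h
  have h4 : (2⁻¹ : ℝ) • (a + b) = 0 := by
    rw [smul_add, ← h]; norm_num
  exact (smul_eq_zero.1 h4).resolve_left (by norm_num)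

theorem norm_sphereSegment {a b : V} (ha : ‖a‖ = 1) (hb : ‖b‖ = 1) (hab : a + b ≠ 0) {s : ℝ}
    (hs0 : 0 ≤ s) (hs1 : s ≤ 1) : ‖sphereSegment a b s‖ = 1 :=
  norm_smul_inv_norm (𝕜 := ℝ) (segment_ne_zero ha hb hab hs0 hs1)

theorem sphereSegment_zero {a b : V} (ha : ‖a‖ = 1) : sphereSegment a b 0 = a := by
  simp [sphereSegment, ha]

theorem sphereSegment_one {a b : V} (hb : ‖b‖ = 1) : sphereSegment a b 1 = b := by
  simp [sphereSegment, hb]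

theorem sphereSegment_self {a : V} (ha : ‖a‖ = 1) (s : ℝ) : sphereSegment a a s = a := by
  rw [sphereSegment, ← add_smul, sub_add_cancel, one_smul, ha, inv_one, one_smul]

/-- The projected segment never reaches `-a`, so `rotTo a (sphereSegment a b s)` is a path of
rotations from `1` to `rotTo a b`. If it did, then `(c + 1 - s) a = -s b` with `c > 0`; comparing
norms makes the two coefficients equal, and `s (a + b) = 0` follows. -/
theorem add_sphereSegment_ne_zero {a b : V} (ha : ‖a‖ = 1) (hb : ‖b‖ = 1) (hab : a + b ≠ 0)
    {s : ℝ} (hs0 : 0 ≤ s) (hs1 : s ≤ 1) : a + sphereSegment a b s ≠ 0 := by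
  intro h
  have h0 := segment_ne_zero ha hb hab hs0 hs1
  set c := ‖(1 - s) • a + s • b‖ with hc
  have hc0 : 0 < c := norm_pos_iff.2 h0
  have h1 : c • (a + sphereSegment a b s) = 0 := by rw [h, smul_zero]
  rw [sphereSegment, ← hc, smul_add, smul_inv_smul₀ hc0.ne', ← add_assoc, ← add_smul] at h1
  have h2 := congrArg norm (eq_neg_of_add_eq_zero_left h1)
  rw [norm_neg, norm_smul, norm_smul, ha, hb, mul_one, mul_one, Real.norm_of_nonneg hs0,
    Real.norm_of_nonneg (by linarith)] at h2
  rw [h2, ← smul_add] at h1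
  rcases smul_eq_zero.1 h1 with h3 | h3
  · linarith
  · exact hab h3

theorem continuous_sphereSegment {X : Type*} [TopologicalSpace X] {a b : X → V} {s : X → ℝ}
    (hca : Continuous a) (hcb : Continuous b) (hcs : Continuous s) (ha : ∀ x, ‖a x‖ = 1)
    (hb : ∀ x, ‖b x‖ = 1) (hab : ∀ x, a x + b x ≠ 0) (hs : ∀ x, 0 ≤ s x ∧ s x ≤ 1) :
    Continuous fun x => sphereSegment (a x) (b x) (s x) := by
  unfold sphereSegment
  have h : Continuous fun x => (1 - s x) • a x + s x • b x := by fun_prop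
  exact (h.norm.inv₀ fun x => norm_ne_zero_iff.2
    (segment_ne_zero (ha x) (hb x) (hab x) (hs x).1 (hs x).2)).smul h

end Segment

theorem joined_rotTo {a b : Euc n} (ha : ‖a‖ = 1) (hb : ‖b‖ = 1) (hab : a + b ≠ 0) :
    Joined 1 (rotTo a b) := by
  refine ⟨⟨⟨fun s : I => rotTo a (sphereSegment a b s), ?_⟩, ?_, ?_⟩⟩
  · refine continuous_rotTo continuous_const ?_
      (fun s => norm_sphereSegment ha hb hab s.2.1 s.2.2)
      fun s => add_sphereSegment_ne_zero ha hb hab s.2.1 s.2.2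
    exact continuous_sphereSegment continuous_const continuous_const continuous_subtype_val
      (fun _ => ha) (fun _ => hb) (fun _ => hab) fun s => s.2
  · change rotTo a (sphereSegment a b ((0 : I) : ℝ)) = 1
    rw [Set.Icc.coe_zero, sphereSegment_zero ha, rotTo_self ha]
  · change rotTo a (sphereSegment a b ((1 : I) : ℝ)) = _
    rw [Set.Icc.coe_one, sphereSegment_one hb]

/-! #### The stabilizer of the last basis vector -/

/-- A matrix, enlarged by a diagonal entry `1`. -/
def inclMatrix (M : Matrix (Fin n) (Fin n) ℝ) : Matrix (Fin (n + 1)) (Fin (n + 1)) ℝ :=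
  reindex finSumFinEquiv finSumFinEquiv (fromBlocks M 0 0 (1 : Matrix (Fin 1) (Fin 1) ℝ))

theorem inclMatrix_mul (M N : Matrix (Fin n) (Fin n) ℝ) :
    inclMatrix (M * N) = inclMatrix M * inclMatrix N := by
  simp only [inclMatrix, reindex_apply, submatrix_mul_equiv, fromBlocks_multiply]
  simp

theorem inclMatrix_one : inclMatrix (1 : Matrix (Fin n) (Fin n) ℝ) = 1 := by
  simp [inclMatrix]

theorem inclMatrix_transpose (M : Matrix (Fin n) (Fin n) ℝ) :
    (inclMatrix M)ᵀ = inclMatrix Mᵀ := by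
  simp [inclMatrix, transpose_submatrix, fromBlocks_transpose]

theorem det_inclMatrix (M : Matrix (Fin n) (Fin n) ℝ) : (inclMatrix M).det = M.det := by
  simp [inclMatrix]

theorem inclMatrix_castSucc (M : Matrix (Fin n) (Fin n) ℝ) (i j : Fin n) :
    inclMatrix M i.castSucc j.castSucc = M i j := by
  change fromBlocks M 0 0 1 (finSumFinEquiv.symm (Fin.castAdd 1 i))
    (finSumFinEquiv.symm (Fin.castAdd 1 j)) = _
  simp

theorem inclMatrix_last_left (M : Matrix (Fin n) (Fin n) ℝ) (j : Fin (n + 1)) :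
    inclMatrix M (Fin.last n) j = if j = Fin.last n then 1 else 0 := by
  change fromBlocks M 0 0 1 (finSumFinEquiv.symm (Fin.natAdd n 0)) _ = _
  refine Fin.lastCases ?_ (fun j => ?_) j
  · change fromBlocks M 0 0 1 _ (finSumFinEquiv.symm (Fin.natAdd n 0)) = _
    simp
  · change fromBlocks M 0 0 1 _ (finSumFinEquiv.symm (Fin.castAdd 1 j)) = _
    simp [(Fin.castSucc_lt_last j).ne]

theorem inclMatrix_last_right (M : Matrix (Fin n) (Fin n) ℝ) (i : Fin (n + 1)) :
    inclMatrix M i (Fin.last n) = if i = Fin.last n then 1 else 0 := by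
  rw [← transpose_apply (inclMatrix M), inclMatrix_transpose, inclMatrix_last_left]

theorem continuous_inclMatrix :
    Continuous (inclMatrix : Matrix (Fin n) (Fin n) ℝ → Matrix (Fin (n + 1)) (Fin (n + 1)) ℝ) := by
  unfold inclMatrix
  exact (Continuous.matrix_fromBlocks continuous_id continuous_const continuous_const
    continuous_const).matrix_reindex _ _

theorem inclMatrix_injective :
    Function.Injective (inclMatrix : Matrix (Fin n) (Fin n) ℝ → _) := fun M N h => by
  ext i j
  rw [← inclMatrix_castSucc M, h, inclMatrix_castSucc]

/-- The standard embedding of `SO(n)` in `SO(n + 1)`. -/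
def inclSO (n : ℕ) : SO n →* SO (n + 1) where
  toFun A := ⟨inclMatrix A, by
    rw [mem_SO_iff, inclMatrix_transpose, ← inclMatrix_mul, det_inclMatrix, SO_mul_transpose,
      inclMatrix_one]
    exact ⟨rfl, (mem_SO_iff.1 A.2).2⟩⟩
  map_one' := Subtype.ext inclMatrix_one
  map_mul' A B := Subtype.ext (inclMatrix_mul _ _)

theorem coe_inclSO (A : SO n) :
    (inclSO n A : Matrix (Fin (n + 1)) (Fin (n + 1)) ℝ) = inclMatrix (A : Matrix _ _ ℝ) := rfl

theorem continuous_inclSO (n : ℕ) : Continuous (inclSO n) :=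
  (continuous_inclMatrix.comp continuous_subtype_val).subtype_mk _

/-- The last vector of the standard basis. -/
noncomputable def lastVec (n : ℕ) : Euc (n + 1) := EuclideanSpace.single (Fin.last n) 1

theorem norm_lastVec (n : ℕ) : ‖lastVec n‖ = 1 := by simp [lastVec]

/-- The image of the last basis vector under a matrix. -/
noncomputable def orbitMap (A : Matrix (Fin (n + 1)) (Fin (n + 1)) ℝ) : Euc (n + 1) :=
  WithLp.toLp 2 (A *ᵥ (lastVec n).ofLp)

theorem continuous_orbitMap :
    Continuous (orbitMap : Matrix (Fin (n + 1)) (Fin (n + 1)) ℝ → Euc (n + 1)) := by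
  unfold orbitMap
  fun_prop

theorem orbitMap_apply (A : Matrix (Fin (n + 1)) (Fin (n + 1)) ℝ) (i : Fin (n + 1)) :
    orbitMap A i = A i (Fin.last n) := by
  simp [orbitMap, lastVec]

theorem orbitMap_inclMatrix (M : Matrix (Fin n) (Fin n) ℝ) : orbitMap (inclMatrix M) = lastVec n := by
  ext i
  rw [orbitMap_apply, inclMatrix_last_right]
  simp [lastVec]

theorem norm_orbitMap (A : SO (n + 1)) :
    ‖orbitMap (A : Matrix (Fin (n + 1)) (Fin (n + 1)) ℝ)‖ = 1 := by
  have h := dotProduct_ofLp_self (orbitMap (A : Matrix (Fin (n + 1)) (Fin (n + 1)) ℝ))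
  rw [orbitMap, SO_dotProduct, dotProduct_ofLp_self, norm_lastVec] at h
  exact (pow_left_inj₀ (norm_nonneg _) zero_le_one two_ne_zero).1 (by rw [orbitMap]; exact h.symm)

theorem orbitMap_mul (A B : Matrix (Fin (n + 1)) (Fin (n + 1)) ℝ) :
    (orbitMap (A * B)).ofLp = A *ᵥ (orbitMap B).ofLp := by
  rw [orbitMap, orbitMap, mulVec_mulVec]

/-- If `A` fixes the last basis vector, so does its transpose, which is its inverse. Hence both the
last column and the last row are those of the identity. -/
theorem inclMatrix_submatrix {A : SO (n + 1)}
    (hA : orbitMap (A : Matrix (Fin (n + 1)) (Fin (n + 1)) ℝ) = lastVec n) :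
    inclMatrix ((A : Matrix (Fin (n + 1)) (Fin (n + 1)) ℝ).submatrix Fin.castSucc Fin.castSucc)
      = (A : Matrix (Fin (n + 1)) (Fin (n + 1)) ℝ) := by
  have hT : (A : Matrix (Fin (n + 1)) (Fin (n + 1)) ℝ)ᵀ *ᵥ (lastVec n).ofLp = (lastVec n).ofLp := by
    have h : (A : Matrix (Fin (n + 1)) (Fin (n + 1)) ℝ) *ᵥ (lastVec n).ofLp = (lastVec n).ofLp :=
      congrArg WithLp.ofLp hA
    conv_lhs => rw [← h]
    rw [mulVec_mulVec, SO_transpose_mul, one_mulVec]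
  ext i j
  refine Fin.lastCases ?_ (fun i => ?_) i
  · rw [inclMatrix_last_left]
    have h := congrFun hT j
    simp only [lastVec, PiLp.ofLp_single, mulVec_single_one, col_apply, transpose_apply,
      Pi.single_apply] at h
    rw [h]
  · refine Fin.lastCases ?_ (fun j => ?_) j
    · have h := congrFun (congrArg WithLp.ofLp hA) i.castSucc
      rw [orbitMap_apply] at h
      rw [inclMatrix_last_right, h]
      simp [lastVec]
    · rw [inclMatrix_castSucc, submatrix_apply]

open Classical in
/-- The inverse of the standard embedding, on the stabilizer of the last basis vector. -/
noncomputable def restrSO (A : SO (n + 1)) : SO n :=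
  if h : (A : Matrix (Fin (n + 1)) (Fin (n + 1)) ℝ).submatrix Fin.castSucc Fin.castSucc
      ∈ specialOrthogonalGroup (Fin n) ℝ then ⟨_, h⟩ else 1

theorem coe_restrSO {A : SO (n + 1)}
    (hA : orbitMap (A : Matrix (Fin (n + 1)) (Fin (n + 1)) ℝ) = lastVec n) :
    (restrSO A : Matrix (Fin n) (Fin n) ℝ)
      = (A : Matrix (Fin (n + 1)) (Fin (n + 1)) ℝ).submatrix Fin.castSucc Fin.castSucc := by
  have e := inclMatrix_submatrix hA
  rw [restrSO, dif_pos]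
  rw [mem_SO_iff]
  constructor
  · apply inclMatrix_injective
    rw [inclMatrix_mul, ← inclMatrix_transpose, e, SO_mul_transpose, inclMatrix_one]
  · rw [← det_inclMatrix, e]
    exact (mem_SO_iff.1 A.2).2

theorem inclSO_restrSO {A : SO (n + 1)}
    (hA : orbitMap (A : Matrix (Fin (n + 1)) (Fin (n + 1)) ℝ) = lastVec n) :
    inclSO n (restrSO A) = A :=
  Subtype.ext (by rw [coe_inclSO, coe_restrSO hA, inclMatrix_submatrix hA])

theorem restrSO_inclSO (A : SO n) : restrSO (inclSO n A) = A := by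
  refine Subtype.ext (inclMatrix_injective ?_)
  rw [← coe_inclSO, inclSO_restrSO]
  · rfl
  · exact orbitMap_inclMatrix _

theorem continuous_restrSO {X : Type*} [TopologicalSpace X] {f : X → SO (n + 1)}
    (hf : Continuous f)
    (h : ∀ x, orbitMap (f x : Matrix (Fin (n + 1)) (Fin (n + 1)) ℝ) = lastVec n) :
    Continuous fun x => restrSO (f x) := by
  refine continuous_induced_rng.2 ?_
  have e : (Subtype.val ∘ fun x => restrSO (f x)) = fun x =>
      (f x : Matrix (Fin (n + 1)) (Fin (n + 1)) ℝ).submatrix Fin.castSucc Fin.castSucc :=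
    funext fun x => coe_restrSO (h x)
  rw [e]
  exact (continuous_subtype_val.comp hf).matrix_submatrix _ _

/-! #### Path-connectedness -/

theorem joined_one_mul {A B : SO n} (hA : Joined 1 A) (hB : Joined 1 B) : Joined 1 (A * B) := by
  have h := hA.mul hB
  rwa [one_mul] at h

/-- Induction along the action on the sphere: rotations of the form `rotTo`, which are joined to
`1`, carry `A e` back to `e`, and what remains lies in `SO(n)`. -/
theorem joined_one_SO : ∀ (n : ℕ) (A : SO n), Joined 1 A
  | 0, A => by
    rw [show A = 1 from Subtype.ext (Subsingleton.elim _ _)]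
  | n + 1, A => by
    have ih := joined_one_SO n
    have he := norm_lastVec n
    have hx := norm_orbitMap A
    set e := lastVec n with hedef
    set x := orbitMap (A : Matrix (Fin (n + 1)) (Fin (n + 1)) ℝ) with hxdef
    -- `rotTo` is useless for antipodal vectors, so the way from `x` to `e` passes through a unit
    -- vector `y` antipodal to neither.
    by_cases hy : ∃ y : Euc (n + 1), ‖y‖ = 1 ∧ x + y ≠ 0 ∧ e + y ≠ 0
    · obtain ⟨y, hy1, hxy, hey⟩ := hy
      have h1 : orbitMap (((rotTo e y)⁻¹ * (rotTo x y * A) : SO (n + 1)) :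
          Matrix (Fin (n + 1)) (Fin (n + 1)) ℝ) = lastVec n := by
        apply WithLp.ofLp_injective
        rw [SO_coe_mul, SO_coe_mul, orbitMap_mul, orbitMap_mul, ← hxdef, rotTo_mulVec hx hy1 hxy,
          ← rotTo_mulVec he hy1 hey, mulVec_mulVec, ← SO_coe_mul, inv_mul_cancel, SO_coe_one,
          one_mulVec]
      have h2 : Joined 1 ((rotTo e y)⁻¹ * (rotTo x y * A)) := by
        rw [← inclSO_restrSO h1, ← map_one (inclSO n)]
        exact (ih _).map (continuous_inclSO n)
      have h3 : A = (rotTo x y)⁻¹ * (rotTo e y * ((rotTo e y)⁻¹ * (rotTo x y * A))) := by group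
      rw [h3]
      have h4 := (joined_rotTo hx hy1 hxy).inv
      rw [inv_one] at h4
      exact joined_one_mul h4 (joined_one_mul (joined_rotTo he hy1 hey) h2)
    · push Not at hy
      have hxe : e + x = 0 := hy x hx (by
        rw [← two_smul ℝ]
        refine smul_ne_zero two_ne_zero fun h => ?_
        rw [h, norm_zero] at hx
        exact zero_ne_one hx)
      -- Taking `y = x` shows that only `x = -e` can fail. On the line the determinant excludes
      -- this; in higher dimension the first basis vector is a suitable `y`.
      rcases n with _ | n
      · exfalso
        have h0 := (mem_SO_iff.1 A.2).2
        rw [det_fin_one] at h0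
        have h1 := congrFun (congrArg WithLp.ofLp hxe) 0
        have h2 : x 0 = 1 := (orbitMap_apply _ _).trans h0
        have h3 : e 0 = 1 := by simp [hedef, lastVec]
        rw [WithLp.ofLp_add, Pi.add_apply, h2, h3] at h1
        norm_num at h1
      · exfalso
        have hne : ∀ c : ℝ, e + c • EuclideanSpace.single (0 : Fin (n + 2)) (1 : ℝ) ≠ 0 := by
          intro c h
          have h1 := congrFun (congrArg WithLp.ofLp h) (Fin.last (n + 1))
          simp [hedef, lastVec] at h1
        refine hne 1 ?_
        rw [one_smul]
        refine hy _ (by simp) fun h => hne (-1) ?_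
        rw [eq_neg_of_add_eq_zero_right hxe] at h
        rw [neg_smul, one_smul, ← neg_eq_zero, neg_add, neg_neg]
        exact h

instance (n : ℕ) : PathConnectedSpace (SO n) where
  nonempty := ⟨1⟩
  joined A B := (joined_one_SO n A).symm.trans (joined_one_SO n B)

end SpecialOrthogonal

/-! ### General position -/

section GeneralPosition

variable {W V : Type*} [NormedAddCommGroup W] [NormedSpace ℝ W] [FiniteDimensional ℝ W]
  [NormedAddCommGroup V] [InnerProductSpace ℝ V]

/-- Near each point a constant approximates `F`; a smooth partition of unity glues these constants,
since balls are convex. -/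
theorem exists_contDiff_near {F : W → V} (hF : Continuous F) {δ : ℝ} (hδ : 0 < δ) :
    ∃ P : W → V, ContDiff ℝ 1 P ∧ ∀ w, ‖P w - F w‖ < δ := by
  obtain ⟨g, hg⟩ := exists_contMDiffMap_forall_mem_convex_of_local_const
    (modelWithCornersSelf ℝ W) (M := W) (F := V) (n := 1) (t := fun w => Metric.ball (F w) δ)
    (fun w => convex_ball _ _) fun w => ⟨F w, by
      have := (hF.continuousAt (x := w)).eventually (Metric.ball_mem_nhds (F w) hδ)
      filter_upwards [this] with y hy
      rwa [Metric.mem_ball_comm]⟩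
  exact ⟨g, contMDiff_iff_contDiff.1 g.contMDiff, fun w => by
    simpa [dist_eq_norm] using hg w⟩

/-- A map to the unit sphere of a space of large dimension can be moved a little, keeping it fixed
where it takes the value `e`, so that it misses some point. -/
theorem exists_missing_point [FiniteDimensional ℝ V]
    (hWV : Module.finrank ℝ W + 1 < Module.finrank ℝ V) {F : W → V}
    (hF : Continuous F) (hF1 : ∀ w, ‖F w‖ = 1) {e : V} (he : ‖e‖ = 1) :
    ∃ g : W → V, Continuous g ∧ (∀ w, ‖g w‖ = 1) ∧ (∀ w, F w + g w ≠ 0) ∧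
      (∀ w, F w = e → g w = e) ∧ ∃ p : V, ‖p‖ = 1 ∧ p ≠ e ∧ ∀ w, g w ≠ p := by
  obtain ⟨P, hP, hPF⟩ := exists_contDiff_near hF (δ := 1 / 4) (by norm_num)
  -- The cone over the image of `P` is a `C¹` image of a space of dimension less than that of `V`.
  -- So some `q` off this cone lies close to `-e`; its direction will be the missing point.
  have hd : Dense (Set.range fun x : W × ℝ => x.2 • P x.1)ᶜ := by
    refine ContDiff.dense_compl_range_of_finrank_lt_finrank ?_ ?_
    · exact contDiff_snd.smul (hP.comp contDiff_fst)
    · rwa [Module.finrank_prod, Module.finrank_self]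
  obtain ⟨q, hq, hqe⟩ := hd.exists_mem_open Metric.isOpen_ball
    ⟨-e, Metric.mem_ball_self (ε := 1) one_pos⟩
  rw [Metric.mem_ball, dist_eq_norm, sub_neg_eq_add] at hqe
  have hqe' : inner ℝ q e < 0 := by
    have h1 : inner ℝ (q + e) e ≤ ‖q + e‖ * ‖e‖ := real_inner_le_norm _ _
    rw [inner_add_left, real_inner_self_eq_norm_sq, he] at h1
    linarith
  have hq0 : q ≠ 0 := by
    rintro rfl
    rw [inner_zero_left] at hqe'
    exact lt_irrefl _ hqe'
  -- A cut-off that vanishes where `F = e` and is `1` as soon as `F` is at distance `1/4` from `e`.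
  -- Then `H` equals `F` in the first case and `P` in the second.
  let χ : W → ℝ := fun w => min 1 (4 * ‖F w - e‖)
  have hχ0 : ∀ w, 0 ≤ χ w := fun w => le_min zero_le_one (by positivity)
  have hχ1 : ∀ w, χ w ≤ 1 := fun w => min_le_left _ _
  let H : W → V := fun w => F w + χ w • (P w - F w)
  have hHF : ∀ w, ‖H w - F w‖ < 1 / 4 := fun w => by
    have h1 : H w - F w = χ w • (P w - F w) := add_sub_cancel_left _ _
    rw [h1, norm_smul, Real.norm_of_nonneg (hχ0 w)]
    exact (mul_le_of_le_one_left (norm_nonneg _) (hχ1 w)).trans_lt (hPF w)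
  have hHF' : ∀ w, 0 < inner ℝ (H w) (F w) := fun w => by
    have h1 : -(inner ℝ (H w - F w) (F w)) ≤ ‖H w - F w‖ * ‖F w‖ :=
      (neg_le_abs _).trans (abs_real_inner_le_norm _ _)
    rw [inner_sub_left, real_inner_self_eq_norm_sq, hF1] at h1
    linarith [hHF w]
  have hH0 : ∀ w, H w ≠ 0 := fun w h => by
    have := hHF' w
    rw [h, inner_zero_left] at this
    exact lt_irrefl _ this
  have hHc : Continuous H := by
    have := hP.continuous
    fun_prop
  have hn : ∀ w, 0 < ‖H w‖ := fun w => norm_pos_iff.2 (hH0 w)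
  have hqn : 0 < ‖q‖ := norm_pos_iff.2 hq0
  refine ⟨fun w => ‖H w‖⁻¹ • H w, ?_, fun w => norm_smul_inv_norm (𝕜 := ℝ) (hH0 w), fun w h => ?_,
    fun w h => ?_, ‖q‖⁻¹ • q, norm_smul_inv_norm (𝕜 := ℝ) hq0, fun h => ?_, fun w h => ?_⟩
  · exact (hHc.norm.inv₀ fun w => (hn w).ne').smul hHc
  · have h1 := congrArg (fun v => inner ℝ v (F w)) h
    simp only [inner_add_left, inner_smul_left, real_inner_self_eq_norm_sq, hF1,
      inner_zero_left] at h1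
    have h2 : 0 < ‖H w‖⁻¹ * inner ℝ (H w) (F w) := mul_pos (inv_pos.2 (hn w)) (hHF' w)
    simp only [conj_trivial] at h1
    linarith
  · have h1 : χ w = 0 := by simp [χ, h]
    have h2 : H w = e := by simp [H, h1, h]
    simp only [h2, he, inv_one, one_smul]
  · have h1 := congrArg (fun v => inner ℝ v e) h
    simp only [inner_smul_left, real_inner_self_eq_norm_sq, he, conj_trivial] at h1
    have h2 : ‖q‖⁻¹ * inner ℝ q e < 0 := mul_neg_of_pos_of_neg (inv_pos.2 hqn) hqe'
    linarith
  · have h1 : q = (‖q‖ * ‖H w‖⁻¹) • H w := by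
      have h' : ‖H w‖⁻¹ • H w = ‖q‖⁻¹ • q := h
      rw [mul_smul, h', smul_inv_smul₀ hqn.ne']
    have hc : 0 < ‖q‖ * ‖H w‖⁻¹ := mul_pos hqn (inv_pos.2 (hn w))
    -- Suppose `q` is on the ray of `H w`. Where `χ = 1` this puts `q` on the cone over `P`.
    -- Elsewhere `H w` is within `1/4 + 1/4` of `e`, so its inner product with `e` is positive,
    -- while that of `q` is negative.
    rcases le_or_gt 1 (4 * ‖F w - e‖) with h2 | h2
    · have h3 : χ w = 1 := min_eq_left h2
      have h4 : H w = P w := by simp [H, h3]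
      exact hq ⟨(w, ‖q‖ * ‖H w‖⁻¹), by change (_ : ℝ) • P w = q; rw [← h4, ← h1]⟩
    · have h3 : ‖H w - e‖ ≤ ‖H w - F w‖ + ‖F w - e‖ := norm_sub_le_norm_sub_add_norm_sub _ _ _
      have h4 : -(inner ℝ (H w - e) e) ≤ ‖H w - e‖ * ‖e‖ :=
        (neg_le_abs _).trans (abs_real_inner_le_norm _ _)
      rw [inner_sub_left, real_inner_self_eq_norm_sq, he] at h4
      have h5 : 0 < inner ℝ (H w) e := by linarith [hHF w]
      have h6 : inner ℝ q e = ‖q‖ * ‖H w‖⁻¹ * inner ℝ (H w) e := by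
        conv_lhs => rw [h1]
        rw [inner_smul_left, conj_trivial]
      have h7 := mul_pos hc h5
      linarith

end GeneralPosition

/-! ### Spheres -/

section Sphere

variable {V : Type*} [NormedAddCommGroup V] [InnerProductSpace ℝ V]

theorem contractibleSpace_sphere_compl {p : V} (hp : ‖p‖ = 1) :
    ContractibleSpace {x : V // ‖x‖ = 1 ∧ x ≠ p} := by
  let e := stereographic hp
  have h : e.source = {(⟨p, by simp [hp]⟩ : Metric.sphere (0 : V) 1)}ᶜ := stereographic_source hp
  have h' : e.target = Set.univ := stereographic_target hp
  let e1 : {x : V // ‖x‖ = 1 ∧ x ≠ p} ≃ₜ e.source :=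
    { toFun := fun x => ⟨⟨x, by simp [x.2.1]⟩, by
        rw [h]; exact fun h2 => x.2.2 (congrArg Subtype.val h2)⟩
      invFun := fun x => ⟨x, by simp, fun h2 =>
        h.subset x.2 (Subtype.ext h2)⟩
      left_inv := fun _ => rfl
      right_inv := fun _ => rfl
      continuous_toFun := by fun_prop
      continuous_invFun := by fun_prop }
  let e2 := (e1.trans e.toHomeomorphSourceTarget).trans ((Homeomorph.setCongr h').trans
    (Homeomorph.Set.univ _))
  exact e2.contractibleSpace

/-- A loop on a sphere of dimension at least two, as a map on the interval, can be moved to a loop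
that misses a point. -/
theorem exists_missing_point_loop [FiniteDimensional ℝ V]
    (hV : 3 ≤ Module.finrank ℝ V) {F : C(I, V)}
    (hF1 : ∀ t, ‖F t‖ = 1) {e : V} (hF0 : F 0 = e) (hFe : F 1 = e) :
    ∃ g : C(I, V), (∀ t, ‖g t‖ = 1) ∧ (∀ t, F t + g t ≠ 0) ∧ g 0 = e ∧ g 1 = e ∧
      ∃ p : V, ‖p‖ = 1 ∧ p ≠ e ∧ ∀ t, g t ≠ p := by
  have he : ‖e‖ = 1 := hF0 ▸ hF1 0
  -- General position is stated for maps on a vector space, so the loop is extended to the line by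
  -- its end values.
  obtain ⟨g, hg, hg1, hFg, hge, p, hp, hpe, hgp⟩ := exists_missing_point (W := ℝ) (V := V)
    (F := fun t => F (Set.projIcc 0 1 zero_le_one t)) (by rw [Module.finrank_self]; omega)
    (F.continuous.comp continuous_projIcc) (fun _ => hF1 _) he
  refine ⟨⟨fun t => g t, by fun_prop⟩, fun t => hg1 t, fun t => ?_, hge _ ?_, hge _ ?_, p, hp, hpe,
    fun t => hgp t⟩
  · have := hFg t
    rwa [Set.projIcc_val] at this
  · rw [Set.projIcc_val]; exact hF0
  · rw [Set.projIcc_val]; exact hFe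

/-- Loops in a contractible space are null-homotopic in every space it maps to. -/
theorem homotopicRel_const_of_contractible {X Y : Type*} [TopologicalSpace X] [TopologicalSpace Y]
    [ContractibleSpace X] (j : C(X, Y)) (ℓ : C(I, X)) {y : Y} (h0 : j (ℓ 0) = y)
    (h1 : ℓ 1 = ℓ 0) : (j.comp ℓ).HomotopicRel (ContinuousMap.const I y) {0, 1} := by
  subst h0
  have h : (⟨ℓ, rfl, h1⟩ : Path (ℓ 0) (ℓ 0)).Homotopic (Path.refl (ℓ 0)) :=
    SimplyConnectedSpace.paths_homotopic _ _
  have h' : ℓ.HomotopicRel (ContinuousMap.const I (ℓ 0)) {0, 1} := h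
  exact h'.comp_continuousMap j

/-- A loop is pushed along projected segments to a nearby loop that misses a point, and the sphere
without a point is contractible. The ends do not move, because there the segment is constant. -/
theorem simplyConnectedSpace_sphere [FiniteDimensional ℝ V] (hV : 3 ≤ Module.finrank ℝ V) :
    SimplyConnectedSpace (Metric.sphere (0 : V) 1) := by
  rw [simply_connected_iff_loops_nullhomotopic]
  constructor
  · rw [← isPathConnected_iff_pathConnectedSpace]
    refine isPathConnected_sphere ?_ 0 zero_le_one
    rw [← Module.finrank_eq_rank]
    exact_mod_cast (by omega : 1 < Module.finrank ℝ V)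
  · intro x γ
    have hγ : ∀ t, ‖(γ t : V)‖ = 1 := fun t => by simp
    obtain ⟨g, hg1, hFg, hg0, hge, p, hp, hpe, hgp⟩ := exists_missing_point_loop hV
      (F := ⟨fun t => (γ t : V), by fun_prop⟩) hγ (e := (x : V)) (by simp) (by simp)
    have := contractibleSpace_sphere_compl hp
    let j : C({x : V // ‖x‖ = 1 ∧ x ≠ p}, Metric.sphere (0 : V) 1) :=
      ⟨fun x => ⟨x, by simp [x.2.1]⟩, by fun_prop⟩
    let ℓ : C(I, {x : V // ‖x‖ = 1 ∧ x ≠ p}) := ⟨fun t => ⟨g t, hg1 t, hgp t⟩, by fun_prop⟩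
    have h2 : (j.comp ℓ).HomotopicRel (ContinuousMap.const I x) {0, 1} :=
      homotopicRel_const_of_contractible j ℓ (Subtype.ext hg0) (Subtype.ext (hge.trans hg0.symm))
    refine ContinuousMap.HomotopicRel.trans (g := j.comp ℓ) ⟨⟨⟨⟨fun q =>
      ⟨sphereSegment (γ q.2 : V) (g q.2) q.1, ?_⟩, ?_⟩, fun t => ?_, fun t => ?_⟩, ?_⟩⟩ h2
    · simpa using norm_sphereSegment (hγ _) (hg1 _) (hFg _) q.1.2.1 q.1.2.2
    · refine Continuous.subtype_mk (continuous_sphereSegment (by fun_prop) (by fun_prop)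
        (by fun_prop) (fun q => hγ _) (fun q => hg1 _) (fun q => hFg _) fun q => q.1.2) _
    · exact Subtype.ext (sphereSegment_zero (hγ t))
    · exact Subtype.ext (sphereSegment_one (hg1 t))
    · rintro s t ht
      have h3 : g t = γ t := by
        rcases ht with rfl | rfl
        · rw [hg0, γ.source]
        · rw [hge, γ.target]
      refine Subtype.ext ?_
      change sphereSegment (γ t : V) (g t) s = _
      rw [h3, sphereSegment_self (hγ t)]
      rfl

end Sphere

/-! ### The fundamental groups of the special orthogonal groups stabilize -/

section Stabilization

open Matrix

variable {n : ℕ}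

/-- A rotation that takes the last basis vector to `x`, defined for `x ≠ p`. -/
noncomputable def frameAt (p x : Euc (n + 1)) : SO (n + 1) :=
  rotTo (-p) x * (rotTo (-p) (lastVec n))⁻¹

theorem frameAt_lastVec (p : Euc (n + 1)) : frameAt p (lastVec n) = 1 := mul_inv_cancel _

theorem neg_add_ne_zero {p x : Euc (n + 1)} (h : x ≠ p) : -p + x ≠ 0 := fun h' =>
  h (neg_add_eq_zero.1 h').symm

/-- The second factor takes the last basis vector to `-p`, the first takes `-p` to `x`. So `frameAt
p` is a section, over the complement of `p`, of the action on the last basis vector. -/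
theorem frameAt_mulVec {p x : Euc (n + 1)} (hp : ‖p‖ = 1) (hpe : p ≠ lastVec n) (hx : ‖x‖ = 1)
    (hxp : x ≠ p) :
    (frameAt p x : Matrix (Fin (n + 1)) (Fin (n + 1)) ℝ) *ᵥ (lastVec n).ofLp = x.ofLp := by
  have hp' : ‖-p‖ = 1 := by rwa [norm_neg]
  rw [frameAt, SO_coe_mul, ← mulVec_mulVec,
    ← rotTo_mulVec hp' (norm_lastVec n) (neg_add_ne_zero hpe.symm), mulVec_mulVec _ _ (rotTo _ _).1,
    ← SO_coe_mul, inv_mul_cancel, SO_coe_one, one_mulVec, rotTo_mulVec hp' hx (neg_add_ne_zero hxp)]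

theorem continuous_frameAt {X : Type*} [TopologicalSpace X] {p : Euc (n + 1)}
    {x : X → Euc (n + 1)} (hx : Continuous x) (hx1 : ∀ y, ‖x y‖ = 1) (hxp : ∀ y, x y ≠ p) :
    Continuous fun y => frameAt p (x y) :=
  (continuous_rotTo continuous_const hx hx1 fun y => neg_add_ne_zero (hxp y)).mul continuous_const

/-- A map to `SO(n + 1)` is corrected to a map to `SO(n)`, if the images of the last basis vector
are close to a map that misses a point of the sphere. -/
theorem exists_correction {K : Type*} [TopologicalSpace K] (f : C(K, SO (n + 1)))
    {g : K → Euc (n + 1)} (hg : Continuous g) (hg1 : ∀ x, ‖g x‖ = 1)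
    (hfg : ∀ x, orbitMap (f x : Matrix (Fin (n + 1)) (Fin (n + 1)) ℝ) + g x ≠ 0)
    {p : Euc (n + 1)} (hp : ‖p‖ = 1) (hpe : p ≠ lastVec n) (hgp : ∀ x, g x ≠ p) :
    ∃ h : C(K, SO n), ∀ x, inclSO n (h x) = (frameAt p (g x))⁻¹ *
      (rotTo (orbitMap (f x : Matrix (Fin (n + 1)) (Fin (n + 1)) ℝ)) (g x) * f x) := by
  have hF : Continuous fun x => orbitMap (f x : Matrix (Fin (n + 1)) (Fin (n + 1)) ℝ) :=
    continuous_orbitMap.comp (continuous_subtype_val.comp f.continuous)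
  have ho : ∀ x, orbitMap (((frameAt p (g x))⁻¹ *
      (rotTo (orbitMap (f x : Matrix (Fin (n + 1)) (Fin (n + 1)) ℝ)) (g x) * f x) : SO (n + 1)) :
      Matrix (Fin (n + 1)) (Fin (n + 1)) ℝ) = lastVec n := fun x => by
    apply WithLp.ofLp_injective
    rw [SO_coe_mul, SO_coe_mul, orbitMap_mul, orbitMap_mul,
      rotTo_mulVec (norm_orbitMap _) (hg1 x) (hfg x), ← frameAt_mulVec hp hpe (hg1 x) (hgp x),
      mulVec_mulVec, ← SO_coe_mul, inv_mul_cancel, SO_coe_one, one_mulVec]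
  refine ⟨⟨_, continuous_restrSO ?_ ho⟩, fun x => inclSO_restrSO (ho x)⟩
  exact (continuous_frameAt hg hg1 hgp).inv.mul
    ((continuous_rotTo hF hg hg1 hfg).mul f.continuous)

/-- Where `g` is the last basis vector and `f` is already in `SO(n)`, both correcting rotations are
`1`. This is what keeps boundary values fixed in the homotopies. -/
theorem exists_correction_eq {f : SO (n + 1)} {g p : Euc (n + 1)} {h : SO n} {B : SO n}
    (hh : inclSO n h = (frameAt p g)⁻¹ *
      (rotTo (orbitMap (f : Matrix (Fin (n + 1)) (Fin (n + 1)) ℝ)) g * f))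
    (hg : g = lastVec n) (hB : f = inclSO n B) : h = B := by
  have ho : orbitMap (f : Matrix (Fin (n + 1)) (Fin (n + 1)) ℝ) = lastVec n := by
    rw [hB]; exact orbitMap_inclMatrix _
  rw [ho, hg, frameAt_lastVec, rotTo_self (norm_lastVec n), inv_one, one_mul, one_mul, hB] at hh
  rw [← restrSO_inclSO h, hh, restrSO_inclSO]

/-- A loop in `SO(n + 1)` is homotopic to a loop in `SO(n)`, for `n ≥ 2`. -/
theorem exists_homotopicRel_inclSO (hn : 2 ≤ n) (γ : C(I, SO (n + 1))) (h0 : γ 0 = 1)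
    (h1 : γ 1 = 1) : ∃ h : C(I, SO n), h 0 = 1 ∧ h 1 = 1 ∧
      γ.HomotopicRel ((⟨inclSO n, continuous_inclSO n⟩ : C(SO n, SO (n + 1))).comp h) {0, 1} := by
  have ho1 : orbitMap ((1 : SO (n + 1)) : Matrix (Fin (n + 1)) (Fin (n + 1)) ℝ) = lastVec n := by
    rw [SO_coe_one, ← inclMatrix_one, orbitMap_inclMatrix]
  have hF : Continuous fun t => orbitMap (γ t : Matrix (Fin (n + 1)) (Fin (n + 1)) ℝ) :=
    continuous_orbitMap.comp (continuous_subtype_val.comp γ.continuous)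
  obtain ⟨g, hg1, hFg, hg0, hge, p, hp, hpe, hgp⟩ := exists_missing_point_loop
    (by rw [finrank_euclideanSpace_fin]; omega)
    (F := ⟨_, hF⟩) (fun t => norm_orbitMap _) (e := lastVec n) (by
      change orbitMap (γ 0 : Matrix (Fin (n + 1)) (Fin (n + 1)) ℝ) = _
      rw [h0, ho1]) (by
      change orbitMap (γ 1 : Matrix (Fin (n + 1)) (Fin (n + 1)) ℝ) = _
      rw [h1, ho1])
  obtain ⟨h, hh⟩ := exists_correction γ g.continuous hg1 hFg hp hpe hgp
  refine ⟨h, exists_correction_eq (hh 0) hg0 (by rw [h0, map_one]),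
    exists_correction_eq (hh 1) hge (by rw [h1, map_one]), ?_⟩
  have hends : ∀ t ∈ ({0, 1} : Set I), orbitMap (γ t : Matrix (Fin (n + 1)) (Fin (n + 1)) ℝ)
      = lastVec n ∧ g t = lastVec n := by
    rintro t (rfl | rfl)
    · rw [h0, ho1]; exact ⟨rfl, hg0⟩
    · rw [h1, ho1]; exact ⟨rfl, hge⟩
  -- `γ` is the product of `A⁻¹`, the frame along `g`, and the corrected loop in `SO(n)`. The first
  -- factor is null-homotopic along segments of the sphere, the second because it comes from the
  -- contractible complement of `p`.
  let A : C(I, SO (n + 1)) := ⟨_, continuous_rotTo hF g.continuous hg1 hFg⟩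
  have hA : (1 : C(I, SO (n + 1))).HomotopicRel A {0, 1} := by
    refine ⟨⟨⟨⟨fun q => rotTo (orbitMap (γ q.2 : Matrix (Fin (n + 1)) (Fin (n + 1)) ℝ))
      (sphereSegment (orbitMap (γ q.2 : Matrix (Fin (n + 1)) (Fin (n + 1)) ℝ)) (g q.2) q.1), ?_⟩,
      fun t => ?_, fun t => ?_⟩, ?_⟩⟩
    · refine continuous_rotTo (hF.comp continuous_snd) ?_
        (fun q => norm_sphereSegment (norm_orbitMap _) (hg1 _) (hFg _) q.1.2.1 q.1.2.2)
        fun q => add_sphereSegment_ne_zero (norm_orbitMap _) (hg1 _) (hFg _) q.1.2.1 q.1.2.2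
      exact continuous_sphereSegment (hF.comp continuous_snd) (by fun_prop) (by fun_prop)
        (fun q => norm_orbitMap _) (fun q => hg1 _) (fun q => hFg _) fun q => q.1.2
    · change rotTo _ (sphereSegment _ _ ((0 : I) : ℝ)) = 1
      rw [Set.Icc.coe_zero, sphereSegment_zero (norm_orbitMap _), rotTo_self (norm_orbitMap _)]
    · change rotTo _ (sphereSegment _ _ ((1 : I) : ℝ)) = _
      rw [Set.Icc.coe_one, sphereSegment_one (hg1 _)]
      rfl
    · intro s t ht
      change rotTo _ (sphereSegment _ _ (s : ℝ)) = 1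
      rw [(hends t ht).1, (hends t ht).2, sphereSegment_self (norm_lastVec n),
        rotTo_self (norm_lastVec n)]
  have := contractibleSpace_sphere_compl hp
  let j : C({x : Euc (n + 1) // ‖x‖ = 1 ∧ x ≠ p}, SO (n + 1)) :=
    ⟨_, continuous_frameAt continuous_subtype_val (fun x => x.2.1) fun x => x.2.2⟩
  let ℓ : C(I, {x : Euc (n + 1) // ‖x‖ = 1 ∧ x ≠ p}) := ⟨fun t => ⟨g t, hg1 t, hgp t⟩, by fun_prop⟩
  have hj : (j.comp ℓ).HomotopicRel 1 {0, 1} := by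
    refine homotopicRel_const_of_contractible j ℓ ?_ (Subtype.ext (hge.trans hg0.symm))
    change frameAt p (g 0) = 1
    rw [hg0, frameAt_lastVec]
  let h' := (⟨inclSO n, continuous_inclSO n⟩ : C(SO n, SO (n + 1))).comp h
  have e : γ = A⁻¹ * (j.comp ℓ * h') := by
    ext1 t
    change γ t = (rotTo _ (g t))⁻¹ * (frameAt p (g t) * inclSO n (h t))
    rw [hh t]
    group
  have hfin := homotopicRel_mul (homotopicRel_inv hA.symm)
    (homotopicRel_mul hj (ContinuousMap.HomotopicRel.refl h'))
  rw [← e, inv_one, one_mul, one_mul] at hfin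
  exact hfin

/-- A loop in `SO(n)` that is null-homotopic in `SO(n + 1)` is null-homotopic, for `n ≥ 3`. -/
theorem homotopicRel_one_of_inclSO (hn : 3 ≤ n) (α : C(I, SO n))
    (hα : ((⟨inclSO n, continuous_inclSO n⟩ : C(SO n, SO (n + 1))).comp α).HomotopicRel 1 {0, 1}) :
    α.HomotopicRel 1 {0, 1} := by
  obtain ⟨H⟩ := hα
  let π : ℝ → I := Set.projIcc 0 1 zero_le_one
  have hπ : Continuous π := continuous_projIcc
  -- The null-homotopy, extended to the plane. General position needs `2 + 1 < n + 1`, whence the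
  -- bound `n ≥ 3`.
  let f : C(ℝ × ℝ, SO (n + 1)) := ⟨fun q => H (π q.1, π q.2), by fun_prop⟩
  have hF : Continuous fun q => orbitMap (f q : Matrix (Fin (n + 1)) (Fin (n + 1)) ℝ) :=
    continuous_orbitMap.comp (continuous_subtype_val.comp f.continuous)
  obtain ⟨g, hg, hg1, hFg, hge, p, hp, hpe, hgp⟩ := exists_missing_point
    (by rw [Module.finrank_prod, Module.finrank_self, finrank_euclideanSpace_fin]; omega) hF
    (fun q => norm_orbitMap _) (norm_lastVec n)
  obtain ⟨h, hh⟩ := exists_correction f hg hg1 hFg hp hpe hgp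
  -- The correction changes nothing where the homotopy takes values in `SO(n)`, in particular on the
  -- boundary of the square; so it is a null-homotopy of `α` itself.
  have key : ∀ (q : I × I) (B : SO n), H q = inclSO n B → h (q.1, q.2) = B := by
    intro q B hq
    have hfq : f (q.1, q.2) = inclSO n B := by
      change H (π q.1, π q.2) = _
      rw [← hq]
      simp only [π, Set.projIcc_val]
    refine exists_correction_eq (hh _) (hge _ ?_) hfq
    rw [hfq]; exact orbitMap_inclMatrix _
  refine ⟨⟨⟨⟨fun q => h (q.1, q.2), by fun_prop⟩, fun t => key (0, t) _ (H.apply_zero t),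
    fun t => key (1, t) _ ((H.apply_one t).trans (map_one (inclSO n)).symm)⟩, fun s t ht => ?_⟩⟩
  exact key (s, t) (α t) (H.eq_fst s ht)

theorem nonempty_fundamentalGroup_SO_succ (hn : 3 ≤ n) :
    Nonempty (FundamentalGroup (SO n) 1 ≃* FundamentalGroup (SO (n + 1)) 1) := by
  let j : C(SO n, SO (n + 1)) := ⟨inclSO n, continuous_inclSO n⟩
  have hj : j 1 = 1 := map_one (inclSO n)
  have key : Nonempty (FundamentalGroup (SO n) 1 ≃* FundamentalGroup (SO (n + 1)) (j 1)) := by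
    refine ⟨MulEquiv.ofBijective (FundamentalGroup.map j 1) ⟨?_, ?_⟩⟩
    · rw [injective_iff_map_eq_one]
      intro a ha
      induction a using Quotient.inductionOn with
      | h a =>
        refine Path.Homotopic.Quotient.eq.2 ?_
        have h2 : (a.map j.continuous).Homotopic (Path.refl (j 1)) :=
          Path.Homotopic.Quotient.eq.1 ha
        have h3 : (j.comp a.toContinuousMap).HomotopicRel (ContinuousMap.const I (j 1)) {0, 1} := h2
        rw [hj] at h3
        exact homotopicRel_one_of_inclSO hn a.toContinuousMap h3
    · intro b
      induction b using Quotient.inductionOn with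
      | h b =>
        obtain ⟨h, h0, h1, hb⟩ := exists_homotopicRel_inclSO (by omega) b.toContinuousMap
          (b.source.trans hj) (b.target.trans hj)
        refine ⟨loopClass ⟨h, h0, h1⟩, ?_⟩
        refine Path.Homotopic.Quotient.eq.2 (Path.Homotopic.symm ?_)
        exact hb
  rwa [hj] at key

end Stabilization

/-! ### The fundamental groups of the special orthogonal groups -/

section LowDimensions

open Matrix

theorem exists_angle {a b : ℝ} (h : a ^ 2 + b ^ 2 = 1) :
    ∃ t ∈ Set.Icc (-Real.pi) Real.pi, Real.cos t = a ∧ Real.sin t = b := by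
  have hz : ‖(⟨a, b⟩ : ℂ)‖ = 1 := by
    rw [← pow_left_inj₀ (norm_nonneg _) zero_le_one two_ne_zero, one_pow, ← Complex.normSq_eq_norm_sq,
      Complex.normSq_apply, ← sq, ← sq]
    exact h
  refine ⟨Complex.arg ⟨a, b⟩, ⟨(Complex.neg_pi_lt_arg _).le, Complex.arg_le_pi _⟩, ?_, ?_⟩
  · rw [Complex.cos_arg (norm_ne_zero_iff.1 (by rw [hz]; exact one_ne_zero)), hz, div_one]
  · rw [Complex.sin_arg, hz, div_one]

/-- The restriction to `K` is a continuous surjection from a compact space to a Hausdorff one, hence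
closed and a quotient map. -/
theorem isQuotientMap_of_compact {X Y : Type*} [TopologicalSpace X] [TopologicalSpace Y] [T2Space Y]
    {f : X → Y} (hf : Continuous f) {K : Set X} (hK : IsCompact K) (hs : ∀ y, ∃ x ∈ K, f x = y) :
    Topology.IsQuotientMap f := by
  have := isCompact_iff_compactSpace.1 hK
  refine Topology.IsQuotientMap.of_comp (f := ((↑) : K → X)) continuous_subtype_val hf ?_
  have h : Continuous (f ∘ ((↑) : K → X)) := hf.comp continuous_subtype_val
  refine h.isClosedMap.isQuotientMap h fun y => ?_
  obtain ⟨x, hx, rfl⟩ := hs y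
  exact ⟨⟨x, hx⟩, rfl⟩

/-- The fundamental group of a quotient of a simply connected group by a discrete normal
subgroup. -/
theorem nonempty_fundamentalGroup_equiv_ker_hom {E H : Type*} [Group E] [TopologicalSpace E]
    [IsTopologicalGroup E] [SimplyConnectedSpace E] [Group H] [TopologicalSpace H] {p : E →* H}
    (hp : Topology.IsQuotientMap p) (hd : IsDiscrete (p.ker : Set E)) :
    Nonempty (FundamentalGroup H 1 ≃* p.ker) := by
  obtain ⟨η, -⟩ := exists_fundamentalGroup_equiv hp _ hd
    (fun {a b} => by rw [MonoidHom.mem_ker, map_mul, map_inv, inv_mul_eq_one]) (map_one p)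
  exact ⟨η⟩

/-- The rotations of the plane. -/
noncomputable def planeRotation : Multiplicative ℝ →* SO 2 where
  toFun t := ⟨!![Real.cos t.toAdd, -Real.sin t.toAdd; Real.sin t.toAdd, Real.cos t.toAdd], by
    rw [mem_specialOrthogonalGroup_fin_two_iff]
    simp⟩
  map_one' := by
    refine Subtype.ext ?_
    ext i j
    fin_cases i <;> fin_cases j <;> simp
  map_mul' s t := by
    refine Subtype.ext ?_
    ext i j
    fin_cases i <;> fin_cases j <;> simp [Real.cos_add, Real.sin_add] <;> ring

theorem planeRotation_eq_one {t : Multiplicative ℝ} (h : planeRotation t = 1) :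
    Real.cos t.toAdd = 1 :=
  congrFun (congrFun (congrArg Subtype.val h) 0) 0

theorem continuous_planeRotation : Continuous planeRotation := by
  refine Continuous.subtype_mk (continuous_matrix fun i j => ?_) _
  have h1 : Continuous fun t : Multiplicative ℝ => Real.cos t.toAdd :=
    Real.continuous_cos.comp continuous_toAdd
  have h2 : Continuous fun t : Multiplicative ℝ => Real.sin t.toAdd :=
    Real.continuous_sin.comp continuous_toAdd
  fin_cases i <;> fin_cases j
  exacts [h1, h2.neg, h2, h1]

theorem isQuotientMap_planeRotation : Topology.IsQuotientMap planeRotation := by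
  refine isQuotientMap_of_compact continuous_planeRotation
    (K := Multiplicative.ofAdd '' Set.Icc (-Real.pi) Real.pi)
    (isCompact_Icc.image continuous_ofAdd) fun A => ?_
  obtain ⟨h1, h2, h3⟩ := mem_specialOrthogonalGroup_fin_two_iff.1 A.2
  obtain ⟨t, ht, hc, hs⟩ := exists_angle (a := A.1 0 0) (b := A.1 1 0) (by
    rw [← h3, h2, neg_sq])
  refine ⟨_, ⟨t, ht, rfl⟩, Subtype.ext ?_⟩
  change !![Real.cos t, -Real.sin t; Real.sin t, Real.cos t] = A.1
  rw [hc, hs]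
  ext i j
  fin_cases i <;> fin_cases j
  exacts [rfl, h2.symm, rfl, h1]

theorem isDiscrete_ker_planeRotation :
    IsDiscrete (planeRotation.ker : Set (Multiplicative ℝ)) := by
  have hU : Multiplicative.toAdd ⁻¹' Set.Ioo (-(2 * Real.pi)) (2 * Real.pi)
      ∈ 𝓝 (1 : Multiplicative ℝ) :=
    continuous_toAdd.continuousAt (Ioo_mem_nhds (α := ℝ) (neg_lt_zero.2 Real.two_pi_pos)
      Real.two_pi_pos)
  refine isDiscrete_of_nhds_one _ hU fun t ht htU => ?_
  exact (Real.cos_eq_one_iff_of_lt_of_lt htU.1 htU.2).1 (planeRotation_eq_one ht)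

instance simplyConnectedSpace_multiplicative {V : Type*} [AddCommGroup V] [Module ℝ V]
    [TopologicalSpace V] [ContinuousAdd V] [ContinuousSMul ℝ V] :
    SimplyConnectedSpace (Multiplicative V) :=
  inferInstanceAs (SimplyConnectedSpace V)

theorem nonempty_fundamentalGroup_SO_two :
    Nonempty (FundamentalGroup (SO 2) 1 ≃* Multiplicative ℤ) := by
  obtain ⟨η⟩ := nonempty_fundamentalGroup_equiv_ker_hom isQuotientMap_planeRotation
    isDiscrete_ker_planeRotation
  let f : Multiplicative ℤ →* Multiplicative ℝ :=
    AddMonoidHom.toMultiplicative (((AddMonoidHom.mulRight (2 * Real.pi))).comp (Int.castAddHom ℝ))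
  have hf : ∀ k : Multiplicative ℤ, f k = Multiplicative.ofAdd ((k.toAdd : ℝ) * (2 * Real.pi)) :=
    fun _ => rfl
  have hker : ∀ k, f k ∈ planeRotation.ker := by
    intro k
    refine Subtype.ext ?_
    rw [hf]
    change !![Real.cos _, -Real.sin _; Real.sin _, Real.cos _] = _
    rw [toAdd_ofAdd, Real.cos_int_mul_two_pi]
    have hs : Real.sin ((k.toAdd : ℝ) * (2 * Real.pi)) = 0 := by
      have := Real.sin_int_mul_pi (2 * k.toAdd)
      push_cast at this
      rw [← this]; ring_nf
    rw [hs]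
    ext i j
    fin_cases i <;> fin_cases j <;> simp
  refine ⟨η.trans (MulEquiv.ofBijective (f.codRestrict _ hker) ⟨fun k l h => ?_, fun t => ?_⟩).symm⟩
  · have h1 : (k.toAdd : ℝ) * (2 * Real.pi) = (l.toAdd : ℝ) * (2 * Real.pi) :=
      congrArg Subtype.val h
    have h2 := mul_right_cancel₀ (by positivity) h1
    exact_mod_cast h2
  · obtain ⟨k, hk⟩ := (Real.cos_eq_one_iff _).1 (planeRotation_eq_one t.2)
    exact ⟨Multiplicative.ofAdd k, Subtype.ext hk⟩

open Quaternion

/-- The matrix of the conjugation with a unit quaternion, on the imaginary quaternions. -/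
def eulerRodrigues (q : ℍ[ℝ]) : Matrix (Fin 3) (Fin 3) ℝ :=
  !![q.re ^ 2 + q.imI ^ 2 - q.imJ ^ 2 - q.imK ^ 2, 2 * (q.imI * q.imJ - q.re * q.imK),
      2 * (q.imI * q.imK + q.re * q.imJ);
    2 * (q.imI * q.imJ + q.re * q.imK), q.re ^ 2 - q.imI ^ 2 + q.imJ ^ 2 - q.imK ^ 2,
      2 * (q.imJ * q.imK - q.re * q.imI);
    2 * (q.imI * q.imK - q.re * q.imJ), 2 * (q.imJ * q.imK + q.re * q.imI),
      q.re ^ 2 - q.imI ^ 2 - q.imJ ^ 2 + q.imK ^ 2]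

theorem eulerRodrigues_mul (p q : ℍ[ℝ]) :
    eulerRodrigues (p * q) = eulerRodrigues p * eulerRodrigues q := by
  ext i j
  fin_cases i <;> fin_cases j <;>
    simp [eulerRodrigues, Matrix.mul_apply, Fin.sum_univ_three] <;> ring

theorem sq_add_sq_of_mem_sphere (q : Metric.sphere (0 : ℍ[ℝ]) 1) :
    q.1.re ^ 2 + q.1.imI ^ 2 + q.1.imJ ^ 2 + q.1.imK ^ 2 = 1 := by
  have h : ‖q.1‖ = 1 := by simp
  rw [← normSq_def', normSq_eq_norm_mul_self, h, one_mul]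

theorem eulerRodrigues_mem (q : Metric.sphere (0 : ℍ[ℝ]) 1) :
    eulerRodrigues q ∈ specialOrthogonalGroup (Fin 3) ℝ := by
  have h := sq_add_sq_of_mem_sphere q
  -- The diagonal entries of the product with the transpose are `|q|⁴`, and the determinant is
  -- `|q|⁶`.
  have h2 : (q.1.re ^ 2 + q.1.imI ^ 2 + q.1.imJ ^ 2 + q.1.imK ^ 2) ^ 2 = 1 := by rw [h, one_pow]
  have h3 : (q.1.re ^ 2 + q.1.imI ^ 2 + q.1.imJ ^ 2 + q.1.imK ^ 2) ^ 3 = 1 := by rw [h, one_pow]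
  rw [mem_SO_iff]
  constructor
  · ext i j
    fin_cases i <;> fin_cases j <;>
      simp [eulerRodrigues, Matrix.mul_apply, Fin.sum_univ_three] <;>
      first
        | linear_combination h2
        | ring
  · rw [det_fin_three]
    simp [eulerRodrigues]
    linear_combination h3

/-- The double covering of `SO(3)` by the unit quaternions. -/
def quaternionRotation : Metric.sphere (0 : ℍ[ℝ]) 1 →* SO 3 where
  toFun q := ⟨eulerRodrigues q, eulerRodrigues_mem q⟩
  map_one' := by
    refine Subtype.ext ?_
    ext i j
    fin_cases i <;> fin_cases j <;> simp [eulerRodrigues]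
  map_mul' p q := Subtype.ext (eulerRodrigues_mul _ _)

theorem continuous_quaternionRotation : Continuous quaternionRotation := by
  refine Continuous.subtype_mk (Continuous.comp (g := eulerRodrigues) ?_ continuous_subtype_val) _
  have := Quaternion.continuous_re
  have := Quaternion.continuous_imI
  have := Quaternion.continuous_imJ
  have := Quaternion.continuous_imK
  refine continuous_matrix fun i j => ?_
  fin_cases i <;> fin_cases j <;> simp only [eulerRodrigues] <;> simp <;> fun_prop

theorem mem_sphere_of_normSq {q : ℍ[ℝ]} (h : normSq q = 1) : q ∈ Metric.sphere (0 : ℍ[ℝ]) 1 := by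
  rw [mem_sphere_zero_iff_norm, ← pow_left_inj₀ (norm_nonneg _) zero_le_one two_ne_zero, one_pow, sq,
    ← normSq_eq_norm_mul_self, h]

theorem mem_sphere_of_sq_add_sq {a b c d : ℝ} (h : a ^ 2 + b ^ 2 + c ^ 2 + d ^ 2 = 1) :
    (⟨a, b, c, d⟩ : ℍ[ℝ]) ∈ Metric.sphere (0 : ℍ[ℝ]) 1 :=
  mem_sphere_of_normSq ((normSq_def' _).trans h)

theorem exists_quaternion_orbit {x y z : ℝ} (h : x ^ 2 + y ^ 2 + z ^ 2 = 1) :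
    ∃ q : Metric.sphere (0 : ℍ[ℝ]) 1, eulerRodrigues q 0 2 = x ∧ eulerRodrigues q 1 2 = y ∧
      eulerRodrigues q 2 2 = z := by
  by_cases hz : z = -1
  · have hx : x = 0 := by nlinarith
    have hy : y = 0 := by nlinarith
    refine ⟨⟨⟨0, 1, 0, 0⟩, mem_sphere_of_sq_add_sq (by norm_num)⟩, ?_⟩
    simp [eulerRodrigues, hx, hy, hz]
  · have hz1 : 0 < 1 + z := by
      have h1 : -1 ≤ z := by nlinarith [sq_nonneg x, sq_nonneg y]
      rcases h1.lt_or_eq with h2 | h2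
      · linarith
      · exact absurd h2.symm hz
    obtain ⟨s, hs, hs2⟩ : ∃ s : ℝ, 0 < s ∧ s ^ 2 = 2 * (1 + z) :=
      ⟨Real.sqrt (2 * (1 + z)), by positivity, Real.sq_sqrt (by positivity)⟩
    have hs0 := hs.ne'
    -- The quaternion of the shortest rotation from the third basis vector to `(x, y, z)`, before
    -- normalization `1 + z - y i + x j`, of squared norm `2 (1 + z)`. It degenerates at `z = -1`,
    -- where the half turn `i` is used.
    refine ⟨⟨⟨(1 + z) / s, -y / s, x / s, 0⟩, mem_sphere_of_sq_add_sq ?_⟩, ?_, ?_, ?_⟩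
    · field_simp
      linear_combination h - hs2
    · simp [eulerRodrigues]
      field_simp
      linear_combination -x * hs2
    · simp [eulerRodrigues]
      field_simp
      linear_combination -y * hs2
    · simp [eulerRodrigues]
      field_simp
      linear_combination -z * hs2 - h

/-- Unit quaternions move the third basis vector anywhere on the sphere, so only its stabilizer
`SO(2)` has to be reached; the rotation by `t` comes from `cos (t/2) + sin (t/2) k`. -/
theorem quaternionRotation_surjective : Function.Surjective quaternionRotation := by
  intro A
  have hx := norm_orbitMap A
  rw [← pow_left_inj₀ (norm_nonneg _) zero_le_one two_ne_zero, one_pow,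
    EuclideanSpace.real_norm_sq_eq, Fin.sum_univ_three] at hx
  obtain ⟨q, h0, h1, h2⟩ := exists_quaternion_orbit hx
  have ho : orbitMap (quaternionRotation q : Matrix (Fin 3) (Fin 3) ℝ)
      = orbitMap (A : Matrix (Fin 3) (Fin 3) ℝ) := by
    ext i
    rw [orbitMap_apply]
    fin_cases i
    exacts [h0, h1, h2]
  have hB : orbitMap (((quaternionRotation q)⁻¹ * A : SO 3) : Matrix (Fin 3) (Fin 3) ℝ)
      = lastVec 2 := by
    apply WithLp.ofLp_injective
    rw [SO_coe_mul, orbitMap_mul, ← ho, orbitMap, mulVec_mulVec, ← SO_coe_mul, inv_mul_cancel,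
      SO_coe_one, one_mulVec]
  have hB' := inclSO_restrSO hB
  obtain ⟨k1, k2, k3⟩ := mem_specialOrthogonalGroup_fin_two_iff.1
    (restrSO ((quaternionRotation q)⁻¹ * A)).2
  set B := restrSO ((quaternionRotation q)⁻¹ * A)
  obtain ⟨t, -, hc, hs⟩ := exists_angle (a := B.1 0 0) (b := B.1 1 0) (by
    rw [← k3, k2, neg_sq])
  let r : Metric.sphere (0 : ℍ[ℝ]) 1 := ⟨⟨Real.cos (t / 2), 0, 0, Real.sin (t / 2)⟩,
    mem_sphere_of_sq_add_sq (by simp)⟩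
  have hr : quaternionRotation r = inclSO 2 B := by
    refine Subtype.ext ?_
    have ht : t = 2 * (t / 2) := by ring
    have hc' : Real.cos (t / 2) ^ 2 - Real.sin (t / 2) ^ 2 = B.1 0 0 := by
      rw [← hc, ← Real.cos_two_mul', ← ht]
    have hs' : 2 * (Real.cos (t / 2) * Real.sin (t / 2)) = B.1 1 0 := by
      rw [← hs]; conv_rhs => rw [ht, Real.sin_two_mul]
      ring
    change eulerRodrigues r = inclMatrix B.1
    ext i j
    refine Fin.lastCases ?_ (fun i => ?_) i
    · rw [inclMatrix_last_left]
      fin_cases j <;> simp [eulerRodrigues, r, Fin.last]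
    · refine Fin.lastCases ?_ (fun j => ?_) j
      · rw [inclMatrix_last_right]
        fin_cases i <;> simp [eulerRodrigues, r, Fin.last]
      · rw [inclMatrix_castSucc]
        fin_cases i <;> fin_cases j <;> simp [eulerRodrigues, r]
        · exact hc'
        · rw [k2, ← hs']
        · exact hs'
        · rw [← k1]; exact hc'
  refine ⟨q * r, ?_⟩
  rw [map_mul, hr, hB', mul_inv_cancel_left]

theorem quaternionRotation_ker (q : Metric.sphere (0 : ℍ[ℝ]) 1) (h : quaternionRotation q = 1) :
    q = 1 ∨ q = -1 := by
  have hq := sq_add_sq_of_mem_sphere q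
  have h0 : eulerRodrigues q 0 0 = 1 := congrFun (congrFun (congrArg Subtype.val h) 0) 0
  have h1 : eulerRodrigues q 1 1 = 1 := congrFun (congrFun (congrArg Subtype.val h) 1) 1
  simp only [eulerRodrigues, of_apply, cons_val', cons_val_zero, cons_val_one] at h0 h1
  have hI : q.1.imI = 0 := by nlinarith
  have hJ : q.1.imJ = 0 := by nlinarith
  have hK : q.1.imK = 0 := by nlinarith
  have hr : (q.1.re - 1) * (q.1.re + 1) = 0 := by
    rw [hI, hJ, hK] at hq
    linear_combination hq
  rcases mul_eq_zero.1 hr with hr | hr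
  · left
    refine Subtype.ext (Quaternion.ext _ _ ?_ ?_ ?_ ?_)
    · simpa using sub_eq_zero.1 hr
    · simpa using hI
    · simpa using hJ
    · simpa using hK
  · right
    refine Subtype.ext (Quaternion.ext _ _ ?_ ?_ ?_ ?_)
    · simpa using eq_neg_of_add_eq_zero_left hr
    · simpa using hI
    · simpa using hJ
    · simpa using hK

theorem nonempty_fundamentalGroup_SO_three :
    Nonempty (FundamentalGroup (SO 3) 1 ≃* Multiplicative (ZMod 2)) := by
  have := simplyConnectedSpace_sphere (V := ℍ[ℝ]) (by rw [Quaternion.finrank_eq_four]; norm_num)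
  have hker : (quaternionRotation.ker : Set (Metric.sphere (0 : ℍ[ℝ]) 1)) = {1, -1} := by
    ext q
    refine ⟨fun h => quaternionRotation_ker q h, ?_⟩
    rintro (rfl | rfl)
    · exact map_one _
    · refine Subtype.ext ?_
      change eulerRodrigues (-1) = 1
      ext i j
      fin_cases i <;> fin_cases j <;> simp [eulerRodrigues]
  obtain ⟨η⟩ := nonempty_fundamentalGroup_equiv_ker_hom
    (isQuotientMap_of_compact continuous_quaternionRotation isCompact_univ fun A => by
      obtain ⟨q, hq⟩ := quaternionRotation_surjective A
      exact ⟨q, trivial, hq⟩) (by rw [hker]; exact (Set.toFinite _).isDiscrete)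
  have hcard : Nat.card quaternionRotation.ker = 2 := by
    rw [← SetLike.coe_sort_coe, Nat.card_coe_set_eq, hker, Set.ncard_pair]
    intro h
    have h1 : (1 : ℝ) = -1 := by
      simpa using congrArg (fun q : Metric.sphere (0 : ℍ[ℝ]) 1 => q.1.re) h
    norm_num at h1
  exact ⟨η.trans (mulEquivOfPrimeCardEq (p := 2) hcard (by simp))⟩

end LowDimensions

theorem nonempty_fundamentalGroup_SO {d : ℕ} (hd : 3 ≤ d) :
    Nonempty (FundamentalGroup (SO d) 1 ≃* Multiplicative (ZMod 2)) := by
  induction d, hd using Nat.le_induction with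
  | base => exact nonempty_fundamentalGroup_SO_three
  | succ n hn ih =>
    obtain ⟨f⟩ := ih
    obtain ⟨g⟩ := nonempty_fundamentalGroup_SO_succ hn
    exact ⟨g.symm.trans f⟩

theorem nonempty_ker_proj_two :
    Nonempty ((UniversalCover.proj : Sp 2 →* SO 2).ker ≃* Multiplicative ℤ) := by
  obtain ⟨f⟩ := UniversalCover.nonempty_fundamentalGroup_equiv_ker (hasContraction_SO 2)
  obtain ⟨g⟩ := nonempty_fundamentalGroup_SO_two
  exact ⟨f.symm.trans g⟩

theorem nonempty_ker_proj {d : ℕ} (hd : 3 ≤ d) :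
    Nonempty ((UniversalCover.proj : Sp d →* SO d).ker ≃* Multiplicative (ZMod 2)) := by
  obtain ⟨f⟩ := UniversalCover.nonempty_fundamentalGroup_equiv_ker (hasContraction_SO d)
  obtain ⟨g⟩ := nonempty_fundamentalGroup_SO hd
  exact ⟨f.symm.trans g⟩

/-! ### Rigid motions -/

section RigidMotions

variable {d : ℕ} {L : Type*}

/-- The translation by `v`. -/
noncomputable abbrev translate (v : Euc d) : RigidMotion d := translationMotion (.ofAdd v)

theorem translate_apply (v x : Euc d) : ((translate v : RigidMotion d) : Euc d ≃ᵃⁱ[ℝ] Euc d) x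
    = v + x := rfl

theorem translate_zero : translate (0 : Euc d) = 1 := map_one translationMotion

theorem translate_add (v w : Euc d) : translate (v + w) = translate v * translate w :=
  map_mul translationMotion (.ofAdd v) (.ofAdd w)

theorem translate_neg (v : Euc d) : translate (-v) = (translate v)⁻¹ :=
  map_inv translationMotion (.ofAdd v)

theorem mul_apply_motion (Φ Ψ : RigidMotion d) (x : Euc d) :
    ((Φ * Ψ : RigidMotion d) : Euc d ≃ᵃⁱ[ℝ] Euc d) x
      = (Φ : Euc d ≃ᵃⁱ[ℝ] Euc d) ((Ψ : Euc d ≃ᵃⁱ[ℝ] Euc d) x) := rfl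

theorem rigidMotion_ext {Φ Ψ : RigidMotion d}
    (h : ∀ x, (Φ : Euc d ≃ᵃⁱ[ℝ] Euc d) x = (Ψ : Euc d ≃ᵃⁱ[ℝ] Euc d) x) : Φ = Ψ :=
  Subtype.ext (AffineIsometryEquiv.ext h)

theorem rotationPart_rotationMotion (A : SO d) : rotationPart (rotationMotion A) = A :=
  Subtype.ext ((Matrix.toEuclideanCLM (n := Fin d) (𝕜 := ℝ)).symm_apply_apply _)

theorem rotationPart_translate (v : Euc d) : rotationPart (translate v) = 1 :=
  Subtype.ext (map_one (Matrix.toEuclideanCLM (n := Fin d) (𝕜 := ℝ)).symm)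

theorem rotationMotion_rotationPart_apply (Φ : RigidMotion d) (x : Euc d) :
    ((rotationMotion (rotationPart Φ) : RigidMotion d) : Euc d ≃ᵃⁱ[ℝ] Euc d) x
      = (Φ : Euc d ≃ᵃⁱ[ℝ] Euc d).linearIsometryEquiv x := by
  change Matrix.toEuclideanCLM (n := Fin d) (𝕜 := ℝ)
    ((Matrix.toEuclideanCLM (n := Fin d) (𝕜 := ℝ)).symm _) x = _
  rw [StarAlgEquiv.apply_symm_apply]
  rfl

theorem eq_translate_mul_rotation (Φ : RigidMotion d) :
    Φ = translate ((Φ : Euc d ≃ᵃⁱ[ℝ] Euc d) 0) * rotationMotion (rotationPart Φ) := by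
  refine rigidMotion_ext fun x => ?_
  rw [mul_apply_motion, translate_apply, rotationMotion_rotationPart_apply]
  have h := (Φ : Euc d ≃ᵃⁱ[ℝ] Euc d).map_vadd 0 x
  rw [vadd_eq_add, vadd_eq_add, add_zero] at h
  rw [h, add_comm]

theorem eq_translate_of_rotationPart {Φ : RigidMotion d} (h : rotationPart Φ = 1) :
    Φ = translate ((Φ : Euc d ≃ᵃⁱ[ℝ] Euc d) 0) := by
  have h1 := eq_translate_mul_rotation Φ
  rwa [h, map_one, mul_one] at h1

theorem smul_support (Φ : RigidMotion d) (t : Tile d L) :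
    (Φ • t).support = (Φ : Euc d ≃ᵃⁱ[ℝ] Euc d) '' t.support := rfl

theorem patch_subset (T : Set (Tile d L)) (x : Euc d) (r : ℝ) : patch T x r ⊆ T := fun _ h => h.1

theorem patch_smul (Φ : RigidMotion d) (T : Set (Tile d L)) (x : Euc d) (r : ℝ) :
    patch (Φ • T) ((Φ : Euc d ≃ᵃⁱ[ℝ] Euc d) x) r = Φ • patch T x r := by
  have key : ∀ t : Tile d L,
      ((Φ • t).support ∩ Metric.closedBall ((Φ : Euc d ≃ᵃⁱ[ℝ] Euc d) x) r).Nonempty ↔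
        (t.support ∩ Metric.closedBall x r).Nonempty := by
    intro t
    rw [smul_support]
    constructor
    · rintro ⟨_, ⟨y, hy, rfl⟩, hyr⟩
      refine ⟨y, hy, ?_⟩
      rwa [Metric.mem_closedBall, (Φ : Euc d ≃ᵃⁱ[ℝ] Euc d).dist_map] at hyr
    · rintro ⟨y, hy, hyr⟩
      refine ⟨_, ⟨y, hy, rfl⟩, ?_⟩
      rwa [Metric.mem_closedBall, (Φ : Euc d ≃ᵃⁱ[ℝ] Euc d).dist_map]
  ext t
  constructor
  · rintro ⟨⟨s, hs, rfl⟩, h⟩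
    exact ⟨s, ⟨hs, (key s).1 h⟩, rfl⟩
  · rintro ⟨s, ⟨hs, h⟩, rfl⟩
    exact ⟨⟨s, hs, rfl⟩, (key s).2 h⟩

theorem patch_smul' (Φ : RigidMotion d) (T : Set (Tile d L)) (x : Euc d) (r : ℝ) :
    patch (Φ • T) x r = Φ • patch T (((Φ⁻¹ : RigidMotion d) : Euc d ≃ᵃⁱ[ℝ] Euc d) x) r := by
  rw [← patch_smul, ← mul_apply_motion, mul_inv_cancel]
  rfl

end RigidMotions

/-! ### Tilings -/

section Tilings

variable {d : ℕ} {L : Type*}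

/-- A compact set with non-empty interior. -/
def IsSolid (K : Set (Euc d)) : Prop := IsCompact K ∧ (interior K).Nonempty

theorem IsPolyhedral.isSolid {K : Set (Euc d)} (h : IsPolyhedral K) : IsSolid K := by
  obtain ⟨V, hV, ⟨s, hs⟩, hVs, rfl⟩ := h
  refine ⟨hV.isCompact_biUnion fun s hs => (hVs s hs).1.isCompact_convexHull ℝ, ?_⟩
  exact (hVs s hs).2.mono (interior_mono (Set.subset_biUnion_of_mem hs))

theorem image_interior_motion (Φ : RigidMotion d) (K : Set (Euc d)) :
    (Φ : Euc d ≃ᵃⁱ[ℝ] Euc d) '' interior K = interior ((Φ : Euc d ≃ᵃⁱ[ℝ] Euc d) '' K) :=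
  (Φ : Euc d ≃ᵃⁱ[ℝ] Euc d).toHomeomorph.image_interior K

theorem image_frontier_motion (Φ : RigidMotion d) (K : Set (Euc d)) :
    (Φ : Euc d ≃ᵃⁱ[ℝ] Euc d) '' frontier K = frontier ((Φ : Euc d ≃ᵃⁱ[ℝ] Euc d) '' K) :=
  (Φ : Euc d ≃ᵃⁱ[ℝ] Euc d).toHomeomorph.image_frontier K

theorem IsSolid.image {K : Set (Euc d)} (h : IsSolid K) (Φ : RigidMotion d) :
    IsSolid ((Φ : Euc d ≃ᵃⁱ[ℝ] Euc d) '' K) :=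
  ⟨h.1.image (Φ : Euc d ≃ᵃⁱ[ℝ] Euc d).continuous, by
    rw [← image_interior_motion]; exact h.2.image _⟩

theorem IsPolyhedral.image {K : Set (Euc d)} (h : IsPolyhedral K) (Φ : RigidMotion d) :
    IsPolyhedral ((Φ : Euc d ≃ᵃⁱ[ℝ] Euc d) '' K) := by
  obtain ⟨V, hV, hne, hVs, rfl⟩ := h
  have hc : ∀ s : Set (Euc d), (Φ : Euc d ≃ᵃⁱ[ℝ] Euc d) '' convexHull ℝ s
      = convexHull ℝ ((Φ : Euc d ≃ᵃⁱ[ℝ] Euc d) '' s) := fun s =>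
    (Φ : Euc d ≃ᵃⁱ[ℝ] Euc d).toAffineEquiv.toAffineMap.image_convexHull s
  refine ⟨(fun s => (Φ : Euc d ≃ᵃⁱ[ℝ] Euc d) '' s) '' V, hV.image _, hne.image _, ?_, ?_⟩
  · rintro _ ⟨s, hs, rfl⟩
    refine ⟨(hVs s hs).1.image _, ?_⟩
    rw [← hc, ← image_interior_motion]
    exact (hVs s hs).2.image _
  · rw [Set.biUnion_image, Set.image_iUnion₂]
    simp only [hc]

theorem cover_smul {T : Set (Tile d L)} (h : ⋃ t ∈ T, t.support = Set.univ) (Φ : RigidMotion d) :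
    ⋃ t ∈ Φ • T, t.support = Set.univ := by
  refine Set.eq_univ_of_forall fun x => ?_
  have hx : ((Φ⁻¹ : RigidMotion d) : Euc d ≃ᵃⁱ[ℝ] Euc d) x ∈ ⋃ t ∈ T, t.support := h ▸ trivial
  simp only [Set.mem_iUnion] at hx ⊢
  obtain ⟨t, ht, hxt⟩ := hx
  refine ⟨Φ • t, ⟨t, ht, rfl⟩, _, hxt, ?_⟩
  rw [← mul_apply_motion, mul_inv_cancel]
  rfl

theorem IsTiling.smul_translate {T : Set (Tile d L)} (hT : IsTiling T) (v : Euc d) :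
    IsTiling (translate v • T) where
  polyhedral := by
    rintro _ ⟨t, ht, rfl⟩
    exact (hT.polyhedral t ht).image _
  cover := cover_smul hT.cover _
  boundary := by
    rintro _ ⟨s, hs, rfl⟩ _ ⟨t, ht, rfl⟩ hst
    have h := hT.boundary s hs t ht fun h => hst (congrArg _ h)
    change (_ '' s.support) ∩ (_ '' t.support) ⊆ frontier (_ '' s.support) ∩ frontier (_ '' t.support)
    rw [← image_frontier_motion, ← image_frontier_motion, ← Set.image_inter, ← Set.image_inter]
    · exact Set.image_mono h
    all_goals exact AffineIsometryEquiv.injective _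
  prototiles := by
    obtain ⟨F, hF, h⟩ := hT.prototiles
    refine ⟨F, hF, ?_⟩
    rintro _ ⟨t, ht, rfl⟩
    obtain ⟨p, hp, w, rfl⟩ := h t ht
    refine ⟨p, hp, v + w, ?_⟩
    exact ((congrArg (· • p) (translate_add v w)).trans (mul_smul _ _ _)).symm

/-- A set of tiles of a tiling that covers the space is the whole tiling. -/
theorem IsTiling.eq_of_subset {T T' : Set (Tile d L)} (hT : IsTiling T) (h : T' ⊆ T)
    (hc : ⋃ t ∈ T', t.support = Set.univ) : T' = T := by
  refine h.antisymm fun t ht => ?_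
  obtain ⟨x, hx⟩ := (hT.polyhedral t ht).isSolid.2
  have hx' : x ∈ ⋃ t ∈ T', t.support := hc ▸ trivial
  simp only [Set.mem_iUnion] at hx'
  obtain ⟨s, hs, hxs⟩ := hx'
  by_cases hst : s = t
  · rwa [← hst]
  · have := (hT.boundary s (h hs) t ht hst ⟨hxs, interior_subset hx⟩).2
    exact absurd hx this.2

theorem IsTiling.nonempty {T : Set (Tile d L)} (hT : IsTiling T) : T.Nonempty := by
  have hx : (0 : Euc d) ∈ ⋃ t ∈ T, t.support := hT.cover ▸ trivial
  simp only [Set.mem_iUnion] at hx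
  obtain ⟨t, ht, -⟩ := hx
  exact ⟨t, ht⟩

/-- A compact non-empty set has no translational symmetries. -/
theorem eq_zero_of_translate {K : Set (Euc d)} (hK : IsCompact K) (hne : K.Nonempty) {v : Euc d}
    (h : ((translate v : RigidMotion d) : Euc d ≃ᵃⁱ[ℝ] Euc d) '' K = K) : v = 0 := by
  obtain ⟨x, hx⟩ := hne
  -- Iterating a non-zero translation would leave every bounded set.
  have h1 : ∀ n : ℕ, (n : ℝ) • v + x ∈ K := by
    intro n
    induction n with
    | zero => simpa using hx
    | succ n ih =>
      rw [← h]
      refine ⟨_, ih, ?_⟩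
      rw [translate_apply, Nat.cast_succ, add_smul, one_smul]
      abel
  obtain ⟨C, hC⟩ := hK.isBounded.exists_norm_le
  by_contra hv
  have hv' : 0 < ‖v‖ := norm_pos_iff.2 hv
  obtain ⟨n, hn⟩ := exists_nat_gt ((C + ‖x‖) / ‖v‖)
  rw [div_lt_iff₀ hv'] at hn
  have h2 := norm_sub_norm_le ((n : ℝ) • v) (-x)
  rw [sub_neg_eq_add, norm_neg, norm_smul, Real.norm_natCast] at h2
  linarith [hC _ (h1 n)]

/-- The translates of a tile in a tiling are uniformly separated. -/
theorem IsTiling.exists_separation {T : Set (Tile d L)} (hT : IsTiling T) {t : Tile d L}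
    (ht : IsSolid t.support) : ∃ ρ > 0, ∀ v w : Euc d, translate v • t ∈ T → translate w • t ∈ T →
      dist v w < ρ → v = w := by
  obtain ⟨x, hx⟩ := ht.2
  obtain ⟨ρ, hρ, hball⟩ := Metric.isOpen_iff.1 isOpen_interior x hx
  refine ⟨ρ, hρ, fun v w hv hw hvw => ?_⟩
  -- `ρ` is the radius of a ball inside the tile. Distinct tiles translated by vectors closer than
  -- `ρ` would share an interior point.
  have heq : translate v • t = translate w • t := by
    by_contra hne
    have h1 : v + x ∈ interior (translate v • t).support := by
      rw [smul_support, ← image_interior_motion]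
      exact ⟨x, hx, rfl⟩
    have h2 : v + x ∈ interior (translate w • t).support := by
      rw [smul_support, ← image_interior_motion]
      refine ⟨v - w + x, hball ?_, ?_⟩
      · rwa [Metric.mem_ball, dist_eq_norm, add_sub_cancel_right, ← dist_eq_norm]
      · rw [translate_apply]; abel
    have := (hT.boundary _ hv _ hw hne ⟨interior_subset h1, interior_subset h2⟩).1
    exact this.2 h1
  have h3 : translate (v - w) • t = t := by
    rw [sub_eq_neg_add, translate_add, mul_smul, heq, translate_neg, inv_smul_smul]
  exact sub_eq_zero.1 (eq_zero_of_translate ht.1 (ht.2.mono interior_subset)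
    (congrArg Tile.support h3))

/-! ### The lattice of a periodic tiling -/

/-- The translational symmetries, as a submodule of Euclidean space over the integers. -/
noncomputable def latticeOf (T : Set (Tile d L)) : Submodule ℤ (Euc d) :=
  AddSubgroup.toIntSubmodule (Subgroup.toAddSubgroup' (translationGroup T))

theorem mem_latticeOf {T : Set (Tile d L)} {v : Euc d} : v ∈ latticeOf T ↔ translate v • T = T :=
  Iff.rfl

theorem IsTiling.exists_separation_lattice {T : Set (Tile d L)} (hT : IsTiling T) :
    ∃ ρ > 0, ∀ v ∈ latticeOf T, ‖v‖ < ρ → v = 0 := by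
  obtain ⟨t, ht⟩ := hT.nonempty
  obtain ⟨ρ, hρ, h⟩ := hT.exists_separation (hT.polyhedral t ht).isSolid
  refine ⟨ρ, hρ, fun v hv hvρ => h v 0 ?_ ?_ (by rwa [dist_zero_right])⟩
  · rw [← mem_latticeOf.1 hv]
    exact ⟨t, ht, rfl⟩
  · rwa [translate_zero, one_smul]

theorem IsTiling.discreteTopology_lattice {T : Set (Tile d L)} (hT : IsTiling T) :
    DiscreteTopology (latticeOf T) := by
  obtain ⟨ρ, hρ, h⟩ := hT.exists_separation_lattice
  refine discreteTopology_of_isOpen_singleton_zero (Metric.isOpen_singleton_iff.2 ⟨ρ, hρ, ?_⟩)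
  intro v hv
  exact Subtype.ext (h v v.2 (by rwa [dist_zero_right] at hv))

theorem IsPeriodic.isZLattice {T : Set (Tile d L)} (hT : IsTiling T) (hper : IsPeriodic T) :
    haveI := hT.discreteTopology_lattice; IsZLattice ℝ (latticeOf T) := by
  have := hT.discreteTopology_lattice
  exact ⟨hper⟩

theorem IsPeriodic.nonempty_equiv {T : Set (Tile d L)} (hT : IsTiling T) (hper : IsPeriodic T) :
    Nonempty (translationGroup T ≃* Multiplicative (Fin d → ℤ)) := by
  have := hT.discreteTopology_lattice
  have := IsPeriodic.isZLattice hT hper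
  have := ZLattice.module_finite ℝ (latticeOf T)
  have := ZLattice.module_free ℝ (latticeOf T)
  have hr := ZLattice.rank ℝ (latticeOf T)
  rw [finrank_euclideanSpace_fin] at hr
  let b := Module.finBasisOfFinrankEq ℤ (latticeOf T) hr
  let e : translationGroup T ≃* Multiplicative (latticeOf T) :=
    { toFun := fun v => Multiplicative.ofAdd ⟨v.1.toAdd, v.2⟩
      invFun := fun v => ⟨Multiplicative.ofAdd (v.toAdd : Euc d), v.toAdd.2⟩
      left_inv := fun _ => rfl
      right_inv := fun _ => rfl
      map_mul' := fun _ _ => rfl }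
  exact ⟨e.trans b.equivFun.toAddEquiv.toMultiplicative⟩

/-- The lattice of a periodic tiling is relatively dense. -/
theorem IsPeriodic.exists_covering_radius {T : Set (Tile d L)} (hT : IsTiling T)
    (hper : IsPeriodic T) : ∃ R : ℝ, 0 < R ∧ ∀ x : Euc d, ∃ v ∈ latticeOf T, ‖x + v‖ ≤ R := by
  have := hT.discreteTopology_lattice
  have := IsPeriodic.isZLattice hT hper
  have := ZLattice.module_finite ℝ (latticeOf T)
  have := ZLattice.module_free ℝ (latticeOf T)
  let b₀ := Module.Free.chooseBasis ℤ (latticeOf T)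
  let b := b₀.ofZLatticeBasis ℝ (latticeOf T)
  have hb : Submodule.span ℤ (Set.range b) = latticeOf T := b₀.ofZLatticeBasis_span ℝ (latticeOf T)
  -- Subtracting the lattice floor leaves the fractional part, which lies in a fundamental cell. The
  -- summand `1` keeps the radius positive even for an empty basis.
  refine ⟨∑ i, ‖b i‖ + 1, by positivity, fun x => ⟨-(ZSpan.floor b x : Euc d), ?_, ?_⟩⟩
  · exact neg_mem (hb.le (ZSpan.floor b x).2)
  · rw [← sub_eq_add_neg]
    exact (ZSpan.norm_fract_le b x).trans (le_add_of_nonneg_right zero_le_one)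

/-- A cover by solid tiles all of whose patches occur in a periodic tiling is a translate
of this tiling. -/
theorem IsPeriodic.exists_translate {T T' : Set (Tile d L)} (hT : IsTiling T)
    (hper : IsPeriodic T) (hs : ∀ t ∈ T', IsSolid t.support)
    (hc : ⋃ t ∈ T', t.support = Set.univ) (hLI : LocallyIndistinguishable T' T) :
    ∃ v : Euc d, T' = translate v • T := by
  obtain ⟨R, -, hR⟩ := IsPeriodic.exists_covering_radius hT hper
  -- The vectors that move a fixed tile into `T` are uniformly separated, so they form a closed set.
  have hclosed : ∀ t : T', IsClosed {v : Euc d | translate v • (t : Tile d L) ∈ T} := by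
    intro t
    obtain ⟨ρ, hρ, h⟩ := hT.exists_separation (hs t t.2)
    refine Metric.isClosed_of_pairwise_le_dist hρ fun v hv w hw hvw => ?_
    by_contra hlt
    exact hvw (h v w hv hw (not_le.1 hlt))
  -- Finite intersection property: a finite patch of `T'` is moved into `T` by some `v`, and a
  -- symmetry of `T` brings `v` into the ball of the covering radius.
  have hne : (Metric.closedBall (0 : Euc d) R ∩
      ⋂ t : T', {v : Euc d | translate v • (t : Tile d L) ∈ T}).Nonempty := by
    refine (isCompact_closedBall _ _).inter_iInter_nonempty _ hclosed fun u => ?_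
    obtain ⟨v, hv⟩ := hLI ((↑) '' (u : Set T')) (by rintro _ ⟨t, -, rfl⟩; exact t.2)
      (u.finite_toSet.image _)
    obtain ⟨w, hw, hwR⟩ := hR v
    refine ⟨v + w, by rwa [mem_closedBall_zero_iff], ?_⟩
    simp only [Set.mem_iInter, Set.mem_ofPred_eq]
    intro t ht
    rw [add_comm, translate_add, mul_smul, ← mem_latticeOf.1 hw]
    exact Set.smul_mem_smul_set (hv (Set.smul_mem_smul_set ⟨t, ht, rfl⟩))
  obtain ⟨v, -, hv⟩ := hne
  simp only [Set.mem_iInter, Set.mem_ofPred_eq] at hv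
  refine ⟨-v, ?_⟩
  have hsub : translate v • T' ⊆ T := by
    rintro _ ⟨t, ht, rfl⟩
    exact hv ⟨t, ht⟩
  rw [← hT.eq_of_subset hsub (cover_smul hc _), translate_neg, inv_smul_smul]

/-- The translational hull of a periodic tiling consists of its translates. -/
theorem IsPeriodic.mem_translationalHull_iff {T T' : Set (Tile d L)} (hT : IsTiling T)
    (hper : IsPeriodic T) : T' ∈ translationalHull T ↔ ∃ v : Euc d, T' = translate v • T := by
  constructor
  · rintro ⟨h1, h2⟩
    exact IsPeriodic.exists_translate hT hper (fun t ht => (h1.polyhedral t ht).isSolid) h1.cover h2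
  · rintro ⟨v, rfl⟩
    refine ⟨hT.smul_translate v, fun P hP _ => ⟨-v, ?_⟩⟩
    change translate (-v) • P ⊆ T
    rw [translate_neg, ← Set.subset_smul_set_iff]
    exact hP

/-! ### The standard extension -/

variable {T : Set (Tile d L)} {G : Subgroup (SO d)}

theorem mem_positiveSpaceGroup {Φ : RigidMotion d} : Φ ∈ positiveSpaceGroup T ↔ Φ • T = T := Iff.rfl

/-- A symmetry takes the patch about `0` into `T`; up to the translation by the image of `0`, so
does its rotational part, and the defining property of the radius applies. -/
theorem HasPointGroup.rotationPart_mem (hG : HasPointGroup T G) {Φ : RigidMotion d}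
    (h : Φ ∈ positiveSpaceGroup T) : rotationPart Φ ∈ G := by
  obtain ⟨-, r, -, hr⟩ := hG
  refine hr 0 _ ⟨(Φ : Euc d ≃ᵃⁱ[ℝ] Euc d) 0, ?_⟩
  change translate ((Φ : Euc d ≃ᵃⁱ[ℝ] Euc d) 0) • rotationMotion (rotationPart Φ) • patch T 0 r ⊆ T
  rw [← mul_smul, ← eq_translate_mul_rotation Φ]
  conv_rhs => rw [← mem_positiveSpaceGroup.1 h]
  exact Set.smul_set_mono (patch_subset _ _ _)

/-- As `G` acts on patches, the patches of `g T` occur in `T`, so `g T` is a translate of `T`;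
undoing the translation gives the symmetry. -/
theorem HasPointGroup.exists_symmetry (hT : IsTiling T) (hper : IsPeriodic T)
    (hG : HasPointGroup T G) {g : SO d} (hg : g ∈ G) :
    ∃ Φ ∈ positiveSpaceGroup T, rotationPart Φ = g := by
  have h : LocallyIndistinguishable (rotationMotion g • T) T := by
    intro P hP hPf
    have := hG.1.2 ((rotationMotion g)⁻¹ • P) (by
      rw [← Set.subset_smul_set_iff]; exact hP) hPf.smul_set g hg
    rwa [smul_inv_smul] at this
  obtain ⟨v, hv⟩ := IsPeriodic.exists_translate hT hper (by
    rintro _ ⟨t, ht, rfl⟩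
    exact (hT.polyhedral t ht).isSolid.image _) (cover_smul hT.cover _) h
  refine ⟨(translate v)⁻¹ * rotationMotion g, ?_, ?_⟩
  · rw [mem_positiveSpaceGroup, mul_smul, hv, inv_smul_smul]
  · rw [map_mul, map_inv, rotationPart_translate, inv_one, one_mul, rotationPart_rotationMotion]

/-- The standard extension of the positive space group of a periodic tiling. -/
noncomputable def standardExtension (hT : IsTiling T) (hper : IsPeriodic T) (hG : HasPointGroup T G) :
    GroupExtension (translationGroup T) (positiveSpaceGroup T) G where
  inl := translationInclusion T
  rightHom := (rotationPart.comp (positiveSpaceGroup T).subtype).codRestrict G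
    fun Φ => hG.rotationPart_mem Φ.2
  inl_injective := by
    intro v w h
    have h1 : translationMotion (v : Multiplicative (Euc d))
        = translationMotion (w : Multiplicative (Euc d)) := congrArg Subtype.val h
    refine Subtype.ext ?_
    have h2 := congrArg (fun Φ : RigidMotion d => (Φ : Euc d ≃ᵃⁱ[ℝ] Euc d) 0) h1
    change v.1.toAdd + (0 : Euc d) = w.1.toAdd + (0 : Euc d) at h2
    rwa [add_zero, add_zero] at h2
  range_inl_eq_ker_rightHom := by
    ext Φ
    constructor
    · rintro ⟨v, rfl⟩
      exact Subtype.ext (rotationPart_translate _)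
    · intro h
      have h1 : rotationPart (Φ : RigidMotion d) = 1 := congrArg Subtype.val h
      have h2 := eq_translate_of_rotationPart h1
      refine ⟨⟨.ofAdd (((Φ : RigidMotion d) : Euc d ≃ᵃⁱ[ℝ] Euc d) 0), ?_⟩, Subtype.ext h2.symm⟩
      change translate _ ∈ positiveSpaceGroup T
      rw [← h2]
      exact Φ.2
  rightHom_surjective := by
    rintro ⟨g, hg⟩
    obtain ⟨Φ, hΦ, rfl⟩ := hG.exists_symmetry hT hper hg
    exact ⟨⟨Φ, hΦ⟩, rfl⟩

end Tilings

/-! ### Rigidity of periodic tilings with point group -/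

section Rigidity

variable {d : ℕ} {L : Type*} {T : Set (Tile d L)} {G : Subgroup (SO d)}

theorem patch_mono (T : Set (Tile d L)) (x : Euc d) {r s : ℝ} (h : r ≤ s) :
    patch T x r ⊆ patch T x s := fun _ ht =>
  ⟨ht.1, ht.2.mono (Set.inter_subset_inter_right _ (Metric.closedBall_subset_closedBall h))⟩

theorem patch_eq_of_closedBall_subset {T₁ T₂ : Set (Tile d L)} {x y : Euc d} {r s : ℝ}
    (hb : Metric.closedBall y s ⊆ Metric.closedBall x r) (h : patch T₁ x r = patch T₂ x r) :
    patch T₁ y s = patch T₂ y s := by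
  have key : ∀ T : Set (Tile d L),
      patch T y s = {t ∈ patch T x r | (t.support ∩ Metric.closedBall y s).Nonempty} := by
    intro T
    ext t
    exact ⟨fun ht => ⟨⟨ht.1, ht.2.mono (Set.inter_subset_inter_right _ hb)⟩, ht.2⟩,
      fun ht => ⟨ht.1.1, ht.2⟩⟩
  rw [key T₁, key T₂, h]

/-- A ball of the covering radius meets a lattice translate of every tile. Translations commute, so
`w` carries every tile of `T` into `T` as soon as it does so for the patch. -/
theorem IsPeriodic.translate_smul_eq (hT : IsTiling T) {R : ℝ}
    (hR : ∀ x : Euc d, ∃ v ∈ latticeOf T, ‖x + v‖ ≤ R) {w y : Euc d}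
    (h : translate w • patch T y R ⊆ T) : translate w • T = T := by
  refine hT.eq_of_subset ?_ (cover_smul hT.cover _)
  rintro _ ⟨t, ht, rfl⟩
  obtain ⟨z, hz⟩ := (hT.polyhedral t ht).isSolid.2.mono interior_subset
  obtain ⟨v, hv, hvR⟩ := hR (z - y)
  have h1 : translate v • t ∈ patch T y R := by
    refine ⟨?_, v + z, ⟨z, hz, rfl⟩, ?_⟩
    · rw [← mem_latticeOf.1 hv]
      exact Set.smul_mem_smul_set ht
    · rw [mem_closedBall_iff_norm, add_comm, add_sub_right_comm]
      exact hvR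
  have h2 : translate v • translate w • t ∈ T := by
    have h3 := h (Set.smul_mem_smul_set h1)
    rwa [← mul_smul, ← translate_add, add_comm, translate_add, mul_smul] at h3
  rw [← mem_latticeOf.1 hv] at h2
  exact Set.smul_mem_smul_set_iff.1 h2

/-- Rigid motions of a periodic tiling that agree on a large ball agree. -/
theorem HasPointGroup.exists_rigidity (hT : IsTiling T) (hper : IsPeriodic T)
    (hG : HasPointGroup T G) : ∃ R : ℝ, 0 < R ∧ ∀ (Φ Ψ : RigidMotion d) (x : Euc d),
      Φ • patch T x R ⊆ Ψ • T → Φ • T = Ψ • T := by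
  obtain ⟨R, hR0, hR⟩ := IsPeriodic.exists_covering_radius hT hper
  obtain ⟨r, hr0, hr⟩ := hG.2
  refine ⟨max R r, lt_max_of_lt_left hR0, fun Φ Ψ x h => ?_⟩
  set Θ := Ψ⁻¹ * Φ with hΘ
  have h1 : Θ • patch T x (max R r) ⊆ T := by
    rwa [hΘ, mul_smul, ← Set.subset_smul_set_iff]
  have hg : rotationPart Θ ∈ G := by
    refine hr x _ ⟨(Θ : Euc d ≃ᵃⁱ[ℝ] Euc d) 0, ?_⟩
    change translate ((Θ : Euc d ≃ᵃⁱ[ℝ] Euc d) 0) • rotationMotion (rotationPart Θ) • patch T x r ⊆ T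
    rw [← mul_smul, ← eq_translate_mul_rotation Θ]
    exact (Set.smul_set_mono (patch_mono T x (le_max_right _ _))).trans h1
  -- The radius `r` puts the rotational part of `Θ` in `G`. Dividing by a symmetry with this
  -- rotational part leaves a translation, to which the covering radius `R` applies.
  obtain ⟨γ, hγ, hγg⟩ := hG.exists_symmetry hT hper hg
  have h2 : rotationPart (Θ * γ⁻¹) = 1 := by rw [map_mul, map_inv, hγg, mul_inv_cancel]
  have h3 := eq_translate_of_rotationPart h2
  have h4 : translate (((Θ * γ⁻¹ : RigidMotion d) : Euc d ≃ᵃⁱ[ℝ] Euc d) 0) • T = T := by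
    refine IsPeriodic.translate_smul_eq hT hR (y := (γ : Euc d ≃ᵃⁱ[ℝ] Euc d) x) ?_
    rw [← h3]
    have h5 := patch_smul γ T x R
    rw [mem_positiveSpaceGroup.1 hγ] at h5
    rw [h5, mul_smul, inv_smul_smul]
    exact (Set.smul_set_mono (patch_mono T x (le_max_left _ _))).trans h1
  rw [← h3, mul_smul, ← mem_positiveSpaceGroup.1 hγ, inv_smul_smul, mem_positiveSpaceGroup.1 hγ, hΘ,
    mul_smul, inv_smul_eq_iff] at h4
  exact h4

end Rigidity

/-! ### The universal covering group of the group of rigid motions -/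

section MotionCover

variable {d : ℕ}

theorem rotationLinear_apply (A : SO d) (v : Euc d) :
    rotationLinear A v = WithLp.toLp 2 ((A : Matrix (Fin d) (Fin d) ℝ).mulVec v.ofLp) := rfl

theorem rotationLinear_one (v : Euc d) : rotationLinear (1 : SO d) v = v := by
  rw [rotationLinear_apply, SO_coe_one, Matrix.one_mulVec]

theorem rotationLinear_mul (A B : SO d) (v : Euc d) :
    rotationLinear (A * B) v = rotationLinear A (rotationLinear B v) := by
  rw [rotationLinear_apply, rotationLinear_apply, rotationLinear_apply, SO_coe_mul,
    Matrix.mulVec_mulVec]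

theorem continuous_rotationLinear_apply {X : Type*} [TopologicalSpace X] {f : X → SO d}
    {g : X → Euc d} (hf : Continuous f) (hg : Continuous g) :
    Continuous fun x => rotationLinear (f x) (g x) := by
  have h1 : Continuous fun x => (f x : Matrix (Fin d) (Fin d) ℝ) := continuous_subtype_val.comp hf
  have h2 : Continuous fun x => (g x).ofLp := (PiLp.continuous_ofLp 2 _).comp hg
  exact (PiLp.continuous_toLp 2 _).comp (h1.matrix_mulVec h2)

/-- The entries of a matrix are the coordinates of the images of the basis vectors. These vectors
lie in the unit ball, on which closeness of tilings measures motions. -/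
theorem exists_nhds_SO {U : Set (SO d)} (hU : U ∈ 𝓝 (1 : SO d)) :
    ∃ ε > 0, ∀ A : SO d, (∀ i, ‖rotationLinear A (EuclideanSpace.single i 1)
      - EuclideanSpace.single i 1‖ < ε) → A ∈ U := by
  rw [nhds_subtype_eq_comap] at hU
  obtain ⟨U', hU', hUU⟩ := hU
  have hU2 : (U' : Set (Fin d → Fin d → ℝ)) ∈
      @nhds (Fin d → Fin d → ℝ) _ (fun i j => (1 : Matrix (Fin d) (Fin d) ℝ) i j) := hU'
  obtain ⟨ε, hε, h⟩ := Metric.mem_nhds_iff.1 hU2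
  refine ⟨ε, hε, fun A hA => hUU ?_⟩
  have hA' : (fun i j => (A : Matrix (Fin d) (Fin d) ℝ) i j) ∈
      Metric.ball (fun i j => (1 : Matrix (Fin d) (Fin d) ℝ) i j) ε := by
    refine (dist_pi_lt_iff hε).2 fun i => (dist_pi_lt_iff hε).2 fun j => ?_
    have h1 := (PiLp.norm_apply_le (rotationLinear A (EuclideanSpace.single j 1)
      - EuclideanSpace.single j 1) i).trans_lt (hA j)
    rw [rotationLinear_apply] at h1
    have h2 : (WithLp.toLp 2 ((A : Matrix (Fin d) (Fin d) ℝ).mulVec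
        (EuclideanSpace.single j (1 : ℝ)).ofLp) - EuclideanSpace.single j (1 : ℝ) : Euc d) i =
        (A : Matrix (Fin d) (Fin d) ℝ) i j - (1 : Matrix (Fin d) (Fin d) ℝ) i j := by
      simp [Matrix.one_apply]
    rwa [dist_eq_norm, ← h2]
  exact h hA'

/-- The semidirect product of Euclidean space and a group that acts by rotations. -/
@[ext]
structure RotationSemidirect {S : Type*} [Group S] (p : S →* SO d) where
  /-- The translational part. -/
  vec : Euc d
  /-- The element of the acting group. -/
  rot : S

namespace RotationSemidirect

variable {S : Type*} [Group S] {p : S →* SO d}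

noncomputable instance : Mul (RotationSemidirect p) :=
  ⟨fun a b => ⟨a.vec + rotationLinear (p a.rot) b.vec, a.rot * b.rot⟩⟩

noncomputable instance : One (RotationSemidirect p) := ⟨⟨0, 1⟩⟩

noncomputable instance : Inv (RotationSemidirect p) :=
  ⟨fun a => ⟨-rotationLinear (p a.rot⁻¹) a.vec, a.rot⁻¹⟩⟩

@[simp] theorem mul_vec (a b : RotationSemidirect p) :
    (a * b).vec = a.vec + rotationLinear (p a.rot) b.vec := rfl

@[simp] theorem mul_rot (a b : RotationSemidirect p) : (a * b).rot = a.rot * b.rot := rfl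

@[simp] theorem one_vec : (1 : RotationSemidirect p).vec = 0 := rfl

@[simp] theorem one_rot : (1 : RotationSemidirect p).rot = 1 := rfl

@[simp] theorem inv_vec (a : RotationSemidirect p) :
    (a⁻¹).vec = -rotationLinear (p a.rot⁻¹) a.vec := rfl

@[simp] theorem inv_rot (a : RotationSemidirect p) : (a⁻¹).rot = a.rot⁻¹ := rfl

noncomputable instance : Group (RotationSemidirect p) :=
  Group.ofLeftAxioms
    (fun a b c => by
      ext1
      · simp only [mul_vec, mul_rot, map_mul, rotationLinear_mul, map_add, add_assoc]
      · simp only [mul_rot, mul_assoc])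
    (fun a => by
      ext1
      · simp only [mul_vec, one_vec, one_rot, map_one, rotationLinear_one, zero_add]
      · simp only [mul_rot, one_rot, one_mul])
    (fun a => by
      ext1
      · simp only [mul_vec, inv_vec, inv_rot, one_vec, neg_add_cancel]
      · simp only [mul_rot, inv_rot, one_rot, inv_mul_cancel])

/-- The projection to the acting group. -/
def rotHom : RotationSemidirect p →* S where
  toFun a := a.rot
  map_one' := rfl
  map_mul' _ _ := rfl

/-- The inclusion of Euclidean space. -/
noncomputable def ofVec : Multiplicative (Euc d) →* RotationSemidirect p where
  toFun v := ⟨v.toAdd, 1⟩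
  map_one' := rfl
  map_mul' v w := by
    ext1
    · simp only [mul_vec, map_one, rotationLinear_one, toAdd_mul]
    · simp only [mul_rot, mul_one]

theorem ofVec_rot (v : Multiplicative (Euc d)) : (ofVec v : RotationSemidirect p).rot = 1 := rfl

theorem eq_ofVec {a : RotationSemidirect p} (h : a.rot = 1) : a = ofVec (.ofAdd a.vec) :=
  RotationSemidirect.ext rfl h

/-- The homomorphism to the group of rigid motions. -/
noncomputable def motion : RotationSemidirect p →* RigidMotion d where
  toFun a := translate a.vec * rotationMotion (p a.rot)
  map_one' := by rw [one_vec, one_rot, translate_zero, map_one, map_one, one_mul]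
  map_mul' a b := by
    refine rigidMotion_ext fun x => ?_
    have h : ∀ (A : SO d) (y : Euc d),
        ((rotationMotion A : RigidMotion d) : Euc d ≃ᵃⁱ[ℝ] Euc d) y = rotationLinear A y :=
      fun _ _ => rfl
    simp only [mul_apply_motion, translate_apply, mul_vec, mul_rot, map_mul, h,
      map_add, add_assoc]

theorem motion_apply (a : RotationSemidirect p) (x : Euc d) :
    ((motion a : RigidMotion d) : Euc d ≃ᵃⁱ[ℝ] Euc d) x
      = a.vec + rotationLinear (p a.rot) x := rfl

theorem motion_mk (v : Euc d) (s : S) :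
    motion (⟨v, s⟩ : RotationSemidirect p) = translate v * rotationMotion (p s) := rfl

theorem motion_ofVec (v : Multiplicative (Euc d)) :
    motion (ofVec v : RotationSemidirect p) = translate v.toAdd := by
  change translate v.toAdd * rotationMotion (p 1) = _
  rw [map_one, map_one, mul_one]

theorem rotationPart_motion (a : RotationSemidirect p) : rotationPart (motion a) = p a.rot := by
  change rotationPart (translate a.vec * rotationMotion (p a.rot)) = _
  rw [map_mul, rotationPart_translate, one_mul, rotationPart_rotationMotion]

theorem motion_eq_of_proj {Φ : RigidMotion d} {s : S} (hs : p s = rotationPart Φ) :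
    motion (⟨(Φ : Euc d ≃ᵃⁱ[ℝ] Euc d) 0, s⟩ : RotationSemidirect p) = Φ := by
  rw [motion_mk, hs, ← eq_translate_mul_rotation]

theorem motion_apply_zero (a : RotationSemidirect p) :
    ((motion a : RigidMotion d) : Euc d ≃ᵃⁱ[ℝ] Euc d) 0 = a.vec := by
  rw [motion_apply, map_zero, add_zero]

theorem motion_surjective (hp : Function.Surjective p) :
    Function.Surjective (motion : RotationSemidirect p → RigidMotion d) := by
  intro Φ
  obtain ⟨s, hs⟩ := hp (rotationPart Φ)
  exact ⟨_, motion_eq_of_proj hs⟩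

variable [TopologicalSpace S]

/-- The bijection with the product. -/
def equivProd : RotationSemidirect p ≃ Euc d × S where
  toFun a := (a.vec, a.rot)
  invFun a := ⟨a.1, a.2⟩
  left_inv _ := rfl
  right_inv _ := rfl

noncomputable instance : TopologicalSpace (RotationSemidirect p) :=
  TopologicalSpace.induced equivProd inferInstance

/-- The homeomorphism with the product. -/
noncomputable def homeomorphProd : RotationSemidirect p ≃ₜ Euc d × S :=
  equivProd.toHomeomorphOfIsInducing ⟨rfl⟩

theorem continuous_vec : Continuous (vec : RotationSemidirect p → Euc d) :=
  continuous_fst.comp (homeomorphProd (p := p)).continuous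

theorem continuous_rot : Continuous (rot : RotationSemidirect p → S) :=
  continuous_snd.comp (homeomorphProd (p := p)).continuous

theorem continuous_mk {X : Type*} [TopologicalSpace X] {f : X → Euc d} {g : X → S}
    (hf : Continuous f) (hg : Continuous g) :
    Continuous fun x => (⟨f x, g x⟩ : RotationSemidirect p) :=
  (homeomorphProd (p := p)).symm.continuous.comp (hf.prodMk hg)

theorem continuous_ofVec : Continuous (ofVec : Multiplicative (Euc d) → RotationSemidirect p) :=
  continuous_mk continuous_toAdd continuous_const

theorem isTopologicalGroup [IsTopologicalGroup S] (hp : Continuous p) :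
    IsTopologicalGroup (RotationSemidirect p) where
  continuous_mul := by
    have h1 : Continuous fun q : RotationSemidirect p × RotationSemidirect p => q.1.rot :=
      continuous_rot.comp continuous_fst
    have h2 : Continuous fun q : RotationSemidirect p × RotationSemidirect p => q.2.vec :=
      continuous_vec.comp continuous_snd
    exact continuous_mk ((continuous_vec.comp continuous_fst).add
      (continuous_rotationLinear_apply (hp.comp h1) h2))
      (h1.mul (continuous_rot.comp continuous_snd))
  continuous_inv := by
    have h1 : Continuous fun q : RotationSemidirect p => q.rot⁻¹ := continuous_rot.inv
    exact continuous_mk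
      (continuous_rotationLinear_apply (hp.comp h1) continuous_vec).neg h1

/-- The Euclidean factor is contractible. -/
theorem simplyConnectedSpace [SimplyConnectedSpace S] :
    SimplyConnectedSpace (RotationSemidirect p) := by
  obtain ⟨e⟩ := ContractibleSpace.hequiv_unit (X := Euc d)
  let f : ContinuousMap.HomotopyEquiv (Euc d × S) (Unit × S) :=
    e.prodCongr (ContinuousMap.HomotopyEquiv.refl _)
  have h1 : SimplyConnectedSpace (Unit × S) :=
    (Homeomorph.punitProd S).toHomotopyEquiv.simplyConnectedSpace
  have h2 := f.simplyConnectedSpace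
  exact (homeomorphProd (p := p)).toHomotopyEquiv.simplyConnectedSpace

/-- Elements near `1` move the points of the unit ball a little. -/
theorem eventually_dist_motion_lt (hp : Continuous p) {ε : ℝ} (hε : 0 < ε) :
    ∀ᶠ a in 𝓝 (1 : RotationSemidirect p), ∀ x ∈ Metric.closedBall (0 : Euc d) 1,
      dist (((motion a : RigidMotion d) : Euc d ≃ᵃⁱ[ℝ] Euc d) x) x < ε := by
  refine (isCompact_closedBall (0 : Euc d) 1).eventually_forall_of_forall_eventually fun x _ => ?_
  have h : Continuous fun q : RotationSemidirect p × Euc d =>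
      dist (q.1.vec + rotationLinear (p q.1.rot) q.2) q.2 := by
    refine Continuous.dist ((continuous_vec.comp continuous_fst).add ?_) continuous_snd
    exact continuous_rotationLinear_apply (hp.comp (continuous_rot.comp continuous_fst))
      continuous_snd
  simp only [motion_apply]
  refine (h.tendsto (1, x)).eventually_lt_const ?_
  rwa [one_vec, one_rot, map_one, rotationLinear_one, zero_add, dist_self]

/-- A rigid motion that moves the points of the unit ball a little lifts to an element near `1`. -/
theorem exists_lift_near (hp : IsOpenMap p) {N : Set (RotationSemidirect p)}
    (hN : N ∈ 𝓝 (1 : RotationSemidirect p)) :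
    ∃ ε > 0, ∀ Φ : RigidMotion d, (∀ x ∈ Metric.closedBall (0 : Euc d) 1,
      dist ((Φ : Euc d ≃ᵃⁱ[ℝ] Euc d) x) x < ε) → ∃ a ∈ N, motion a = Φ := by
  rw [(homeomorphProd (p := p)).isInducing.nhds_eq_comap] at hN
  obtain ⟨M, hM, hMN⟩ := hN
  obtain ⟨N₁, hN₁, N₂, hN₂, hNN⟩ := mem_nhds_prod_iff.1 hM
  obtain ⟨ε₁, hε₁, h₁⟩ := Metric.mem_nhds_iff.1 hN₁
  have hU : p '' N₂ ∈ 𝓝 (1 : SO d) := by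
    have := hp.image_mem_nhds hN₂
    change p '' N₂ ∈ 𝓝 (p 1) at this
    rwa [map_one] at this
  obtain ⟨ε₂, hε₂, h₂⟩ := exists_nhds_SO hU
  -- A basis vector is moved by `Φ` to the sum of `Φ 0` and its rotated image. Two errors of at most
  -- `ε₂ / 2` therefore bound the displacement by the rotation.
  refine ⟨min ε₁ (ε₂ / 2), lt_min hε₁ (half_pos hε₂), fun Φ hΦ => ?_⟩
  have h0 := hΦ 0 (Metric.mem_closedBall_self zero_le_one)
  have hA : rotationPart Φ ∈ p '' N₂ := by
    refine h₂ _ fun i => ?_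
    have hi := hΦ (EuclideanSpace.single i 1) (by simp)
    have e : (Φ : Euc d ≃ᵃⁱ[ℝ] Euc d) (EuclideanSpace.single i 1) = (Φ : Euc d ≃ᵃⁱ[ℝ] Euc d) 0
        + rotationLinear (rotationPart Φ) (EuclideanSpace.single i 1) := by
      conv_lhs => rw [eq_translate_mul_rotation Φ]
      rfl
    rw [e, dist_eq_norm] at hi
    rw [dist_zero_right] at h0
    have h3 := norm_sub_le ((Φ : Euc d ≃ᵃⁱ[ℝ] Euc d) 0 + rotationLinear (rotationPart Φ)
      (EuclideanSpace.single i 1) - EuclideanSpace.single i 1) ((Φ : Euc d ≃ᵃⁱ[ℝ] Euc d) 0)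
    rw [add_sub_assoc, add_sub_cancel_left] at h3
    rw [add_sub_assoc] at hi
    have h4 := min_le_right ε₁ (ε₂ / 2)
    linarith
  obtain ⟨s, hs, hsA⟩ := hA
  refine ⟨⟨(Φ : Euc d ≃ᵃⁱ[ℝ] Euc d) 0, s⟩, hMN (hNN ⟨h₁ ?_, hs⟩), motion_eq_of_proj hsA⟩
  exact h0.trans_le (min_le_left _ _)

end RotationSemidirect

/-- The universal covering group of the group of rigid motions. -/
abbrev MotionCover (d : ℕ) : Type := RotationSemidirect (UniversalCover.proj : Sp d →* SO d)

instance : IsTopologicalGroup (MotionCover d) :=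
  RotationSemidirect.isTopologicalGroup UniversalCover.continuous_proj

instance : SimplyConnectedSpace (MotionCover d) :=
  have := UniversalCover.simplyConnectedSpace (hasContraction_SO d)
  RotationSemidirect.simplyConnectedSpace

end MotionCover

/-! ### The hulls as coset spaces -/

section Hulls

open RotationSemidirect

variable {d : ℕ} {L : Type*} {T : Set (Tile d L)} {G : Subgroup (SO d)}

theorem IsPeriodic.mem_rotationalHull_iff (hT : IsTiling T) (hper : IsPeriodic T)
    {T' : Set (Tile d L)} : T' ∈ rotationalHull T ↔ ∃ Φ : RigidMotion d, T' = Φ • T := by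
  constructor
  · rintro ⟨A, hA⟩
    obtain ⟨v, hv⟩ := (IsPeriodic.mem_translationalHull_iff hT hper).1 hA
    exact ⟨(rotationMotion A)⁻¹ * translate v, by rw [mul_smul, ← hv, inv_smul_smul]⟩
  · rintro ⟨Φ, rfl⟩
    refine ⟨(rotationPart Φ)⁻¹, (IsPeriodic.mem_translationalHull_iff hT hper).2 ?_⟩
    have h : rotationPart (rotationMotion (rotationPart Φ)⁻¹ * Φ) = 1 := by
      rw [map_mul, rotationPart_rotationMotion, inv_mul_cancel]
    exact ⟨_, by rw [← eq_translate_of_rotationPart h, mul_smul]⟩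

/-- The orbit map from the group of rigid motions to the rotational hull. -/
noncomputable def hullMap (hT : IsTiling T) (hper : IsPeriodic T) (a : MotionCover d) :
    rotationalHull T :=
  ⟨motion a • T, (IsPeriodic.mem_rotationalHull_iff hT hper).2 ⟨_, rfl⟩⟩

/-- The lift of the positive space group. -/
noncomputable def liftedSpaceGroup (T : Set (Tile d L)) : Subgroup (MotionCover d) :=
  (positiveSpaceGroup T).comap motion

theorem smul_eq_smul_iff_mem {Φ Ψ : RigidMotion d} :
    Φ • T = Ψ • T ↔ Φ⁻¹ * Ψ ∈ positiveSpaceGroup T := by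
  rw [mem_positiveSpaceGroup, mul_smul, inv_smul_eq_iff, eq_comm]

theorem hullMap_eq_iff (hT : IsTiling T) (hper : IsPeriodic T) {a b : MotionCover d} :
    hullMap hT hper a = hullMap hT hper b ↔ a⁻¹ * b ∈ liftedSpaceGroup T := by
  rw [liftedSpaceGroup, Subgroup.mem_comap, map_mul, map_inv, ← smul_eq_smul_iff_mem, Subtype.ext_iff]
  rfl

theorem hullMap_surjective (hT : IsTiling T) (hper : IsPeriodic T) :
    Function.Surjective (hullMap hT hper) := by
  rintro ⟨T', hT'⟩
  obtain ⟨Φ, rfl⟩ := (IsPeriodic.mem_rotationalHull_iff hT hper).1 hT'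
  obtain ⟨a, rfl⟩ := motion_surjective UniversalCover.proj_surjective Φ
  exact ⟨a, rfl⟩

/-- The motion of `b * a⁻¹` takes the tiling of `a` exactly to that of `b`, and it is small when `b`
is near `a`. -/
theorem continuous_motion_smul (T : Set (Tile d L)) :
    Continuous fun a : MotionCover d => motion a • T := by
  refine continuous_def.2 fun U hU => isOpen_iff_mem_nhds.2 fun a ha => ?_
  obtain ⟨ε, hε, h⟩ := hU _ ha
  have h1 : Filter.Tendsto (fun b : MotionCover d => b * a⁻¹) (𝓝 a) (𝓝 1) := by
    have : Continuous fun b : MotionCover d => b * a⁻¹ := continuous_mul_const _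
    have := this.tendsto a
    rwa [mul_inv_cancel] at this
  filter_upwards [h1.eventually (eventually_dist_motion_lt UniversalCover.continuous_proj hε)] with b hb
  refine h _ ⟨motion (b * a⁻¹), hb, ?_⟩
  rw [← mul_smul, ← map_mul, inv_mul_cancel_right]

theorem continuous_hullMap (hT : IsTiling T) (hper : IsPeriodic T) :
    Continuous (hullMap hT hper) :=
  (continuous_motion_smul T).subtype_mk _

/-- The image of `O` is the trace on the hull of the set `U` of all sets of tiles that agree with
some `a T`, for `a` in `O`, on a ball of radius greater than `R`: by rigidity such agreement is
equality within the hull. The strict inequality leaves room to lose a little radius when the set of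
tiles is moved, which makes `U` open. -/
theorem isOpenMap_hullMap (hT : IsTiling T) (hper : IsPeriodic T) (hG : HasPointGroup T G) :
    IsOpenMap (hullMap hT hper) := by
  intro O hO
  obtain ⟨R, hR0, hR⟩ := hG.exists_rigidity hT hper
  let U : Set (Set (Tile d L)) :=
    {T' | ∃ a ∈ O, ∃ R' > R, patch (motion a • T) 0 R' = patch T' 0 R'}
  have hU : IsOpen U := by
    rintro T₂ ⟨a, ha, R', hR', hp⟩
    have hN : {n : MotionCover d | n * a ∈ O} ∈ 𝓝 (1 : MotionCover d) := by
      have hc : Continuous fun n : MotionCover d => n * a := continuous_mul_const _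
      exact (hO.preimage hc).mem_nhds (by change 1 * a ∈ O; rwa [one_mul])
    obtain ⟨ε, hε, hlift⟩ := exists_lift_near (UniversalCover.isOpenMap_proj (hasContraction_SO d)) hN
    let R'' := (R + R') / 2
    have hR1 : R < R'' := by simp only [R'']; linarith
    have hR2 : R'' < R' := by simp only [R'']; linarith
    have hR3 : 0 < R'' := hR0.trans hR1
    -- `ε` lets the small motion lift to a factor that keeps `n * a` in `O`, `R' - R''` bounds the
    -- shift of the origin, and `1 / R''` ensures agreement on the ball of radius `R''`.
    let δ := min ε (min (R' - R'') (1 / R''))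
    have hδ : 0 < δ := lt_min hε (lt_min (sub_pos.2 hR2) (by positivity))
    refine ⟨δ, hδ, fun T₃ ⟨Φ, hΦ, hΦp⟩ => ?_⟩
    obtain ⟨n, hn, rfl⟩ := hlift Φ fun x hx => (hΦ x hx).trans_le (min_le_left _ _)
    refine ⟨n * a, hn, R'', hR1, ?_⟩
    have h0 : ‖(((motion n)⁻¹ : RigidMotion d) : Euc d ≃ᵃⁱ[ℝ] Euc d) 0‖ ≤ R' - R'' := by
      have h1 := hΦ 0 (Metric.mem_closedBall_self zero_le_one)
      have h2 := (((motion n)⁻¹ : RigidMotion d) : Euc d ≃ᵃⁱ[ℝ] Euc d).dist_map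
        (((motion n : RigidMotion d) : Euc d ≃ᵃⁱ[ℝ] Euc d) 0) 0
      rw [← mul_apply_motion, inv_mul_cancel] at h2
      change dist (0 : Euc d) _ = _ at h2
      rw [dist_zero_left] at h2
      rw [h2]
      exact (h1.trans_le ((min_le_right _ _).trans (min_le_left _ _))).le
    have h3 : patch (motion n • T₂) 0 R'' = patch T₃ 0 R'' := by
      refine patch_eq_of_le ?_ hΦp
      rw [le_one_div hR3 hδ]
      exact (min_le_right _ _).trans (min_le_right _ _)
    rw [← h3, map_mul, mul_smul, patch_smul', patch_smul' (motion n) T₂]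
    congr 1
    refine patch_eq_of_closedBall_subset (Metric.closedBall_subset_closedBall' ?_) hp
    rw [dist_zero_right]
    linarith
  have e : hullMap hT hper '' O = Subtype.val ⁻¹' U := by
    ext x
    constructor
    · rintro ⟨a, ha, rfl⟩
      exact ⟨a, ha, R + 1, lt_add_one R, rfl⟩
    · rintro ⟨a, ha, R', hR', hp⟩
      refine ⟨a, ha, Subtype.ext ?_⟩
      obtain ⟨b, rfl⟩ := hullMap_surjective hT hper x
      refine hR (motion a) (motion b) ((((motion a)⁻¹ : RigidMotion d) : Euc d ≃ᵃⁱ[ℝ] Euc d) 0) ?_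
      rw [← patch_smul']
      refine (patch_mono _ _ hR'.le).trans ?_
      rw [hp]
      exact patch_subset _ _ _
  rw [e]
  exact hU.preimage continuous_subtype_val

theorem isQuotientMap_hullMap (hT : IsTiling T) (hper : IsPeriodic T) (hG : HasPointGroup T G) :
    Topology.IsQuotientMap (hullMap hT hper) :=
  (isOpenMap_hullMap hT hper hG).isQuotientMap (continuous_hullMap hT hper)
    (hullMap_surjective hT hper)

/-- A neighbourhood of `1` meets the lift of a finite group of rotations trivially. -/
theorem exists_nhds_liftGroup (hG : (G : Set (SO d)).Finite) :
    ∃ W : Set (Sp d), IsOpen W ∧ 1 ∈ W ∧ ∀ s ∈ W, s ∈ liftGroup G → s = 1 := by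
  obtain ⟨W, hW, h⟩ := UniversalCover.exists_nhds_ker_proj (hasContraction_SO d)
  obtain ⟨W', hW', hWo, h1⟩ := mem_nhds_iff.1 hW
  refine ⟨W' ∩ UniversalCover.proj ⁻¹' ((G : Set (SO d)) \ {1})ᶜ, hWo.inter ?_, ⟨h1, ?_⟩, ?_⟩
  · exact (hG.subset Set.sdiff_subset).isClosed.isOpen_compl.preimage UniversalCover.continuous_proj
  · rintro ⟨-, h2⟩
    exact h2 (map_one _)
  · rintro s ⟨hs, hs'⟩ hsG
    refine h s (hW' hs) ?_
    by_contra hne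
    exact hs' ⟨hsG, hne⟩

theorem isDiscrete_liftGroup (hG : (G : Set (SO d)).Finite) :
    IsDiscrete (liftGroup G : Set (Sp d)) := by
  obtain ⟨W, hW, h1, h⟩ := exists_nhds_liftGroup hG
  exact isDiscrete_of_nhds_one _ (hW.mem_nhds h1) fun s hs hsW => h s hsW hs

theorem rot_mem_liftGroup (hG : HasPointGroup T G) {a : MotionCover d}
    (ha : a ∈ liftedSpaceGroup T) : a.rot ∈ liftGroup G := by
  change UniversalCover.proj a.rot ∈ G
  rw [← rotationPart_motion]
  exact hG.rotationPart_mem ha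

theorem ofVec_mem_liftedSpaceGroup {v : Multiplicative (Euc d)} :
    ofVec v ∈ liftedSpaceGroup T ↔ v ∈ translationGroup T := by
  rw [liftedSpaceGroup, Subgroup.mem_comap, motion_ofVec]
  rfl

theorem IsTiling.exists_nhds_translationGroup (hT : IsTiling T) :
    ∃ U ∈ 𝓝 (1 : Multiplicative (Euc d)), ∀ v ∈ translationGroup T, v ∈ U → v = 1 := by
  obtain ⟨ρ, hρ, h⟩ := hT.exists_separation_lattice
  refine ⟨Multiplicative.toAdd ⁻¹' Metric.ball 0 ρ,
    continuous_toAdd.continuousAt (Metric.ball_mem_nhds (0 : Euc d) hρ), fun v hv hvU => ?_⟩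
  exact h v.toAdd hv (mem_ball_zero_iff.1 hvU)

theorem IsTiling.isDiscrete_translationGroup (hT : IsTiling T) :
    IsDiscrete (translationGroup T : Set (Multiplicative (Euc d))) := by
  obtain ⟨U, hU, h⟩ := hT.exists_nhds_translationGroup
  exact isDiscrete_of_nhds_one _ hU h

/-- Near `1` the rotational part lies in the discrete group `G̃`, hence is `1`; what remains is a
small translational symmetry, hence trivial. -/
theorem isDiscrete_liftedSpaceGroup (hT : IsTiling T) (hG : HasPointGroup T G) :
    IsDiscrete (liftedSpaceGroup T : Set (MotionCover d)) := by
  obtain ⟨W, hW, h1, h⟩ := exists_nhds_liftGroup hG.1.1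
  obtain ⟨U, hU, hU'⟩ := hT.exists_nhds_translationGroup
  have hfst : Continuous fun a : MotionCover d => Multiplicative.ofAdd a.vec :=
    continuous_ofAdd.comp continuous_vec
  refine isDiscrete_of_nhds_one _ (Filter.inter_mem (hfst.continuousAt (x := 1) hU)
    ((hW.preimage continuous_rot).mem_nhds h1)) fun a ha haN => ?_
  have h2 := eq_ofVec (h _ haN.2 (rot_mem_liftGroup hG ha))
  rw [h2] at ha ⊢
  rw [hU' _ (ofVec_mem_liftedSpaceGroup.1 ha) haN.1, map_one]

/-- The orbit map from the group of translations to the translational hull. -/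
noncomputable def hullMapT (hT : IsTiling T) (hper : IsPeriodic T) (v : Multiplicative (Euc d)) :
    translationalHull T :=
  ⟨translate v.toAdd • T, (IsPeriodic.mem_translationalHull_iff hT hper).2 ⟨_, rfl⟩⟩

theorem hullInclusion_hullMapT (hT : IsTiling T) (hper : IsPeriodic T)
    (v : Multiplicative (Euc d)) :
    hullInclusion T (hullMapT hT hper v) = hullMap hT hper (ofVec v) := by
  refine Subtype.ext ?_
  change translate v.toAdd • T = motion (ofVec v) • T
  rw [motion_ofVec]

theorem hullMapT_eq_iff (hT : IsTiling T) (hper : IsPeriodic T) {v w : Multiplicative (Euc d)} :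
    hullMapT hT hper v = hullMapT hT hper w ↔ v⁻¹ * w ∈ translationGroup T := by
  rw [← ofVec_mem_liftedSpaceGroup, map_mul, map_inv, ← hullMap_eq_iff hT hper,
    ← hullInclusion_hullMapT, ← hullInclusion_hullMapT]
  exact (Set.inclusion_injective (translationalHull_subset T)).eq_iff.symm

theorem isQuotientMap_hullMapT (hT : IsTiling T) (hper : IsPeriodic T) (hG : HasPointGroup T G) :
    Topology.IsQuotientMap (hullMapT hT hper) := by
  have hc : Continuous (hullMapT hT hper) := by
    refine Continuous.subtype_mk ?_ _
    have h := (continuous_motion_smul T).comp continuous_ofVec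
    refine h.congr fun v => ?_
    change motion (ofVec v) • T = _
    rw [motion_ofVec]
  have hs : Function.Surjective (hullMapT hT hper) := by
    rintro ⟨T', hT'⟩
    obtain ⟨v, rfl⟩ := (IsPeriodic.mem_translationalHull_iff hT hper).1 hT'
    exact ⟨.ofAdd v, rfl⟩
  refine IsOpenMap.isQuotientMap (fun O hO => ?_) hc hs
  obtain ⟨W, hW, h1, h⟩ := exists_nhds_liftGroup hG.1.1
  have hfst : Continuous fun a : MotionCover d => Multiplicative.ofAdd a.vec :=
    continuous_ofAdd.comp continuous_vec
  -- `O` is thickened by rotations in a neighbourhood that meets `G̃` trivially. The open image in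
  -- `Ω_r` then meets `Ω_t` exactly in the image of `O`.
  have ho := isOpenMap_hullMap hT hper hG _
    ((hO.preimage hfst).inter (hW.preimage continuous_rot))
  convert ho.preimage (hullInclusion T).continuous using 1
  ext y
  constructor
  · rintro ⟨v, hv, rfl⟩
    exact ⟨ofVec v, ⟨hv, h1⟩, (hullInclusion_hullMapT hT hper v).symm⟩
  · rintro ⟨a, ⟨haO, haW⟩, ha⟩
    obtain ⟨v, rfl⟩ := hs y
    rw [hullInclusion_hullMapT] at ha
    have h2 := rot_mem_liftGroup hG ((hullMap_eq_iff hT hper).1 ha)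
    rw [mul_rot, inv_rot, ofVec_rot, mul_one, inv_mem_iff] at h2
    have h4 := eq_ofVec (h _ haW h2)
    refine ⟨_, haO, ?_⟩
    refine Set.inclusion_injective (translationalHull_subset T) ?_
    change hullInclusion T _ = hullInclusion T _
    rw [hullInclusion_hullMapT, hullInclusion_hullMapT, ← h4, ha]

/-- The orientation map of the rotational hull. -/
theorem exists_orientationMap (hT : IsTiling T) (hper : IsPeriodic T) (hG : HasPointGroup T G) :
    ∃ θ : C(rotationalHull T, Sp d ⧸ liftGroup G), ∀ a : MotionCover d,
      θ (hullMap hT hper a) = QuotientGroup.mk a.rot := by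
  have hq : Topology.IsQuotientMap
    (⟨hullMap hT hper, continuous_hullMap hT hper⟩ : C(MotionCover d, rotationalHull T)) :=
    isQuotientMap_hullMap hT hper hG
  let g : C(MotionCover d, Sp d ⧸ liftGroup G) :=
    ⟨fun a => QuotientGroup.mk a.rot, continuous_quotient_mk'.comp continuous_rot⟩
  have hg : Function.FactorsThrough g (hullMap hT hper) := by
    intro a b hab
    refine QuotientGroup.eq.2 ?_
    exact rot_mem_liftGroup hG ((hullMap_eq_iff hT hper).1 hab)
  exact ⟨hq.lift g hg, fun a => congrArg (fun f : C(_, _) => f a) (hq.lift_comp g hg)⟩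

end Hulls

/-! ### Lifting of loops and induced homomorphisms -/

section Loops

theorem loopClass_surjective {X : Type*} [TopologicalSpace X] {x : X} (a : FundamentalGroup X x) :
    ∃ ℓ : Path x x, loopClass ℓ = a :=
  ⟨Quotient.out (s := Path.Homotopic.setoid x x) a, Quotient.out_eq _⟩

theorem map_loopClass {X Y : Type*} [TopologicalSpace X] [TopologicalSpace Y] (f : C(X, Y)) {x : X}
    (ℓ : Path x x) :
    FundamentalGroup.map f x (loopClass ℓ) = loopClass (ℓ.map f.continuous) := rfl

/-- The isomorphism `η` of a fundamental group with a discrete subgroup takes a loop to the end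
point of its lift. -/
def IsLifting {E X : Type*} [Group E] [TopologicalSpace E] [TopologicalSpace X] (p : E → X)
    {D : Subgroup E} {x₀ : X} (η : FundamentalGroup X x₀ ≃* D) : Prop :=
  ∀ (ℓ : Path x₀ x₀) (s : C(I, E)), s 0 = 1 → (∀ t, p (s t) = ℓ t) → (η (loopClass ℓ) : E) = s 1

variable {E X : Type*} [Group E] [TopologicalSpace E] [TopologicalSpace X] {p : E → X}
  {D : Subgroup E} {x₀ : X} {η : FundamentalGroup X x₀ ≃* D}

theorem IsLifting.exists_loop (hη : IsLifting p η) (hp : Continuous p)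
    (hpD : ∀ {a b}, p a = p b ↔ a⁻¹ * b ∈ D) (h1 : p 1 = x₀) (g : D) (s : C(I, E)) (h0 : s 0 = 1)
    (hs : s 1 = g) : ∃ ℓ : Path x₀ x₀, (∀ t, ℓ t = p (s t)) ∧ η (loopClass ℓ) = g := by
  let ℓ : Path x₀ x₀ :=
    { toFun := fun t => p (s t)
      continuous_toFun := hp.comp s.continuous
      source' := by rw [h0, h1]
      target' := by
        rw [← h1, eq_comm, hpD, hs, inv_one, one_mul]
        exact g.2 }
  exact ⟨ℓ, fun _ => rfl, Subtype.ext ((hη ℓ s h0 fun _ => rfl).trans hs)⟩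

/-- A homomorphism `f` over `F` takes the lift of a loop that starts at `1` to the lift of the image
loop, so it takes end point to end point. -/
theorem IsLifting.map_eq [IsTopologicalGroup E] {E' X' : Type*} [Group E'] [TopologicalSpace E']
    [TopologicalSpace X'] {p' : E' → X'} {D' : Subgroup E'} {F : C(X, X')}
    {η' : FundamentalGroup X' (F x₀) ≃* D'} (hη : IsLifting p η) (hη' : IsLifting p' η')
    (hp : Topology.IsQuotientMap p) (hD : IsDiscrete (D : Set E))
    (hpD : ∀ {a b}, p a = p b ↔ a⁻¹ * b ∈ D) (h1 : p 1 = x₀) {f : E →* E'} (hf : Continuous f)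
    (hF : ∀ a, F (p a) = p' (f a)) (a : FundamentalGroup X x₀) :
    (η' (FundamentalGroup.map F x₀ a) : E') = f (η a) := by
  obtain ⟨ℓ, rfl⟩ := loopClass_surjective a
  obtain ⟨s, h0, hs⟩ := exists_lift_of_discrete hp D hD hpD h1 ℓ.toContinuousMap ℓ.source
  rw [hη ℓ s h0 hs, map_loopClass]
  refine hη' _ ((⟨f, hf⟩ : C(E, E')).comp s) ?_ fun t => ?_
  · change f (s 0) = 1
    rw [h0, map_one]
  · change p' (f (s t)) = F (ℓ t)
    rw [← hF, hs]
    rfl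

end Loops

/-! ### Transport of group extensions -/

section Extensions

variable {N M A B B' : Type*} [Group N] [Group M] [Group A] [Group B] [Group B']

/-- Transport of a group extension along an isomorphism of the middle groups. -/
def extensionOfEquiv (S : GroupExtension N A B) (e : M ≃* A) (inl : N →* M) (rightHom : M →* B)
    (h₁ : ∀ n, e (inl n) = S.inl n) (h₂ : ∀ m, S.rightHom (e m) = rightHom m) :
    GroupExtension N M B where
  inl := inl
  rightHom := rightHom
  inl_injective := fun a b h => S.inl_injective (by rw [← h₁, ← h₁, h])
  range_inl_eq_ker_rightHom := by
    ext m
    rw [MonoidHom.mem_ker, ← h₂, ← MonoidHom.mem_ker, ← S.range_inl_eq_ker_rightHom]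
    refine exists_congr fun n => ?_
    rw [← h₁, e.injective.eq_iff]
  rightHom_surjective := fun b => by
    obtain ⟨a, rfl⟩ := S.rightHom_surjective b
    exact ⟨e.symm a, by rw [← h₂, e.apply_symm_apply]⟩

/-- The fibre product with a surjective homomorphism `q` is an extension by the kernel of `q`. -/
def fibreProductExtension (S : GroupExtension N A B) (q : B' →* B) (hq : Function.Surjective q)
    (k : M ≃* q.ker) : GroupExtension M (FibreProduct S.rightHom q) A where
  inl := ((1 : M →* A).prod (q.ker.subtype.comp k.toMonoidHom)).codRestrict _ fun m => by
    change S.rightHom 1 = q (k m)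
    rw [map_one]
    exact (k m).2.symm
  rightHom := pullbackFst S q
  inl_injective := fun a b h => k.injective (Subtype.ext
    (congrArg (fun x : FibreProduct S.rightHom q => (x : A × B').2) h))
  range_inl_eq_ker_rightHom := by
    ext ⟨⟨a, b⟩, h⟩
    change S.rightHom a = q b at h
    constructor
    · rintro ⟨m, hm⟩
      exact (congrArg (fun x : FibreProduct S.rightHom q => (x : A × B').1) hm).symm
    · intro ha
      change a = 1 at ha
      subst ha
      rw [map_one] at h
      refine ⟨k.symm ⟨b, h.symm⟩, Subtype.ext (Prod.ext rfl ?_)⟩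
      change (k (k.symm ⟨b, h.symm⟩) : B') = b
      rw [k.apply_symm_apply]
  rightHom_surjective := fun a => by
    obtain ⟨b, hb⟩ := hq (S.rightHom a)
    exact ⟨⟨(a, b), hb.symm⟩, rfl⟩

end Extensions

/-! ### The lifted space group as a fibre product -/

section LiftProj

variable {d : ℕ} {L : Type*} {T : Set (Tile d L)} {G : Subgroup (SO d)}

theorem liftProj_surjective (G : Subgroup (SO d)) : Function.Surjective (liftProj G) := by
  rintro ⟨g, hg⟩
  obtain ⟨s, rfl⟩ := UniversalCover.proj_surjective g
  exact ⟨⟨s, hg⟩, rfl⟩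

/-- The kernel of the universal covering does not change on restriction to a subgroup. -/
def kerProjEquivKerLiftProj (G : Subgroup (SO d)) :
    (UniversalCover.proj : Sp d →* SO d).ker ≃* (liftProj G).ker where
  toFun s := ⟨⟨s.1, by
    change UniversalCover.proj s.1 ∈ G
    rw [MonoidHom.mem_ker.1 s.2]
    exact one_mem G⟩, Subtype.ext s.2⟩
  invFun s := ⟨s.1.1, congrArg Subtype.val (MonoidHom.mem_ker.1 s.2)⟩
  left_inv _ := rfl
  right_inv _ := rfl
  map_mul' _ _ := rfl

open RotationSemidirect

/-- The lift of the positive space group is the fibre product over the point group. -/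
noncomputable def liftedSpaceGroupEquiv (hT : IsTiling T) (hper : IsPeriodic T) (hG : HasPointGroup T G) :
    liftedSpaceGroup T ≃* FibreProduct (standardExtension hT hper hG).rightHom (liftProj G) where
  toFun a := ⟨(⟨motion a.1, a.2⟩, ⟨a.1.rot, rot_mem_liftGroup hG a.2⟩),
    Subtype.ext (rotationPart_motion a.1)⟩
  invFun x := ⟨⟨((x.1.1 : RigidMotion d) : Euc d ≃ᵃⁱ[ℝ] Euc d) 0, x.1.2⟩, by
    change motion _ ∈ positiveSpaceGroup T
    have h := motion_eq_of_proj (Φ := (x.1.1 : RigidMotion d)) (s := (x.1.2 : Sp d))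
      (congrArg Subtype.val x.2).symm
    rw [h]
    exact x.1.1.2⟩
  left_inv a := Subtype.ext (RotationSemidirect.ext (motion_apply_zero a.1) rfl)
  right_inv x := Subtype.ext (Prod.ext
    (Subtype.ext (motion_eq_of_proj (congrArg Subtype.val x.2).symm)) rfl)
  map_mul' a b := Subtype.ext (Prod.ext (Subtype.ext (map_mul motion a.1 b.1)) rfl)

end LiftProj

/-! ### Fundamental groups of the hulls and the maps between them -/

section FundamentalGroups

open RotationSemidirect

variable {d : ℕ} {L : Type*} {T : Set (Tile d L)} {G : Subgroup (SO d)}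

theorem hullMap_one (hT : IsTiling T) (hper : IsPeriodic T) :
    hullMap hT hper 1 = basePointR hT := Subtype.ext (by
  change motion 1 • T = T
  rw [map_one, one_smul])

theorem hullMapT_one (hT : IsTiling T) (hper : IsPeriodic T) :
    hullMapT hT hper 1 = basePointT hT := Subtype.ext (by
  change translate 0 • T = T
  rw [translate_zero, one_smul])

/-- Rotating `T + v` gives the rotate of `T`, translated by the rotated `v`. This brings the
condition on `θ` to points of `MotionCover d`. -/
theorem eq_hullMap (hT : IsTiling T) (hper : IsPeriodic T) (y : translationalHull T) (s : Sp d)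
    (x : rotationalHull T)
    (hx : (x : Set (Tile d L)) = rotationMotion (UniversalCover.proj s) • (y : Set (Tile d L))) :
    ∃ a : MotionCover d, x = hullMap hT hper a ∧ a.rot = s := by
  obtain ⟨v, hv⟩ := (IsPeriodic.mem_translationalHull_iff hT hper).1 y.2
  refine ⟨⟨rotationLinear (UniversalCover.proj s) v, s⟩, Subtype.ext ?_, rfl⟩
  change (x : Set (Tile d L)) = motion _ • T
  rw [hx, hv, ← mul_smul]
  congr 1
  refine rigidMotion_ext fun z => ?_
  rw [motion_apply, mul_apply_motion, translate_apply]
  exact map_add (rotationLinear (UniversalCover.proj s)) v z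

/-- The base point of the coset space is written as the value of `θ` at `T`; lifts from `1` require
it to be the class of `1`. -/
theorem mk_one_eq (hT : IsTiling T) (hper : IsPeriodic T)
    {θ : C(rotationalHull T, Sp d ⧸ liftGroup G)}
    (hθ : ∀ a : MotionCover d, θ (hullMap hT hper a) = QuotientGroup.mk a.rot) :
    (QuotientGroup.mk (1 : Sp d) : Sp d ⧸ liftGroup G) = θ (basePointR hT) := by
  rw [← hullMap_one hT hper, hθ, one_rot]

theorem exists_equiv_translationalHull (hT : IsTiling T) (hper : IsPeriodic T)
    (hG : HasPointGroup T G) :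
    ∃ τ : FundamentalGroup (translationalHull T) (basePointT hT) ≃* translationGroup T,
      IsLifting (hullMapT hT hper) τ :=
  exists_fundamentalGroup_equiv (isQuotientMap_hullMapT hT hper hG) _
    hT.isDiscrete_translationGroup (hullMapT_eq_iff hT hper) (hullMapT_one hT hper)

theorem exists_equiv_rotationalHull (hT : IsTiling T) (hper : IsPeriodic T)
    (hG : HasPointGroup T G) :
    ∃ δ : FundamentalGroup (rotationalHull T) (basePointR hT) ≃* liftedSpaceGroup T,
      IsLifting (hullMap hT hper) δ :=
  exists_fundamentalGroup_equiv (isQuotientMap_hullMap hT hper hG) _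
    (isDiscrete_liftedSpaceGroup hT hG) (hullMap_eq_iff hT hper) (hullMap_one hT hper)

theorem exists_equiv_quotient_liftGroup (hG : (G : Set (SO d)).Finite) {x : Sp d ⧸ liftGroup G}
    (hx : QuotientGroup.mk 1 = x) :
    ∃ η : FundamentalGroup (Sp d ⧸ liftGroup G) x ≃* liftGroup G,
      IsLifting (QuotientGroup.mk : Sp d → Sp d ⧸ liftGroup G) η :=
  have := UniversalCover.simplyConnectedSpace (hasContraction_SO d)
  exists_fundamentalGroup_equiv isQuotientMap_quotient_mk' _ (isDiscrete_liftGroup hG)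
    QuotientGroup.eq hx

theorem lifting_map_hullInclusion (hT : IsTiling T) (hper : IsPeriodic T)
    (hG : HasPointGroup T G)
    {τ : FundamentalGroup (translationalHull T) (basePointT hT) ≃* translationGroup T}
    (hτ : IsLifting (hullMapT hT hper) τ)
    {δ : FundamentalGroup (rotationalHull T) (basePointR hT) ≃* liftedSpaceGroup T}
    (hδ : IsLifting (hullMap hT hper) δ) (a) :
    (δ (FundamentalGroup.map (hullInclusion T) (basePointT hT) a) : MotionCover d)
      = ofVec (τ a : Multiplicative (Euc d)) :=
  IsLifting.map_eq (F := hullInclusion T) (η' := δ) hτ hδ (isQuotientMap_hullMapT hT hper hG)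
    hT.isDiscrete_translationGroup (hullMapT_eq_iff hT hper) (hullMapT_one hT hper)
    continuous_ofVec (hullInclusion_hullMapT hT hper) a

theorem lifting_map_orientationMap (hT : IsTiling T) (hper : IsPeriodic T)
    (hG : HasPointGroup T G) {θ : C(rotationalHull T, Sp d ⧸ liftGroup G)}
    (hθ : ∀ a : MotionCover d, θ (hullMap hT hper a) = QuotientGroup.mk a.rot)
    {δ : FundamentalGroup (rotationalHull T) (basePointR hT) ≃* liftedSpaceGroup T}
    (hδ : IsLifting (hullMap hT hper) δ)
    {η : FundamentalGroup (Sp d ⧸ liftGroup G) (θ (basePointR hT)) ≃* liftGroup G}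
    (hη : IsLifting (QuotientGroup.mk : Sp d → Sp d ⧸ liftGroup G) η) (b) :
    (η (FundamentalGroup.map θ (basePointR hT) b) : Sp d) = (δ b : MotionCover d).rot :=
  IsLifting.map_eq (f := rotHom) hδ hη (isQuotientMap_hullMap hT hper hG)
    (isDiscrete_liftedSpaceGroup hT hG) (hullMap_eq_iff hT hper) (hullMap_one hT hper)
    continuous_rot hθ b

theorem exists_translation_loop (hT : IsTiling T) (hper : IsPeriodic T) (hG : HasPointGroup T G)
    {τ : FundamentalGroup (translationalHull T) (basePointT hT) ≃* translationGroup T}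
    (hτ : IsLifting (hullMapT hT hper) τ) (v : translationGroup T) :
    ∃ ℓ : Path (basePointT hT) (basePointT hT), (∀ t : I, (ℓ t : Set (Tile d L)) =
      translationMotion (.ofAdd ((t : ℝ) • (v : Multiplicative (Euc d)).toAdd)) • T) ∧
      τ (loopClass ℓ) = v := by
  let s : C(I, Multiplicative (Euc d)) :=
    ⟨fun t => .ofAdd ((t : ℝ) • (v : Multiplicative (Euc d)).toAdd),
      continuous_ofAdd.comp (continuous_subtype_val.smul continuous_const)⟩
  have h0 : s 0 = 1 := congrArg Multiplicative.ofAdd (zero_smul ℝ _)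
  have h1 : s 1 = v := congrArg Multiplicative.ofAdd (one_smul ℝ _)
  obtain ⟨ℓ, hℓ, hℓv⟩ := hτ.exists_loop (isQuotientMap_hullMapT hT hper hG).continuous
    (hullMapT_eq_iff hT hper) (hullMapT_one hT hper) v s h0 h1
  exact ⟨ℓ, fun t => congrArg Subtype.val (hℓ t), hℓv⟩

/-- An extension by the kernel of the universal covering, transported to `M`. -/
theorem exists_extension_ker {N M A K : Type*} [Group N] [Group M] [Group A] [Group K]
    (S : GroupExtension N A G) (e : M ≃* FibreProduct S.rightHom (liftProj G))
    (k : (UniversalCover.proj : Sp d →* SO d).ker ≃* K) :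
    ∃ C : GroupExtension K M A,
      C.rightHom = (pullbackFst S (liftProj G)).comp e.toMonoidHom :=
  let C := fibreProductExtension S (liftProj G) (liftProj_surjective G)
    (k.symm.trans (kerProjEquivKerLiftProj G))
  ⟨extensionOfEquiv C e (e.symm.toMonoidHom.comp C.inl) _ (fun _ => e.apply_symm_apply _)
    fun _ => rfl, rfl⟩

end FundamentalGroups

end TilingSpace

/-! ### The extensions of the fundamental group of the rotational hull -/

set_option maxHeartbeats 1000000 in
theorem mainTheorem2 {d : ℕ} (hd : 2 ≤ d) {L : Type*} (T : Set (Tile d L)) (hT : IsTiling T)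
    (hper : IsPeriodic T) (G : Subgroup (SO d)) (hG : HasPointGroup T G) :
    -- the translational symmetries form a free abelian group of rank `d`
    Nonempty (translationGroup T ≃* Multiplicative (Fin d → ℤ)) ∧
    -- the standard extension of the positive space group
    ∃ S : GroupExtension (translationGroup T) (positiveSpaceGroup T) G,
      S.inl = translationInclusion T ∧
      (∀ γ, (S.rightHom γ : SO d) = rotationPart (γ : RigidMotion d)) ∧
    -- the orientation map
    ∃ θ : C(rotationalHull T, Sp d ⧸ liftGroup G),
      (∀ (y : translationalHull T) (s : Sp d) (x : rotationalHull T),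
        (x : Set (Tile d L)) = rotationMotion (UniversalCover.proj s) • (y : Set (Tile d L)) →
          θ x = QuotientGroup.mk s) ∧
    -- the identification of the fundamental group of `Ω_t` with the translational symmetries
    ∃ τ : FundamentalGroup (translationalHull T) (basePointT hT) ≃* translationGroup T,
      (∀ v : translationGroup T, ∃ ℓ : Path (basePointT hT) (basePointT hT),
        (∀ t : I, (ℓ t : Set (Tile d L)) =
          translationMotion (.ofAdd ((t : ℝ) • (v : Multiplicative (Euc d)).toAdd)) • T) ∧
        τ (loopClass ℓ) = v) ∧
    -- the identification of the fundamental group of `Sp(d) / G̃` with `G̃`, by lifting of loops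
    ∃ η : FundamentalGroup (Sp d ⧸ liftGroup G) (θ (basePointR hT)) ≃* liftGroup G,
      (∀ (g : liftGroup G) (s : Path (1 : Sp d) (g : Sp d)),
        ∃ ℓ : Path (θ (basePointR hT)) (θ (basePointR hT)),
          (∀ t : I, ℓ t = QuotientGroup.mk (s t)) ∧ η (loopClass ℓ) = g) ∧
    -- the extension that is induced by the fibration `Ω_t → Ω_r → Sp(d) / G̃`
    ∃ R : GroupExtension (translationGroup T)
        (FundamentalGroup (rotationalHull T) (basePointR hT)) (liftGroup G),
      R.inl = (FundamentalGroup.map (hullInclusion T) (basePointT hT)).comp τ.symm.toMonoidHom ∧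
      R.rightHom = η.toMonoidHom.comp (FundamentalGroup.map θ (basePointR hT)) ∧
    -- it is the pullback of the standard extension
    ∃ e : R.Equiv (pullbackExtension S (liftProj G)),
      -- the resulting extension of the positive space group
      (d = 2 → ∃ C : GroupExtension (Multiplicative ℤ)
          (FundamentalGroup (rotationalHull T) (basePointR hT)) (positiveSpaceGroup T),
        C.rightHom = (pullbackFst S (liftProj G)).comp e.toMulEquiv.toMonoidHom) ∧
      (3 ≤ d → ∃ C : GroupExtension (Multiplicative (ZMod 2))
          (FundamentalGroup (rotationalHull T) (basePointR hT)) (positiveSpaceGroup T),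
        C.rightHom = (pullbackFst S (liftProj G)).comp e.toMulEquiv.toMonoidHom) := by
  obtain ⟨θ, hθ⟩ := exists_orientationMap hT hper hG
  have hq1 := mk_one_eq hT hper hθ
  obtain ⟨τ, hτ⟩ := exists_equiv_translationalHull hT hper hG
  obtain ⟨δ, hδ⟩ := exists_equiv_rotationalHull hT hper hG
  obtain ⟨η, hη⟩ := exists_equiv_quotient_liftGroup hG.1.1 hq1
  have k1 := lifting_map_hullInclusion hT hper hG hτ hδ
  have k2 := lifting_map_orientationMap hT hper hG hθ hδ hη
  let S := standardExtension hT hper hG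
  -- End points of lifts, read in the fibre product of `Γ₊` and `G̃`.
  let e₀ := δ.trans (liftedSpaceGroupEquiv hT hper hG)
  have c1 : ∀ n, e₀ (((FundamentalGroup.map (hullInclusion T) (basePointT hT)).comp
      τ.symm.toMonoidHom) n) = (pullbackExtension S (liftProj G)).inl n := by
    intro n
    have h := (k1 (τ.symm n)).trans (by rw [τ.apply_symm_apply])
    refine Subtype.ext (Prod.ext (Subtype.ext ?_) (Subtype.ext ?_))
    · exact (congrArg RotationSemidirect.motion h).trans (RotationSemidirect.motion_ofVec _)
    · exact congrArg RotationSemidirect.rot h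
  have c2 : ∀ b, (pullbackExtension S (liftProj G)).rightHom (e₀ b)
      = (η.toMonoidHom.comp (FundamentalGroup.map θ (basePointR hT))) b :=
    fun b => Subtype.ext (k2 b).symm
  -- The induced sequence is transported from the pullback along `e₀`. The squares `c1` and `c2`
  -- give its exactness and, at once, the isomorphism of extensions.
  refine ⟨IsPeriodic.nonempty_equiv hT hper, S, rfl, fun _ => rfl, θ, ?_, τ,
    exists_translation_loop hT hper hG hτ, η, ?_, extensionOfEquiv _ e₀ _ _ c1 c2, rfl, rfl,
    { e₀ with
      inl_comm := funext c1
      rightHom_comm := funext c2 }, ?_, ?_⟩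
  · intro y s x hx
    obtain ⟨a, rfl, rfl⟩ := eq_hullMap hT hper y s x hx
    exact hθ a
  · intro g s
    exact hη.exists_loop isQuotientMap_quotient_mk'.continuous QuotientGroup.eq hq1 g
      s.toContinuousMap s.source s.target
  · rintro rfl
    obtain ⟨k⟩ := nonempty_ker_proj_two
    exact exists_extension_ker S e₀ k
  · intro hd3
    obtain ⟨k⟩ := nonempty_ker_proj hd3
    exact exists_extension_ker S e₀ k
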